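/- A *$\mu$-component virtual link diagram* is an immersion of $\mu$ ordered, oriented circles in the plane whose only singularities are transverse double points, each of which is marked either as a classical crossing (with an over- and an underpass) or as a virtual crossing. A *welded link* is an equivalence class of virtual link diagrams under welded isotopy, that is, under plane isotopy, the Reidemeister moves R1–R3, the virtual moves VR1–VR4, and the move OC, which moves a strand passing over two other strands across a virtual crossing of these two. The move UC moves a strand passing under two other strands across a virtual crossing of these two. For a positive integer $n$, the $V^n$-move replaces two parallel, equally oriented strands without crossings by the same two strands crossing $2n$ times, alternately in a virtual and in a classical crossing, where at all $n$ classical crossings the same strand is the overpass and the sign is the same. (The inverse of each move is allowed too.) For a $\mu$-component welded link $L$ and $i\neq j$, the ordered linking number $\lambda_{ij}(L)\in\mathbb{Z}$ is the sum of the signs of all classical crossings, in any diagram of $L$, whose overpass belongs to the $i$th and whose underpass belongs to the $j$th component. **Theorem.** Let $L$ and $L'$ be two $\mu$-component welded links. 1. For every positive integer $n$, $L$ and $L'$ have diagrams that are related by a finite sequence of $V^n$-moves, UC-moves and welded isotopies (that is, $L$ and $L'$ are $(V^n+\mathrm{UC})$-equivalent) if and only if $\lambda_{ij}(L)\equiv\lambda_{ij}(L')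 \pmod n$ for all $1\le i\ne j\le\mu$. 2. $L$ and $L'$ have diagrams that are related by a finite sequence of UC-moves and welded isotopies if and only if $\lambda_{ij}(L)=\lambda_{ij}(L')$ for all $1\le i\neq j\le\mu$. -/

import Mathlib

/-!
Virtual link diagrams, welded links, the V^n-move and the UC-move.

A diagram in the plane is recorded in Morse position: it is cut by horizontal lines into slices,
read from bottom to top, each slice containing exactly one cup, one cap or one crossing next to
vertical strands. Plane isotopy of diagrams is generated by the four kinds of moves called
`interchange`, `zigzag`, `capSlide` and `cupSlide` below (exchange of the heights of two distant
events, cancellation of a cup with a cap, passage of a crossing through a maximum or a minimum).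
Every strand carries the name of its component and its orientation.
-/

namespace Welded

/-- A strand crossing a horizontal line: the component it belongs to, and its orientation
(`up = true` if it is oriented upwards). -/
@[ext] structure Strand (ι : Type) where
  color : ι
  up : Bool

namespace Strand

variable {ι : Type}

/-- The same component, traversed in the opposite vertical direction. -/
def rev (x : Strand ι) : Strand ι := ⟨x.color, !x.up⟩

/-- `1` for a strand oriented upwards, `-1` for a strand oriented downwards. -/
def eps (x : Strand ι) : ℤ := if x.up then 1 else -1

end Strand

/-- The kind of a double point. At a double point one strand runs from the bottom left to the
top right; `classical true` means that this strand is the overpass, `classical false` that it is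
the underpass. -/
inductive Kind where
  | virt : Kind
  | classical (risingOver : Bool) : Kind

/-- Exchange the roles of the two strands (that is, of over and under) at a double point. -/
def Kind.flip : Kind → Kind
  | .virt => .virt
  | .classical o => .classical (!o)

/-- The elementary pieces of a diagram. -/
inductive Piece (ι : Type) where
  /-- a local minimum, opening the strands `x, x.rev` (from left to right) -/
  | cup (x : Strand ι) : Piece ι
  /-- a local maximum, closing the strands `x, x.rev` (from left to right) -/
  | cap (x : Strand ι) : Piece ι
  /-- a double point of `x`, running from bottom left to top right, and `y`, running from bottom
  right to top left -/
  | cross (k : Kind) (x y : Strand ι) : Piece ι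

namespace Piece

variable {ι : Type}

/-- The strands at the bottom of a piece, from left to right. -/
def bot : Piece ι → List (Strand ι)
  | cup _ => []
  | cap x => [x, x.rev]
  | cross _ x y => [x, y]

/-- The strands at the top of a piece, from left to right. -/
def top : Piece ι → List (Strand ι)
  | cup x => [x, x.rev]
  | cap _ => []
  | cross _ x y => [y, x]

/-- The sign of a classical crossing if its overpass belongs to component `i` and its underpass
to component `j`; zero for all other pieces. A crossing of two upward strands is positive if the
overpass is the strand running from bottom left to top right. -/
def linking [DecidableEq ι] (i j : ι) : Piece ι → ℤ
  | cross (.classical true) x y =>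
      if x.color = i ∧ y.color = j then x.eps * y.eps else 0
  | cross (.classical false) x y =>
      if y.color = i ∧ x.color = j then -(x.eps * y.eps) else 0
  | _ => 0

end Piece

/-- A horizontal slice: a piece with vertical strands on its left and on its right. -/
structure Slice (ι : Type) where
  left : List (Strand ι)
  piece : Piece ι
  right : List (Strand ι)

namespace Slice

variable {ι : Type}

def bot (e : Slice ι) : List (Strand ι) := e.left ++ e.piece.bot ++ e.right

def top (e : Slice ι) : List (Strand ι) := e.left ++ e.piece.top ++ e.right

/-- Add vertical strands on both sides of a slice. -/
def widen (a b : List (Strand ι)) (e : Slice ι) : Slice ι := ⟨a ++ e.left, e.piece, e.right ++ b⟩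

end Slice

/-- A stack of slices, read from bottom to top. -/
abbrev Stack (ι : Type) := List (Slice ι)

namespace Stack

variable {ι : Type}

/-- The slices fit together, from the bottom strands `s` to the top strands `t`. -/
def Fits : List (Strand ι) → Stack ι → List (Strand ι) → Prop
  | s, [], t => s = t
  | s, e :: w, t => e.bot = s ∧ Fits e.top w t

/-- The sum of the signs of the classical crossings whose overpass belongs to component `i` and
whose underpass belongs to component `j`. -/
def linking [DecidableEq ι] (i j : ι) (w : Stack ι) : ℤ :=
  (w.map fun e => e.piece.linking i j).sum

/-- The points where a diagram meets the horizontal lines are recorded by pairs `(t, p)`: the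
point number `p` from the left on the line below slice number `t` (both counted from zero).
`Joined w P Q` says that `P` and `Q` are joined by an arc of the diagram inside one slice. -/
inductive Joined (w : Stack ι) : ℕ × ℕ → ℕ × ℕ → Prop
  | left {t p : ℕ} {e : Slice ι} (he : w[t]? = some e) (hp : p < e.left.length) :
      Joined w (t, p) (t + 1, p)
  | right {t p : ℕ} {e : Slice ι} (he : w[t]? = some e) (hp : p < e.right.length) :
      Joined w (t, e.left.length + e.piece.bot.length + p)
        (t + 1, e.left.length + e.piece.top.length + p)
  | cup {t : ℕ} {a b : List (Strand ι)} {x : Strand ι} (he : w[t]? = some ⟨a, .cup x, b⟩) :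
      Joined w (t + 1, a.length) (t + 1, a.length + 1)
  | cap {t : ℕ} {a b : List (Strand ι)} {x : Strand ι} (he : w[t]? = some ⟨a, .cap x, b⟩) :
      Joined w (t, a.length) (t, a.length + 1)
  | rising {t : ℕ} {a b : List (Strand ι)} {k : Kind} {x y : Strand ι}
      (he : w[t]? = some ⟨a, .cross k x y, b⟩) :
      Joined w (t, a.length) (t + 1, a.length + 1)
  | falling {t : ℕ} {a b : List (Strand ι)} {k : Kind} {x y : Strand ι}
      (he : w[t]? = some ⟨a, .cross k x y, b⟩) :
      Joined w (t, a.length + 1) (t + 1, a.length)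

/-- The point `P` is on the diagram and belongs to component `i`. -/
def HasColor (w : Stack ι) (i : ι) (P : ℕ × ℕ) : Prop :=
  ∃ e x, w[P.1]? = some e ∧ e.bot[P.2]? = some x ∧ x.color = i

/-- The strands named `i` form exactly one closed curve. -/
def OneCircle (w : Stack ι) (i : ι) : Prop :=
  ∃ P, HasColor w i P ∧ ∀ Q, HasColor w i Q → Relation.EqvGen (Joined w) P Q

end Stack

/-- A closed diagram: an immersed family of oriented circles in the plane, each with a name,
with classical and virtual crossings. -/
structure Diagram (ι : Type) where
  stack : Stack ι
  fits : stack.Fits [] []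

section Moves

variable {ι : Type}

/-- Three strands `x, y, z` (from left to right) that cross pairwise, the crossing of `x` and `y`
coming first; `p`, `q`, `r` are the kinds of the crossings `xy`, `xz`, `yz`. -/
def triangleLeft (p q r : Kind) (x y z : Strand ι) : Stack ι :=
  [⟨[], .cross p x y, [z]⟩, ⟨[y], .cross q x z, []⟩, ⟨[], .cross r y z, [x]⟩]

/-- The same three strands, the strand `x` or `z` having been moved across the crossing of the
other two. -/
def triangleRight (p q r : Kind) (x y z : Strand ι) : Stack ι :=
  [⟨[x], .cross r y z, []⟩, ⟨[], .cross q x z, [y]⟩, ⟨[z], .cross p x y, []⟩]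

/-- The local moves generating plane isotopy and welded isotopy, for all orientations and all
names of the strands. -/
inductive WeldedMove : Stack ι → Stack ι → Prop
  -- plane isotopy
  | interchange (g h : Piece ι) (m : List (Strand ι)) :
      WeldedMove [⟨[], g, m ++ h.bot⟩, ⟨g.top ++ m, h, []⟩]
        [⟨g.bot ++ m, h, []⟩, ⟨[], g, m ++ h.top⟩]
  | zigzagLeft (x : Strand ι) :
      WeldedMove [⟨[x], .cup x.rev, []⟩, ⟨[], .cap x, [x]⟩] []
  | zigzagRight (x : Strand ι) :
      WeldedMove [⟨[], .cup x, [x]⟩, ⟨[x], .cap x.rev, []⟩] []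
  | capSlide (k : Kind) (x y : Strand ι) :
      WeldedMove [⟨[x], .cross k y x.rev, []⟩, ⟨[], .cap x, [y]⟩]
        [⟨[], .cross k.flip x y, [x.rev]⟩, ⟨[y], .cap x, []⟩]
  | cupSlide (k : Kind) (x y : Strand ι) :
      WeldedMove [⟨[y], .cup x, []⟩, ⟨[], .cross k y x, [x.rev]⟩]
        [⟨[], .cup x, [y]⟩, ⟨[x], .cross k.flip x.rev y, []⟩]
  -- R1 and VR1: a curl at a maximum or at a minimum
  | R1cap (o : Bool) (x : Strand ι) :
      WeldedMove [⟨[], .cross (.classical o) x x.rev, []⟩, ⟨[], .cap x.rev, []⟩]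
        [⟨[], .cap x, []⟩]
  | R1cup (o : Bool) (x : Strand ι) :
      WeldedMove [⟨[], .cup x, []⟩, ⟨[], .cross (.classical o) x x.rev, []⟩]
        [⟨[], .cup x.rev, []⟩]
  | VR1cap (x : Strand ι) :
      WeldedMove [⟨[], .cross .virt x x.rev, []⟩, ⟨[], .cap x.rev, []⟩] [⟨[], .cap x, []⟩]
  | VR1cup (x : Strand ι) :
      WeldedMove [⟨[], .cup x, []⟩, ⟨[], .cross .virt x x.rev, []⟩] [⟨[], .cup x.rev, []⟩]
  -- R2 (the same strand is over at both crossings) and VR2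
  | R2 (o : Bool) (x y : Strand ι) :
      WeldedMove [⟨[], .cross (.classical o) x y, []⟩, ⟨[], .cross (.classical (!o)) y x, []⟩] []
  | VR2 (x y : Strand ι) :
      WeldedMove [⟨[], .cross .virt x y, []⟩, ⟨[], .cross .virt y x, []⟩] []
  -- R3: the condition says that the strands are at three different heights, that is, that it is
  -- not the case that each of the three strands passes over the next one cyclically
  | R3 (p q r : Bool) (h : p = r → q = p) (x y z : Strand ι) :
      WeldedMove (triangleLeft (.classical p) (.classical q) (.classical r) x y z)
        (triangleRight (.classical p) (.classical q) (.classical r) x y z)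
  | VR3 (x y z : Strand ι) :
      WeldedMove (triangleLeft .virt .virt .virt x y z) (triangleRight .virt .virt .virt x y z)
  -- VR4: a strand with two virtual crossings moves across a classical crossing
  | VR4x (o : Bool) (x y z : Strand ι) :
      WeldedMove (triangleLeft .virt .virt (.classical o) x y z)
        (triangleRight .virt .virt (.classical o) x y z)
  | VR4y (o : Bool) (x y z : Strand ι) :
      WeldedMove (triangleLeft .virt (.classical o) .virt x y z)
        (triangleRight .virt (.classical o) .virt x y z)
  | VR4z (o : Bool) (x y z : Strand ι) :
      WeldedMove (triangleLeft (.classical o) .virt .virt x y z)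
        (triangleRight (.classical o) .virt .virt x y z)
  -- OC: a strand passing over two strands moves across the virtual crossing of these
  | OCx (x y z : Strand ι) :
      WeldedMove (triangleLeft (.classical true) (.classical true) .virt x y z)
        (triangleRight (.classical true) (.classical true) .virt x y z)
  | OCy (x y z : Strand ι) :
      WeldedMove (triangleLeft (.classical false) .virt (.classical true) x y z)
        (triangleRight (.classical false) .virt (.classical true) x y z)
  | OCz (x y z : Strand ι) :
      WeldedMove (triangleLeft .virt (.classical false) (.classical false) x y z)
        (triangleRight .virt (.classical false) (.classical false) x y z)

/-- UC: a strand (`x`, `y` or `z`) passing under two strands moves across the virtual crossing of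
these. -/
inductive UCMove : Stack ι → Stack ι → Prop
  | UCx (x y z : Strand ι) :
      UCMove (triangleLeft (.classical false) (.classical false) .virt x y z)
        (triangleRight (.classical false) (.classical false) .virt x y z)
  | UCy (x y z : Strand ι) :
      UCMove (triangleLeft (.classical true) .virt (.classical false) x y z)
        (triangleRight (.classical true) .virt (.classical false) x y z)
  | UCz (x y z : Strand ι) :
      UCMove (triangleLeft .virt (.classical true) (.classical true) x y z)
        (triangleRight .virt (.classical true) (.classical true) x y z)

/-- The `V^n`-move: two parallel strands with the same orientation are replaced by the two
strands crossing `2 * n` times, alternately in a virtual crossing and in a classical one, the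
overpass being the same strand and the sign being the same at all `n` classical crossings
(`o` says which). -/
inductive VMove (n : ℕ) : Stack ι → Stack ι → Prop
  | mk (o : Bool) (x y : Strand ι) (hx : x.up = true) (hy : y.up = true) :
      VMove n []
        (List.replicate n
          [⟨[], .cross .virt x y, []⟩, ⟨[], .cross (.classical o) y x, []⟩]).flatten

/-- The local move `R` is applied to one place of the diagram `D`, the rest being unchanged. -/
def Step (R : Stack ι → Stack ι → Prop) (D D' : Diagram ι) : Prop :=
  ∃ (a b : List (Strand ι)) (u v l r : Stack ι), R l r ∧
    D.stack = u ++ l.map (Slice.widen a b) ++ v ∧ D'.stack = u ++ r.map (Slice.widen a b) ++ v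

/-- Two diagrams are related by a finite sequence of moves `R` and their inverses. -/
def Related (R : Stack ι → Stack ι → Prop) : Diagram ι → Diagram ι → Prop :=
  Relation.EqvGen (Step R)

end Moves

section Invariance

variable {ι : Type} [DecidableEq ι]

theorem WeldedMove.linking_eq {i j : ι} (hij : i ≠ j) {l r : Stack ι} (h : WeldedMove l r) :
    l.linking i j = r.linking i j := by
  have key : ∀ x : Strand ι, ¬ (x.color = i ∧ x.color = j) :=
    fun x hx => hij (hx.1.symm.trans hx.2)
  cases h with
  | interchange g h m => simp [Stack.linking, add_comm]
  | zigzagLeft x => simp [Stack.linking, Piece.linking]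
  | zigzagRight x => simp [Stack.linking, Piece.linking]
  | capSlide k x y =>
    rcases k with _ | (_ | _) <;>
      cases hx : x.up <;> cases hy : y.up <;>
      simp [Stack.linking, Piece.linking, Kind.flip, Strand.rev, Strand.eps, hx, hy]
  | cupSlide k x y =>
    rcases k with _ | (_ | _) <;>
      cases hx : x.up <;> cases hy : y.up <;>
      simp [Stack.linking, Piece.linking, Kind.flip, Strand.rev, Strand.eps, hx, hy]
  | R1cap o x =>
    cases o <;> simp [Stack.linking, Piece.linking, Strand.rev, key]
  | R1cup o x =>
    cases o <;> simp [Stack.linking, Piece.linking, Strand.rev, key]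
  | VR1cap x => simp [Stack.linking, Piece.linking]
  | VR1cup x => simp [Stack.linking, Piece.linking]
  | R2 o x y =>
    cases o <;> simp [Stack.linking, Piece.linking] <;> split_ifs <;> ring
  | VR2 x y => simp [Stack.linking, Piece.linking]
  | R3 p q r h x y z =>
    simp only [Stack.linking, triangleLeft, triangleRight, List.map_cons, List.map_nil,
      List.sum_cons, List.sum_nil]; ring
  | _ =>
    simp only [Stack.linking, triangleLeft, triangleRight, List.map_cons, List.map_nil,
      List.sum_cons, List.sum_nil]; ring

theorem Stack.linking_append (i j : ι) (u v : Stack ι) :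
    Stack.linking i j (u ++ v) = u.linking i j + v.linking i j := by
  simp [Stack.linking]

theorem Stack.linking_widen (i j : ι) (a b : List (Strand ι)) (w : Stack ι) :
    Stack.linking i j (w.map (Slice.widen a b)) = w.linking i j := by
  simp [Stack.linking, Slice.widen, Function.comp_def]

theorem Related.linking_eq {i j : ι} (hij : i ≠ j) {D D' : Diagram ι}
    (h : Related WeldedMove D D') : D.stack.linking i j = D'.stack.linking i j := by
  induction h with
  | rel D D' h =>
    obtain ⟨a, b, u, v, l, r, hlr, h1, h2⟩ := h
    rw [h1, h2]
    simp only [Stack.linking_append, Stack.linking_widen, hlr.linking_eq hij]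
  | refl D => rfl
  | symm D D' _ ih => exact ih.symm
  | trans D D' D'' _ _ ih ih' => exact ih.trans ih'

end Invariance

/-- A virtual link diagram with `μ` ordered oriented components. (None of the moves above changes
the circles and their names, so in a sequence of moves that starts from such a diagram all
diagrams are again of this form.) -/
structure LinkDiagram (μ : ℕ) extends Diagram (Fin μ) where
  oneCircle : ∀ i, stack.OneCircle i

instance weldedSetoid (μ : ℕ) : Setoid (LinkDiagram μ) :=
  (Relation.EqvGen.setoid (Step (WeldedMove (ι := Fin μ)))).comap LinkDiagram.toDiagram

/-- A `μ`-component welded link: a virtual link diagram up to welded isotopy. -/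
def WeldedLink (μ : ℕ) : Type := Quotient (weldedSetoid μ)

namespace WeldedLink

variable {μ : ℕ}

/-- The diagram `D` represents the welded link `L`. -/
def IsDiagramOf (D : LinkDiagram μ) (L : WeldedLink μ) : Prop :=
  (Quotient.mk (weldedSetoid μ) D : WeldedLink μ) = L

/-- The ordered linking number `λ_ij`, for `i ≠ j`: the value of any diagram. -/
def linking (L : WeldedLink μ) (i j : Fin μ) (hij : i ≠ j) : ℤ :=
  Quotient.lift (s := weldedSetoid μ) (fun D : LinkDiagram μ => D.stack.linking i j)
    (fun _ _ h => Related.linking_eq hij h) L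

/-- `L` and `L'` have diagrams related by moves `R`. -/
def EquivUpTo (R : Stack (Fin μ) → Stack (Fin μ) → Prop) (L L' : WeldedLink μ) : Prop :=
  ∃ D D' : LinkDiagram μ, IsDiagramOf D L ∧ IsDiagramOf D' L' ∧
    Related R D.toDiagram D'.toDiagram

/-- Equivalence up to `V^n`-moves, UC-moves and welded Reidemeister moves. -/
def VnUCEquivalent (n : ℕ) (L L' : WeldedLink μ) : Prop :=
  EquivUpTo (fun l r => WeldedMove l r ∨ UCMove l r ∨ VMove n l r) L L'

/-- Equivalence up to UC-moves and welded Reidemeister moves. -/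
def UCEquivalent (L L' : WeldedLink μ) : Prop :=
  EquivUpTo (fun l r => WeldedMove l r ∨ UCMove l r) L L'

end WeldedLink

end Welded

/-!
The moves OC and UC together say that the *arrows* of a diagram almost commute. An arrow from a
strand `x` (the overpass, its tail) to a strand `y` (the underpass, its head) is a classical
crossing completed by a virtual one, so that both strands return to their places. Virtual crossings
are coherent: a stack of them is determined by the strands at its bottom and at its top, if these
are distinct (`Vir.coherence`). Hence a braid-like diagram is a product of arrows followed by a
virtual permutation (`Cr.fus_word`), and an arrow does not depend on the virtual path along which
its strands are brought together (`arr_eq`). OC lets arrows with a common tail commute, UC arrows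
with a common head, and then R3 consecutive arrows; so any two arrows commute, unless they join the
same two strands in opposite directions (`Comm.of_ne`).

Above a family of local minima the remaining case is harmless. An end of an arrow which is the
lowest one may be moved to the other side of a minimum, which changes the sign
(`BFus.conv_head`, `BFus.conv_tail`), and an arrow between the two sides of one minimum vanishes by
R1 (`BFus.kill`). If every component has just one minimum, all tails are moved to the upward
sides and all heads to the downward sides, and arrows of a component with itself vanish
(`exists_normal`). The resulting arrows commute, so that only their numbers count. These are
the linking numbers up to sign (`linking_real`). A `V^n`-move cancels `n` equal arrows, whence
the numbers matter modulo `n` only (`BEqv.of_modEq`).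

It remains to reach a diagram in which each component has one minimum and one maximum.
The minima are moved to the bottom and the maxima to the top (`exists_plat`). Every arc from a
minimum is given a name of its own, and the names are transported upwards. As long as some maximum
joins two arcs of different names, all ends of arrows are moved away from the two strands that
meet there (`exists_one_sided`), the maximum slides down through virtual crossings only, and it
cancels with one of the two minima (`exists_reduction`). In the end each circle has one minimum and
one maximum (`exists_closed_plat`). Different circles carry different components: all moves
transport a refinement of the names of the components (`Fus.lift`), and the original diagram has
one circle for each component (`Stack.OneCircle.color_eq`).

That the linking numbers are invariant is a direct verification on the moves
(`Related.linking_modEq`).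
-/

namespace Welded

open Stack

variable {ι κ : Type}

/-! ### Stacks, widening and typed equivalence -/

/-- Add the vertical strands `a` on the left and `b` on the right of all slices of a stack. -/
def wd (a b : List (Strand ι)) (w : Stack ι) : Stack ι := w.map (Slice.widen a b)

@[simp] theorem wd_nil (a b : List (Strand ι)) : wd a b [] = [] := rfl

@[simp] theorem wd_cons (a b : List (Strand ι)) (e : Slice ι) (w : Stack ι) :
    wd a b (e :: w) = ⟨a ++ e.left, e.piece, e.right ++ b⟩ :: wd a b w := rfl

@[simp] theorem wd_append (a b : List (Strand ι)) (u v : Stack ι) :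
    wd a b (u ++ v) = wd a b u ++ wd a b v := by simp [wd]

@[simp] theorem wd_wd (a b a' b' : List (Strand ι)) (w : Stack ι) :
    wd a b (wd a' b' w) = wd (a ++ a') (b' ++ b) w := by
  simp [wd, Slice.widen, Function.comp_def]

@[simp] theorem wd_id (w : Stack ι) : wd [] [] w = w := by
  induction w with
  | nil => rfl
  | cons e w ih => simp [ih]

theorem Stack.fits_append {s t : List (Strand ι)} {u v : Stack ι} :
    Fits s (u ++ v) t ↔ ∃ m, Fits s u m ∧ Fits m v t := by
  induction u generalizing s with
  | nil => simp [Fits]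
  | cons e u ih => simp [Fits, ih, and_assoc]

theorem Stack.Fits.comp {s m t : List (Strand ι)} {u v : Stack ι} (hu : Fits s u m)
    (hv : Fits m v t) : Fits s (u ++ v) t := fits_append.2 ⟨m, hu, hv⟩

theorem Stack.Fits.unique {s t t' : List (Strand ι)} {w : Stack ι} (h : Fits s w t)
    (h' : Fits s w t') : t = t' := by
  induction w generalizing s with
  | nil => exact h.symm.trans h'
  | cons e w ih => exact ih h.2 h'.2

theorem Stack.Fits.widen {s t : List (Strand ι)} {w : Stack ι} (h : Fits s w t)
    (a b : List (Strand ι)) : Fits (a ++ s ++ b) (wd a b w) (a ++ t ++ b) := by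
  induction w generalizing s with
  | nil => cases h; rfl
  | cons e w ih =>
    refine ⟨?_, ?_⟩
    · rw [← h.1]; simp [Slice.bot, Slice.widen]
    · have := ih h.2
      simpa [Slice.top, Slice.widen, wd] using this

theorem Stack.Fits.widenL {s t : List (Strand ι)} {w : Stack ι} (h : Fits s w t)
    (a : List (Strand ι)) : Fits (a ++ s) (wd a [] w) (a ++ t) := by
  simpa using Fits.widen h a []

theorem Stack.Fits.widenR {s t : List (Strand ι)} {w : Stack ι} (h : Fits s w t)
    (b : List (Strand ι)) : Fits (s ++ b) (wd [] b w) (t ++ b) := by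
  simpa using Fits.widen h [] b

/-- One application of a local move of `R` to a stack with the strands `s` at the bottom. Only the
part below the place of the move is required to fit together, so that the relation is stable under
adding arbitrary slices on top. -/
def LocalStep (R : Stack ι → Stack ι → Prop) (s : List (Strand ι)) (w w' : Stack ι) : Prop :=
  ∃ (a b p q : List (Strand ι)) (u v l r : Stack ι), R l r ∧ Fits p l q ∧ Fits p r q ∧
    Fits s u (a ++ p ++ b) ∧ w = u ++ wd a b l ++ v ∧ w' = u ++ wd a b r ++ v

/-- Equivalence of stacks with the strands `s` at the bottom under local moves of `R`. -/
def Eqv (R : Stack ι → Stack ι → Prop) (s : List (Strand ι)) : Stack ι → Stack ι → Prop :=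
  Relation.EqvGen (LocalStep R s)

namespace Eqv

variable {R R' : Stack ι → Stack ι → Prop} {s t : List (Strand ι)} {u v w w' w'' : Stack ι}

theorem refl (w : Stack ι) : Eqv R s w w := Relation.EqvGen.refl w

theorem of_eq (h : w = w') : Eqv R s w w' := h ▸ refl w

theorem symm (h : Eqv R s w w') : Eqv R s w' w := Relation.EqvGen.symm _ _ h

theorem trans (h : Eqv R s w w') (h' : Eqv R s w' w'') : Eqv R s w w'' :=
  Relation.EqvGen.trans _ _ _ h h'

theorem of_move (h : R w w') (h1 : Fits s w t) (h2 : Fits s w' t) : Eqv R s w w' :=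
  .rel _ _ ⟨[], [], s, t, [], [], w, w', h, h1, h2, by simp [Fits], by simp, by simp⟩

theorem mono (hR : ∀ l r, R l r → R' l r) (h : Eqv R s w w') : Eqv R' s w w' := by
  induction h with
  | rel w w' h =>
    obtain ⟨a, b, p, q, u, v, l, r, h, h'⟩ := h
    exact .rel _ _ ⟨a, b, p, q, u, v, l, r, hR _ _ h, h'⟩
  | refl w => exact refl w
  | symm _ _ _ ih => exact ih.symm
  | trans _ _ _ _ _ ih ih' => exact ih.trans ih'

theorem right (h : Eqv R s w w') (v : Stack ι) : Eqv R s (w ++ v) (w' ++ v) := by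
  induction h with
  | rel w w' h =>
    obtain ⟨a, b, p, q, u, v', l, r, h, h1, h2, h3, h4, h5⟩ := h
    exact .rel _ _ ⟨a, b, p, q, u, v' ++ v, l, r, h, h1, h2, h3, by simp [h4], by simp [h5]⟩
  | refl w => exact refl _
  | symm _ _ _ ih => exact ih.symm
  | trans _ _ _ _ _ ih ih' => exact ih.trans ih'

theorem left (hu : Fits s u t) (h : Eqv R t w w') : Eqv R s (u ++ w) (u ++ w') := by
  induction h with
  | rel w w' h =>
    obtain ⟨a, b, p, q, u', v', l, r, h, h1, h2, h3, h4, h5⟩ := h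
    exact .rel _ _ ⟨a, b, p, q, u ++ u', v', l, r, h, h1, h2, Fits.comp hu h3, by simp [h4],
      by simp [h5]⟩
  | refl w => exact refl _
  | symm _ _ _ ih => exact ih.symm
  | trans _ _ _ _ _ ih ih' => exact ih.trans ih'

theorem mid (hu : Fits s u t) (h : Eqv R t w w') (v : Stack ι) :
    Eqv R s (u ++ (w ++ v)) (u ++ (w' ++ v)) := left hu (h.right v)

theorem widen (h : Eqv R s w w') (a b : List (Strand ι)) :
    Eqv R (a ++ s ++ b) (wd a b w) (wd a b w') := by
  induction h with
  | rel w w' h =>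
    obtain ⟨a', b', p, q, u, v, l, r, h, h1, h2, h3, h4, h5⟩ := h
    refine .rel _ _ ⟨a ++ a', b' ++ b, p, q, wd a b u, wd a b v, l, r, h, h1, h2, ?_, by simp [h4],
      by simp [h5]⟩
    have := Fits.widen h3 a b
    simpa using this
  | refl w => exact refl _
  | symm _ _ _ ih => exact ih.symm
  | trans _ _ _ _ _ ih ih' => exact ih.trans ih'

theorem widenL (h : Eqv R s w w') (a : List (Strand ι)) :
    Eqv R (a ++ s) (wd a [] w) (wd a [] w') := by simpa using h.widen a []

theorem widenR (h : Eqv R s w w') (b : List (Strand ι)) :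
    Eqv R (s ++ b) (wd [] b w) (wd [] b w') := by simpa using h.widen [] b

theorem fits_iff (h : Eqv R s w w') : ∀ t, Fits s w t ↔ Fits s w' t := by
  induction h with
  | rel w w' h =>
    obtain ⟨a, b, p, q, u, v, l, r, h, h1, h2, h3, rfl, rfl⟩ := h
    have key : ∀ l, Fits p l q → ∀ t, (Fits s (u ++ wd a b l ++ v) t ↔ Fits (a ++ q ++ b) v t) := by
      intro l hl t
      constructor
      · intro h
        obtain ⟨m, h, hv⟩ := fits_append.1 h
        rwa [(Fits.comp h3 (Fits.widen hl a b)).unique h]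
      · intro h
        exact Fits.comp (Fits.comp h3 (Fits.widen hl a b)) h
    intro t
    rw [key l h1, key r h2]
  | refl w => exact fun t => Iff.rfl
  | symm _ _ _ ih => exact fun t => (ih t).symm
  | trans _ _ _ _ _ ih ih' => exact fun t => (ih t).trans (ih' t)

theorem fits (h : Eqv R s w w') (hw : Fits s w t) : Fits s w' t := (h.fits_iff t).1 hw

/-- The stacks between the two ends are closed diagrams too, because moves preserve `Fits`. -/
theorem related {D D' : Diagram ι} (h : Eqv R [] D.stack D'.stack) : Related R D D' := by
  suffices ∀ w w', Eqv R [] w w' → ∀ (hw : Fits [] w []) (hw' : Fits [] w' []),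
      Related R ⟨w, hw⟩ ⟨w', hw'⟩ from this _ _ h D.fits D'.fits
  intro w w' h
  induction h with
  | rel w w' h =>
    intro hw hw'
    obtain ⟨a, b, p, q, u, v, l, r, h, h1, h2, h3, h4, h5⟩ := h
    exact .rel _ _ ⟨a, b, u, v, l, r, h, h4, h5⟩
  | refl w => exact fun _ _ => .refl _
  | symm _ _ _ ih => exact fun hw hw' => .symm _ _ (ih hw' hw)
  | trans _ _ _ h _ ih ih' =>
    exact fun hw hw' => .trans _ _ _ (ih hw (fits h hw)) (ih' (fits h hw) hw')

end Eqv

/-- The moves of fused links: welded isotopy together with the UC-move. -/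
def FusedMove (l r : Stack ι) : Prop := WeldedMove l r ∨ UCMove l r

/-- Equivalence of stacks with the strands `s` at the bottom under welded isotopy and UC-moves. -/
abbrev Fus (s : List (Strand ι)) (w w' : Stack ι) : Prop := Eqv FusedMove s w w'

theorem Fus.of_welded {s t : List (Strand ι)} {w w' : Stack ι} (h : WeldedMove w w')
    (h1 : Fits s w t) (h2 : Fits s w' t) : Fus s w w' := Eqv.of_move (.inl h) h1 h2

/-! ### Far commutativity -/

/-- A slice and another one to its right exchange their heights. -/
theorem exchange_slices (e f : Slice ι) : Fus (e.bot ++ f.bot)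
    [⟨e.left, e.piece, e.right ++ f.bot⟩, ⟨e.top ++ f.left, f.piece, f.right⟩]
    [⟨e.bot ++ f.left, f.piece, f.right⟩, ⟨e.left, e.piece, e.right ++ f.top⟩] := by
  obtain ⟨a, g, b⟩ := e
  obtain ⟨c, h, d⟩ := f
  have := (Fus.of_welded (WeldedMove.interchange g h (b ++ c))
    (s := g.bot ++ (b ++ c) ++ h.bot) (t := g.top ++ (b ++ c) ++ h.top)
    (by simp [Fits, Slice.bot, Slice.top]) (by simp [Fits, Slice.bot, Slice.top])).widen a d
  simpa [Slice.bot, Slice.top] using this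

theorem exchange_slice_stack (e : Slice ι) {t t' : List (Strand ι)} {v : Stack ι}
    (hv : Fits t v t') : Fus (e.bot ++ t)
      (⟨e.left, e.piece, e.right ++ t⟩ :: wd e.top [] v)
      (wd e.bot [] v ++ [⟨e.left, e.piece, e.right ++ t'⟩]) := by
  induction v generalizing t with
  | nil => cases hv; exact Eqv.refl _
  | cons f v ih =>
    obtain ⟨rfl, hv⟩ := hv
    have h1 := (exchange_slices e f).right (wd e.top [] v)
    have h2 := Eqv.left (u := [⟨e.bot ++ f.left, f.piece, f.right⟩]) (s := e.bot ++ f.bot)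
      (by simp [Fits, Slice.bot, Slice.top]) (ih hv)
    simp only [wd_cons, List.append_nil]
    exact h1.trans h2

/-- Two stacks next to each other may be stacked in either order. -/
theorem exchange {s s' t t' : List (Strand ι)} {u v : Stack ι} (hu : Fits s u s')
    (hv : Fits t v t') :
    Fus (s ++ t) (wd [] t u ++ wd s' [] v) (wd s [] v ++ wd [] t' u) := by
  induction u generalizing s with
  | nil => cases hu; simp; exact Eqv.refl _
  | cons e u ih =>
    obtain ⟨rfl, hu⟩ := hu
    have h1 := Eqv.left (u := [⟨e.left, e.piece, e.right ++ t⟩]) (s := e.bot ++ t)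
      (by simp [Fits, Slice.bot, Slice.top]) (ih hu)
    have h2 := (exchange_slice_stack e hv).right (wd [] t' u)
    refine .trans h1 ?_
    simpa using h2

/-! ### Sliding strands through virtual crossings -/

/-- The strand `z` moves from the left of the strands `a` to their right, crossing them
virtually. -/
def sl (z : Strand ι) : List (Strand ι) → Stack ι
  | [] => []
  | x :: a => ⟨[], .cross .virt z x, a⟩ :: wd [x] [] (sl z a)

theorem sl_fits (z : Strand ι) (a : List (Strand ι)) : Fits (z :: a) (sl z a) (a ++ [z]) := by
  induction a with
  | nil => rfl
  | cons x a ih =>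
    refine ⟨by simp [Slice.bot, Piece.bot], ?_⟩
    simpa [Slice.top, Piece.top] using Fits.widenL ih [x]

theorem sl_append (z : Strand ι) (a b : List (Strand ι)) :
    sl z (a ++ b) = wd [] b (sl z a) ++ wd a [] (sl z b) := by
  induction a with
  | nil => simp [sl]
  | cons x a ih => simp [sl, ih]

theorem virt_cancel (x y : Strand ι) :
    Fus [x, y] [⟨[], .cross .virt x y, []⟩, ⟨[], .cross .virt y x, []⟩] [] :=
  .of_welded (.VR2 x y) (t := [x, y]) (by simp [Fits, Slice.bot, Slice.top, Piece.bot, Piece.top])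
    (by simp [Fits])

/-- The moves VR3 and VR4 let crossings pass through a virtual strand, the slides let minima and
maxima pass. -/
theorem sl_natural_piece (z : Strand ι) (g : Piece ι) :
    Fus (z :: g.bot) (⟨[z], g, []⟩ :: sl z g.top) (sl z g.bot ++ [⟨[], g, [z]⟩]) := by
  cases g with
  | cup x =>
    have h1 := Fus.of_welded (.cupSlide .virt x z) (s := [z]) (t := [x, z, x.rev])
      (by simp [Fits, Slice.bot, Slice.top, Piece.bot, Piece.top])
      (by simp [Fits, Slice.bot, Slice.top, Piece.bot, Piece.top])
    have h2 := h1.right [⟨[x], .cross .virt z x.rev, []⟩]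
    have h3 := Eqv.left (u := [⟨[], .cup x, [z]⟩]) (s := [z])
      (t := [x] ++ [x.rev, z])
      (by simp [Fits, Slice.bot, Slice.top, Piece.bot, Piece.top])
      ((virt_cancel x.rev z).widenL [x])
    simpa [sl, Piece.bot, Piece.top] using h2.trans h3
  | cap x =>
    have h1 := Fus.of_welded (.capSlide .virt x z) (s := [x, z, x.rev]) (t := [z])
      (by simp [Fits, Slice.bot, Slice.top, Piece.bot, Piece.top])
      (by simp [Fits, Slice.bot, Slice.top, Piece.bot, Piece.top])
    have h2 := Eqv.left (u := [⟨[], .cross .virt z x, [x.rev]⟩]) (s := [z, x, x.rev])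
      (by simp [Fits, Slice.bot, Slice.top, Piece.bot, Piece.top]) h1
    have h3 := ((virt_cancel z x).widenR [x.rev]).right [⟨[z], .cap x, []⟩]
    simpa [sl, Piece.bot, Piece.top] using (h2.trans h3).symm
  | cross k x y =>
    have h : WeldedMove (triangleLeft .virt .virt k z x y) (triangleRight .virt .virt k z x y) := by
      cases k
      · exact .VR3 _ _ _
      · exact .VR4x _ _ _ _
    have := Fus.of_welded h (s := [z, x, y]) (t := [y, x, z])
      (by simp [Fits, triangleLeft, Slice.bot, Slice.top, Piece.bot, Piece.top])
      (by simp [Fits, triangleRight, Slice.bot, Slice.top, Piece.bot, Piece.top])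
    simpa [sl, Piece.bot, Piece.top, triangleLeft, triangleRight] using this.symm

theorem Slice.fits (e : Slice ι) : Fits e.bot [e] e.top := by
  simp [Fits]

theorem slice_fits (a b : List (Strand ι)) (g : Piece ι) :
    Fits (a ++ (g.bot ++ b)) [⟨a, g, b⟩] (a ++ (g.top ++ b)) := by
  simp [Fits, Slice.bot, Slice.top]

theorem sl_natural_slice (z : Strand ι) (e : Slice ι) :
    Fus (z :: e.bot) (⟨z :: e.left, e.piece, e.right⟩ :: sl z e.top)
      (sl z e.bot ++ [⟨e.left, e.piece, e.right ++ [z]⟩]) := by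
  obtain ⟨a, g, b⟩ := e
  simp only [Slice.bot, Slice.top, sl_append]
  have h1 := (exchange (sl_fits z a) (slice_fits [] b g)).symm.right
    (wd a b (sl z g.top) ++ wd (a ++ g.top) [] (sl z b))
  have h2 := Eqv.mid (s := z :: (a ++ (g.bot ++ b))) (by
    simpa using Fits.widenR (sl_fits z a) (g.bot ++ b)) ((sl_natural_piece z g).widen a b)
    (wd (a ++ g.top) [] (sl z b))
  have h3 := Eqv.left (u := wd [] (g.bot ++ b) (sl z a) ++ wd a b (sl z g.bot))
    (s := z :: (a ++ (g.bot ++ b))) (t := a ++ g.bot ++ (z :: b))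
    (Fits.comp (m := a ++ z :: (g.bot ++ b)) (by
      simpa using Fits.widenR (sl_fits z a) (g.bot ++ b)) (by
      simpa using Fits.widen (sl_fits z g.bot) a b))
    (by simpa using exchange (slice_fits a [] g) (sl_fits z b))
  simp at h1 h2 h3 ⊢
  exact h1.trans (h2.trans h3)

theorem sl_natural (z : Strand ι) {s t : List (Strand ι)} {w : Stack ι} (hw : Fits s w t) :
    Fus (z :: s) (wd [z] [] w ++ sl z t) (sl z s ++ wd [] [z] w) := by
  induction w generalizing s with
  | nil => cases hw; simp; exact Eqv.refl _
  | cons e w ih =>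
    obtain ⟨rfl, hw⟩ := hw
    have h1 := Eqv.left (s := z :: e.bot) (u := [⟨z :: e.left, e.piece, e.right⟩])
      (by simp [Fits, Slice.bot, Slice.top]) (ih hw)
    have h2 := (sl_natural_slice z e).right (wd [] [z] w)
    simp at h1 h2 ⊢
    exact h1.trans h2

/-- The strands `a` move from the left of the strands `s` to their right, crossing them
virtually. -/
def bl : List (Strand ι) → List (Strand ι) → Stack ι
  | [], _ => []
  | z :: a, s => wd [z] [] (bl a s) ++ wd [] a (sl z s)

theorem bl_fits (a s : List (Strand ι)) : Fits (a ++ s) (bl a s) (s ++ a) := by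
  induction a with
  | nil => simp [bl, Fits]
  | cons z a ih =>
    refine Fits.comp (Fits.widenL ih [z]) ?_
    simpa using Fits.widenR (sl_fits z s) a

@[simp] theorem bl_nil (a : List (Strand ι)) : bl a [] = [] := by
  induction a with
  | nil => rfl
  | cons z a ih => simp [bl, ih, sl]

/-- Every stack of slices passes through the virtual crossings with a family of strands `a`. -/
theorem bl_natural (a : List (Strand ι)) {s t : List (Strand ι)} {w : Stack ι} (hw : Fits s w t) :
    Fus (a ++ s) (wd a [] w ++ bl a t) (bl a s ++ wd [] a w) := by
  induction a with
  | nil => simp [bl]; exact Eqv.refl _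
  | cons z a ih =>
    have h1 := (ih.widenL [z]).right (wd [] a (sl z t))
    have h2 := Eqv.left (s := z :: (a ++ s)) (Fits.widenL (bl_fits a s) [z])
      (by simpa using (sl_natural z hw).widenR a)
    simp [bl] at h1 h2 ⊢
    exact h1.trans h2

/-! ### Stacks of crossings -/

/-- All pieces of the stack are crossings. -/
def Cr (w : Stack ι) : Prop := ∀ e ∈ w, ∃ k x y, e.piece = .cross k x y

/-- All pieces of the stack are virtual crossings. -/
def Vir (w : Stack ι) : Prop := ∀ e ∈ w, ∃ x y, e.piece = .cross .virt x y

@[simp] theorem Cr.nil : Cr ([] : Stack ι) := by simp [Cr]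

@[simp] theorem Vir.nil : Vir ([] : Stack ι) := by simp [Vir]

theorem Vir.cr {w : Stack ι} (h : Vir w) : Cr w := fun e he =>
  let ⟨x, y, h⟩ := h e he; ⟨_, x, y, h⟩

@[simp] theorem cr_cons {e : Slice ι} {w : Stack ι} :
    Cr (e :: w) ↔ (∃ k x y, e.piece = .cross k x y) ∧ Cr w := by simp [Cr]

@[simp] theorem cr_append {u v : Stack ι} : Cr (u ++ v) ↔ Cr u ∧ Cr v := by
  simp [Cr, or_imp, forall_and]

@[simp] theorem vir_cons {e : Slice ι} {w : Stack ι} :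
    Vir (e :: w) ↔ (∃ x y, e.piece = .cross .virt x y) ∧ Vir w := by simp [Vir]

@[simp] theorem vir_append {u v : Stack ι} : Vir (u ++ v) ↔ Vir u ∧ Vir v := by
  simp [Vir, or_imp, forall_and]

@[simp] theorem cr_wd {a b : List (Strand ι)} {w : Stack ι} : Cr (wd a b w) ↔ Cr w := by
  simp [Cr, wd, Slice.widen]

@[simp] theorem vir_wd {a b : List (Strand ι)} {w : Stack ι} : Vir (wd a b w) ↔ Vir w := by
  simp [Vir, wd, Slice.widen]

theorem sl_vir (z : Strand ι) (a : List (Strand ι)) : Vir (sl z a) := by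
  induction a with
  | nil => simp [sl]
  | cons x a ih => simp [sl, ih]

theorem bl_vir (a s : List (Strand ι)) : Vir (bl a s) := by
  induction a with
  | nil => simp [bl]
  | cons z a ih => simp [bl, ih, sl_vir]

theorem Cr.perm {s t : List (Strand ι)} {w : Stack ι} (h : Cr w) (hw : Fits s w t) : s.Perm t := by
  induction w generalizing s with
  | nil => cases hw; exact .refl _
  | cons e w ih =>
    obtain ⟨rfl, hw⟩ := hw
    obtain ⟨⟨k, x, y, h1⟩, h2⟩ := cr_cons.1 h
    refine .trans ?_ (ih h2 hw)
    simp only [Slice.bot, Slice.top, h1, Piece.bot, Piece.top]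
    exact ((List.Perm.swap y x []).append_left _).append_right _

/-- Stacks of virtual crossings are invertible. -/
theorem Vir.exists_inverse {s t : List (Strand ι)} {v : Stack ι} (h : Vir v) (hv : Fits s v t) :
    ∃ v', Vir v' ∧ Fits t v' s ∧ Fus s (v ++ v') [] ∧ Fus t (v' ++ v) [] := by
  induction v generalizing s with
  | nil => cases hv; exact ⟨[], by simp, rfl, Eqv.refl _, Eqv.refl _⟩
  | cons e v ih =>
    obtain ⟨rfl, hv⟩ := hv
    obtain ⟨⟨x, y, h1⟩, h2⟩ := vir_cons.1 h
    obtain ⟨v', hv1, hv2, hv3, hv4⟩ := ih h2 hv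
    obtain ⟨a, g, b⟩ := e
    cases h1
    have hf : Fits (a ++ [y, x] ++ b) [⟨a, .cross .virt y x, b⟩] (a ++ [x, y] ++ b) := by
      simp [Fits, Slice.bot, Slice.top, Piece.bot, Piece.top]
    have hf' : Fits (a ++ [x, y] ++ b) [⟨a, .cross .virt x y, b⟩] (a ++ [y, x] ++ b) := by
      simp [Fits, Slice.bot, Slice.top, Piece.bot, Piece.top]
    refine ⟨v' ++ [⟨a, .cross .virt y x, b⟩], by simp [hv1],
      Fits.comp hv2 (by simp [Fits, Slice.bot, Slice.top, Piece.bot, Piece.top]), ?_, ?_⟩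
    · have h3 := Eqv.left hf' (hv3.right [⟨a, .cross .virt y x, b⟩])
      have h4 := (virt_cancel x y).widen a b
      simp at h3 h4
      simpa [Slice.bot, Piece.bot] using h3.trans h4
    · have h3 := Eqv.mid hv2 ((virt_cancel y x).widen a b) v
      simp at h3 ⊢
      exact h3.trans hv4

/-- Virtual stacks realize all permutations of strands. -/
theorem exists_vir {s t : List (Strand ι)} (h : s.Perm t) : ∃ v, Vir v ∧ Fits s v t := by
  induction h with
  | nil => exact ⟨[], by simp, rfl⟩
  | cons x _ ih =>
    obtain ⟨v, h1, h2⟩ := ih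
    exact ⟨wd [x] [] v, by simpa, Fits.widenL h2 [x]⟩
  | swap x y l =>
    exact ⟨[⟨[], .cross .virt y x, l⟩], by simp, by
      simp [Fits, Slice.bot, Slice.top, Piece.bot, Piece.top]⟩
  | trans _ _ ih ih' =>
    obtain ⟨v, h1, h2⟩ := ih
    obtain ⟨v', h3, h4⟩ := ih'
    exact ⟨v ++ v', by simp [h1, h3], Fits.comp h2 h4⟩

/-! ### Coherence of virtual crossings -/

theorem slice_cross_fits (k : Kind) (x y : Strand ι) (a b : List (Strand ι)) :
    Fits (a ++ x :: y :: b) [⟨a, .cross k x y, b⟩] (a ++ y :: x :: b) := by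
  simp [Fits, Slice.bot, Slice.top, Piece.bot, Piece.top]

/-- A virtual stack may be rewritten so that its leftmost strand does not move until the end, when
it slides to its final place. -/
theorem Vir.extract {x : Strand ι} {s t : List (Strand ι)} {v : Stack ι} (h : Vir v)
    (hv : Fits (x :: s) v t) : ∃ a b v', t = a ++ x :: b ∧ Vir v' ∧ Fits s v' (a ++ b) ∧
      Fus (x :: s) v (wd [x] [] v' ++ wd [] b (sl x a)) := by
  induction v using List.reverseRecOn generalizing t with
  | nil => cases hv; exact ⟨[], s, [], by simp, by simp, rfl, by simp [sl]; exact Eqv.refl _⟩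
  | append_singleton v e ih =>
    obtain ⟨m, hv, he⟩ := fits_append.1 hv
    obtain ⟨h1, h2⟩ := vir_append.1 h
    obtain ⟨a, b, v', rfl, hv1, hv2, hv3⟩ := ih h1 hv
    have hf : Fits (x :: s) (wd [x] [] v' ++ wd [] b (sl x a)) (a ++ x :: b) := hv3.fits hv
    have hf' : Fits (x :: s) (wd [x] [] v') (x :: (a ++ b)) := by simpa using Fits.widenL hv2 [x]
    obtain ⟨⟨y, z, hp⟩, -⟩ := vir_cons.1 h2
    obtain ⟨c, g, d⟩ := e
    cases hp
    obtain ⟨hb, rfl⟩ := he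
    have hb : c ++ (y :: z :: d) = a ++ x :: b := by simpa [Slice.bot, Piece.bot] using hb
    have h3 := hv3.right [⟨c, .cross .virt y z, d⟩]
    simp only [Slice.top, Piece.top]
    have caseA : a = c → x :: b = y :: z :: d → ∃ a b v', c ++ [z, y] ++ d = a ++ x :: b ∧ Vir v' ∧
        Fits s v' (a ++ b) ∧ Fus (x :: s) (v ++ [⟨c, .cross .virt y z, d⟩])
          (wd [x] [] v' ++ wd [] b (sl x a)) := fun hac hbd => by
      obtain ⟨rfl, rfl⟩ : x = y ∧ b = z :: d := by simpa using hbd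
      subst hac
      refine ⟨a ++ [z], d, v', by simp, hv1, by simpa using hv2, ?_⟩
      simpa [sl_append, sl] using h3
    rcases List.append_eq_append_iff.1 hb with ⟨a', rfl, ha'⟩ | ⟨c', rfl, hc'⟩
    · rcases a' with _ | ⟨y', a'⟩
      · exact caseA (by simp) (by simpa using ha'.symm)
      obtain ⟨rfl, ha'⟩ : y = y' ∧ z :: d = a' ++ x :: b := by simpa using ha'
      rcases a' with _ | ⟨z', a'⟩
      · obtain ⟨rfl, rfl⟩ : z = x ∧ d = b := by simpa using ha'
        refine ⟨c, y :: d, v', by simp, hv1, by simpa using hv2, ?_⟩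
        refine h3.trans ?_
        have := Eqv.left (s := z :: s) (u := wd [z] [] v' ++ wd [] (y :: d) (sl z c))
          (t := c ++ [z, y] ++ d)
          (Fits.comp (by simpa using hf') (by simpa using Fits.widenR (sl_fits z c) (y :: d)))
          ((virt_cancel z y).widen c d)
        simpa [sl_append, sl] using this
      · obtain ⟨rfl, rfl⟩ : z = z' ∧ d = a' ++ x :: b := by simpa using ha'
        refine ⟨c ++ z :: y :: a', b, v' ++ [⟨c, .cross .virt y z, a' ++ b⟩], by simp,
          by simp [hv1],
          Fits.comp hv2 (by simpa using slice_cross_fits .virt y z c (a' ++ b)), ?_⟩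
        refine h3.trans ?_
        have := Eqv.left hf' (by
          simpa using (sl_natural x (slice_cross_fits .virt y z c a')).symm.widenR b)
        simpa using this
    · rcases c' with _ | ⟨x', c'⟩
      · exact caseA (by simp) (by simpa using hc')
      obtain ⟨rfl, rfl⟩ : x = x' ∧ b = c' ++ y :: z :: d := by simpa using hc'
      refine ⟨a, c' ++ z :: y :: d, v' ++ [⟨a ++ c', .cross .virt y z, d⟩], by simp, by simp [hv1],
        Fits.comp hv2 (by simpa using slice_cross_fits .virt y z (a ++ c') d), ?_⟩
      refine h3.trans ?_
      have := Eqv.left hf' (by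
        simpa using (exchange (sl_fits x a) (slice_cross_fits .virt y z c' d)))
      simpa using this

/-- Coherence: a virtual stack of distinct strands is determined by the strands at its bottom and
at its top. -/
theorem Vir.coherence {s t : List (Strand ι)} {v v' : Stack ι} (hs : s.Nodup) (h : Vir v)
    (h' : Vir v') (hv : Fits s v t) (hv' : Fits s v' t) : Fus s v v' := by
  induction s generalizing t v v' with
  | nil =>
    have key : ∀ w : Stack ι, Vir w → Fits [] w t → w = [] := by
      intro w hw hf
      cases w with
      | nil => rfl
      | cons e w =>
        obtain ⟨⟨x, y, hp⟩, -⟩ := vir_cons.1 hw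
        have := hf.1
        simp [Slice.bot, hp, Piece.bot] at this
    rw [key v h hv, key v' h' hv']
    exact Eqv.refl _
  | cons x s ih =>
    obtain ⟨a, b, w, rfl, hw1, hw2, hw3⟩ := h.extract hv
    obtain ⟨a', b', w', hab, hw1', hw2', hw3'⟩ := h'.extract hv'
    have hn : (a ++ x :: b).Nodup := (h.cr.perm hv).nodup hs
    have hx : x ∉ a := by
      intro hx
      exact (List.disjoint_of_nodup_append hn) hx (by simp)
    have hx' : x ∉ a' := by
      intro hx
      rw [hab] at hn
      exact (List.disjoint_of_nodup_append hn) hx (by simp)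
    obtain ⟨rfl, rfl⟩ : a = a' ∧ b = b' := by
      rcases List.append_eq_append_iff.1 hab with ⟨c, rfl, hc⟩ | ⟨c, rfl, hc⟩
      · cases c with
        | nil => simpa using hc
        | cons y c => simp at hc; simp [hc.1] at hx'
      · cases c with
        | nil => simpa using hc.symm
        | cons y c => simp at hc; simp [hc.1] at hx
    have := (ih (List.nodup_cons.1 hs).2 hw1 hw1' hw2 hw2').widenL [x]
    exact hw3.trans ((this.right _).trans hw3'.symm)

/-- A virtual stack from `s` to `t`, if `t` is a permutation of `s`; otherwise the empty stack. -/
noncomputable def vp (s t : List (Strand ι)) : Stack ι :=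
  open Classical in if h : s.Perm t then (exists_vir h).choose else []

theorem vp_vir (s t : List (Strand ι)) : Vir (vp s t) := by
  unfold vp
  split_ifs with h
  · exact (exists_vir h).choose_spec.1
  · simp

theorem vp_fits {s t : List (Strand ι)} (h : s.Perm t) : Fits s (vp s t) t := by
  rw [vp, dif_pos h]
  exact (exists_vir h).choose_spec.2

/-! ### Arrows -/

/-- A letter stands for an arrow between two strands: a classical crossing followed or preceded by
a virtual one, so that the two strands return to their places. The strand `tail` is the overpass
and the strand `head` the underpass; `pos` distinguishes an arrow from its inverse. -/
structure Letter (ι : Type) where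
  tail : Strand ι
  head : Strand ι
  pos : Bool

/-- The inverse arrow. -/
def Letter.inv (l : Letter ι) : Letter ι := ⟨l.tail, l.head, !l.pos⟩

@[simp] theorem Letter.inv_inv (l : Letter ι) : l.inv.inv = l := by simp [Letter.inv]

/-- The arrow connects two different strands out of `s`. -/
def Letter.On (s : List (Strand ι)) (l : Letter ι) : Prop :=
  l.tail ≠ l.head ∧ l.tail ∈ s ∧ l.head ∈ s

theorem Letter.On.perm {s t : List (Strand ι)} {l : Letter ι} (h : l.On s) (hst : s.Perm t) :
    l.On t := ⟨h.1, hst.subset h.2.1, hst.subset h.2.2⟩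

theorem Letter.On.exists_perm {s : List (Strand ι)} {l : Letter ι} (h : l.On s) :
    ∃ r, s.Perm (l.tail :: l.head :: r) := by
  classical
  obtain ⟨h1, h2, h3⟩ := h
  refine ⟨(s.erase l.tail).erase l.head, (List.perm_cons_erase h2).trans (.cons _ ?_)⟩
  exact List.perm_cons_erase ((List.mem_erase_of_ne h1.symm).2 h3)

/-- The arrow between two neighbouring strands, the tail on the left. -/
def Letter.stack : Letter ι → Stack ι
  | ⟨x, y, true⟩ => [⟨[], .cross (.classical true) x y, []⟩, ⟨[], .cross .virt y x, []⟩]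
  | ⟨x, y, false⟩ => [⟨[], .cross .virt x y, []⟩, ⟨[], .cross (.classical false) y x, []⟩]

theorem Letter.stack_fits (l : Letter ι) : Fits [l.tail, l.head] l.stack [l.tail, l.head] := by
  obtain ⟨x, y, _ | _⟩ := l <;>
    simp [Letter.stack, Fits, Slice.bot, Slice.top, Piece.bot, Piece.top]

theorem Letter.stack_cr (l : Letter ι) : Cr l.stack := by
  obtain ⟨x, y, _ | _⟩ := l <;> simp [Letter.stack]

/-- By the moves R2 and VR2 an arrow cancels with its inverse. -/
theorem Letter.stack_inv (l : Letter ι) : Fus [l.tail, l.head] (l.stack ++ l.inv.stack) [] := by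
  obtain ⟨x, y, _ | _⟩ := l
  · have h1 := Eqv.mid (u := [⟨[], .cross .virt x y, []⟩]) (s := [x, y]) (t := [y, x])
      (slice_cross_fits .virt x y [] [])
      (Fus.of_welded (.R2 false y x) (slice_cross_fits _ y x [] []|>.comp
        (slice_cross_fits _ x y [] [])) (by simp [Fits])) [⟨[], .cross .virt y x, []⟩]
    exact h1.trans (virt_cancel x y)
  · have h1 := Eqv.mid (u := [⟨[], .cross (.classical true) x y, []⟩]) (s := [x, y]) (t := [y, x])
      (slice_cross_fits _ x y [] []) (virt_cancel y x) [⟨[], .cross (.classical false) y x, []⟩]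
    exact h1.trans (Fus.of_welded (.R2 true x y) (slice_cross_fits _ x y [] []|>.comp
        (slice_cross_fits _ y x [] [])) (by simp [Fits]))

open Classical in
/-- The arrow `l` on the strands `s`: its strands are brought together at the left by virtual
crossings, and return to their places afterwards. The stack is empty if the strands do not occur
in `s`. -/
noncomputable def arr (s : List (Strand ι)) (l : Letter ι) : Stack ι :=
  if h : ∃ r, s.Perm (l.tail :: l.head :: r) then
    vp s (l.tail :: l.head :: h.choose) ++ wd [] h.choose l.stack ++
      vp (l.tail :: l.head :: h.choose) s
  else []

theorem arr_fits (s : List (Strand ι)) (l : Letter ι) : Fits s (arr s l) s := by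
  unfold arr
  split_ifs with h
  · have := h.choose_spec
    exact ((vp_fits this).comp (by simpa using Fits.widenR l.stack_fits h.choose)).comp
      (vp_fits this.symm)
  · rfl

theorem arr_cr (s : List (Strand ι)) (l : Letter ι) : Cr (arr s l) := by
  unfold arr
  split_ifs with h
  · simp [l.stack_cr, (vp_vir _ _).cr]
  · simp

/-- An arrow may be realized by any virtual path of its strands to the left. -/
theorem arr_eq {s r : List (Strand ι)} {l : Letter ι} {v v' : Stack ι} (hs : s.Nodup)
    (hv : Vir v) (hv' : Vir v') (hf : Fits s v (l.tail :: l.head :: r))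
    (hf' : Fits (l.tail :: l.head :: r) v' s) :
    Fus s (arr s l) (v ++ (wd [] r l.stack ++ v')) := by
  have hp := hv.cr.perm hf
  have h : ∃ r, s.Perm (l.tail :: l.head :: r) := ⟨r, hp⟩
  rw [arr, dif_pos h]
  have hq := h.choose_spec
  generalize h.choose = q at hq
  have hrq : q.Perm r := (List.perm_cons _).1 ((List.perm_cons _).1 (hq.symm.trans hp))
  have hmid : Fits (l.tail :: l.head :: q) (wd [] q l.stack) (l.tail :: l.head :: q) := by
    simpa using Fits.widenR l.stack_fits q
  have hmove : Fits (l.tail :: l.head :: q) (wd [l.tail, l.head] [] (vp q r))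
      (l.tail :: l.head :: r) := Fits.widenL (vp_fits hrq) [l.tail, l.head]
  have h1 : Fus _ (vp (l.tail :: l.head :: q) s) (wd [l.tail, l.head] [] (vp q r) ++ v') :=
    Vir.coherence (hq.nodup hs) (vp_vir _ _) (by simp [vp_vir, hv']) (vp_fits hq.symm)
      (hmove.comp hf')
  have h2 : Fus s (vp s (l.tail :: l.head :: q) ++ wd [l.tail, l.head] [] (vp q r)) v :=
    Vir.coherence hs (by simp [vp_vir]) hv ((vp_fits hq).comp hmove) hf
  have h3 := Eqv.left ((vp_fits hq).comp hmid) h1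
  have h4 := Eqv.mid (vp_fits hq) (exchange l.stack_fits (vp_fits hrq)) v'
  have h5 := h2.right (wd [] r l.stack ++ v')
  refine h3.trans (.trans ?_ h5)
  simpa using h4

/-- Arrows pass through virtual crossings. -/
theorem arr_vir {s t : List (Strand ι)} {v : Stack ι} (l : Letter ι) (hs : s.Nodup) (hv : Vir v)
    (hf : Fits s v t) : Fus s (arr s l ++ v) (v ++ arr t l) := by
  have hst := hv.cr.perm hf
  by_cases h : ∃ r, s.Perm (l.tail :: l.head :: r)
  · obtain ⟨r, hr⟩ := h
    have hr' := hst.symm.trans hr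
    have h1 := (arr_eq hs (vp_vir _ _) (vp_vir _ _) (vp_fits hr) (vp_fits hr.symm)).right v
    have h2 := Eqv.left hf (arr_eq ((hst.nodup_iff).1 hs) (vp_vir _ _) (vp_vir _ _) (vp_fits hr')
      (vp_fits hr'.symm))
    have hmid : Fits (l.tail :: l.head :: r) (wd [] r l.stack) (l.tail :: l.head :: r) := by
      simpa using Fits.widenR l.stack_fits r
    have h3 : Fus s (vp s (l.tail :: l.head :: r)) (v ++ vp t (l.tail :: l.head :: r)) :=
      Vir.coherence hs (vp_vir _ _) (by simp [vp_vir, hv]) (vp_fits hr) (hf.comp (vp_fits hr'))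
    have h4 : Fus _ (vp (l.tail :: l.head :: r) s ++ v) (vp (l.tail :: l.head :: r) t) :=
      Vir.coherence (hr.nodup hs) (by simp [vp_vir, hv]) (vp_vir _ _) ((vp_fits hr.symm).comp hf)
        (vp_fits hr'.symm)
    have h5 := Eqv.left ((vp_fits hr).comp hmid) h4
    have h6 := h3.right (wd [] r l.stack ++ vp (l.tail :: l.head :: r) t)
    simp only [List.append_assoc] at h1 h2 h5 h6 ⊢
    exact h1.trans (h5.trans (h6.trans h2.symm))
  · have h' : ¬ ∃ r, t.Perm (l.tail :: l.head :: r) := fun ⟨r, hr⟩ => h ⟨r, hst.trans hr⟩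
    rw [arr, arr, dif_neg h, dif_neg h']
    exact Eqv.of_eq (by simp)

/-- The arrow of two strands that are neighbours at any place. -/
theorem arr_local (l : Letter ι) (a b : List (Strand ι))
    (hs : (a ++ l.tail :: l.head :: b).Nodup) :
    Fus (a ++ l.tail :: l.head :: b) (wd a b l.stack) (arr (a ++ l.tail :: l.head :: b) l) := by
  have hb : Fits (a ++ l.tail :: l.head :: b) (wd [] b (bl a [l.tail, l.head]))
      (l.tail :: l.head :: (a ++ b)) := by
    simpa using Fits.widenR (bl_fits a [l.tail, l.head]) b
  obtain ⟨v', h1, h2, h3, -⟩ := Vir.exists_inverse (by simp [bl_vir]) hb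
  have h4 := arr_eq hs (by simp [bl_vir]) h1 hb h2
  have h5 := ((bl_natural a l.stack_fits).widenR b).right v'
  have h6 := Eqv.left (u := wd a b l.stack) (s := a ++ l.tail :: l.head :: b)
    (by simpa using Fits.widen l.stack_fits a b) h3
  simp at h4 h5 h6
  exact h6.symm.trans (h5.trans h4.symm)

/-- The product of the arrows of a word on the strands `s`, the first one at the bottom. -/
noncomputable def real (s : List (Strand ι)) (W : List (Letter ι)) : Stack ι := W.flatMap (arr s)

@[simp] theorem real_nil (s : List (Strand ι)) : real s [] = [] := rfl

@[simp] theorem real_cons (s : List (Strand ι)) (l : Letter ι) (W : List (Letter ι)) :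
    real s (l :: W) = arr s l ++ real s W := rfl

@[simp] theorem real_append (s : List (Strand ι)) (W W' : List (Letter ι)) :
    real s (W ++ W') = real s W ++ real s W' := by simp [real]

theorem real_fits (s : List (Strand ι)) (W : List (Letter ι)) : Fits s (real s W) s := by
  induction W with
  | nil => rfl
  | cons l W ih => exact (arr_fits s l).comp ih

theorem real_cr (s : List (Strand ι)) (W : List (Letter ι)) : Cr (real s W) := by
  induction W with
  | nil => simp
  | cons l W ih => simp [arr_cr, ih]

theorem real_vir {s t : List (Strand ι)} {v : Stack ι} (W : List (Letter ι)) (hs : s.Nodup)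
    (hv : Vir v) (hf : Fits s v t) : Fus s (real s W ++ v) (v ++ real t W) := by
  induction W with
  | nil => exact Eqv.of_eq (by simp)
  | cons l W ih =>
    have h1 := Eqv.left (arr_fits s l) ih
    have h2 := (arr_vir l hs hv hf).right (real t W)
    simp at h1 h2 ⊢
    exact h1.trans h2

/-- On words of arrows, `Letter.inv` is the inverse. -/
theorem arr_inv {s : List (Strand ι)} (hs : s.Nodup) (l : Letter ι) :
    Fus s (arr s l ++ arr s l.inv) [] := by
  by_cases h : ∃ r, s.Perm (l.tail :: l.head :: r)
  · obtain ⟨r, hr⟩ := h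
    have h1 := arr_eq hs (vp_vir _ _) (vp_vir _ _) (vp_fits hr) (vp_fits hr.symm)
    have h2 : Fus s (arr s l.inv) (vp s (l.tail :: l.head :: r) ++
        (wd [] r l.inv.stack ++ vp (l.tail :: l.head :: r) s)) :=
      arr_eq (l := l.inv) hs (vp_vir _ _) (vp_vir _ _) (vp_fits hr) (vp_fits hr.symm)
    have h3 := (h1.right (arr s l.inv)).trans (Eqv.left (h1.fits (arr_fits s l)) h2)
    have hmid : Fits (l.tail :: l.head :: r) (wd [] r l.stack) (l.tail :: l.head :: r) := by
      simpa using Fits.widenR l.stack_fits r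
    have h4 : Fus _ (vp (l.tail :: l.head :: r) s ++ vp s (l.tail :: l.head :: r)) [] :=
      Vir.coherence (hr.nodup hs) (by simp [vp_vir]) (by simp)
        ((vp_fits hr.symm).comp (vp_fits hr)) rfl
    have h5 : Fus _ (vp s (l.tail :: l.head :: r) ++ vp (l.tail :: l.head :: r) s) [] :=
      Vir.coherence hs (by simp [vp_vir]) (by simp)
        ((vp_fits hr).comp (vp_fits hr.symm)) rfl
    have h6 := Eqv.mid ((vp_fits hr).comp hmid) h4
      (wd [] r l.inv.stack ++ vp (l.tail :: l.head :: r) s)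
    have h7 := Eqv.mid (vp_fits hr) (l.stack_inv.widenR r) (vp (l.tail :: l.head :: r) s)
    simp at h3 h5 h6 h7 ⊢
    exact h3.trans (h6.trans (h7.trans h5))
  · have h' : ¬ ∃ r, s.Perm (l.inv.tail :: l.inv.head :: r) := h
    rw [arr, arr, dif_neg h, dif_neg h']
    exact Eqv.refl _

theorem arr_widen {a s b : List (Strand ι)} {l : Letter ι} (hs : (a ++ s ++ b).Nodup)
    (hl : l.On s) : Fus (a ++ s ++ b) (wd a b (arr s l)) (arr (a ++ s ++ b) l) := by
  have hs' : s.Nodup := (List.nodup_append.1 (List.nodup_append.1 hs).1).2.1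
  obtain ⟨r, hr⟩ := hl.exists_perm
  have hr' : (a ++ s ++ b).Perm (a ++ l.tail :: l.head :: (r ++ b)) := by
    have := (hr.append_left a).append_right b
    simpa using this
  have h1 := (arr_eq hs' (vp_vir _ _) (vp_vir _ _) (vp_fits hr) (vp_fits hr.symm)).widen a b
  have hf : Fits (a ++ s ++ b) (wd a b (vp s (l.tail :: l.head :: r)))
      (a ++ l.tail :: l.head :: (r ++ b)) := by
    simpa using Fits.widen (vp_fits hr) a b
  have hf' : Fits (a ++ l.tail :: l.head :: (r ++ b)) (wd a b (vp (l.tail :: l.head :: r) s))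
      (a ++ s ++ b) := by
    simpa using Fits.widen (vp_fits hr.symm) a b
  have h2 := Eqv.mid hf (arr_local l a (r ++ b) (hr'.nodup hs))
    (wd a b (vp (l.tail :: l.head :: r) s))
  have h3 := (arr_vir l hs (by simp [vp_vir]) hf).symm.right
    (wd a b (vp (l.tail :: l.head :: r) s))
  have h4 : Fus _ (wd a b (vp s (l.tail :: l.head :: r)) ++
      wd a b (vp (l.tail :: l.head :: r) s)) [] :=
    Vir.coherence hs (by simp [vp_vir]) (by simp) (hf.comp hf') rfl
  have h5 := Eqv.left (arr_fits _ l) h4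
  simp at h1 h2 h3 h5 ⊢
  exact h1.trans (h2.trans (h3.trans h5))

/-- Arrows do not see the strands that they do not join. -/
theorem real_widen {a s b : List (Strand ι)} {W : List (Letter ι)} (hs : (a ++ s ++ b).Nodup)
    (hW : ∀ l ∈ W, l.On s) : Fus (a ++ s ++ b) (wd a b (real s W)) (real (a ++ s ++ b) W) := by
  induction W with
  | nil => exact Eqv.refl _
  | cons l W ih =>
    have h1 := (arr_widen hs (hW l (by simp))).right (wd a b (real s W))
    have h2 := Eqv.left (arr_fits (a ++ s ++ b) l) (ih fun l hl => hW l (by simp [hl]))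
    simpa using h1.trans h2

/-! ### Words of arrows -/

/-- The words `W` and `W'` of arrows give equivalent stacks. -/
def WFus (s : List (Strand ι)) (W W' : List (Letter ι)) : Prop := Fus s (real s W) (real s W')

namespace WFus

variable {s t : List (Strand ι)} {U V W W' W'' : List (Letter ι)}

theorem refl (W : List (Letter ι)) : WFus s W W := Eqv.refl _

theorem symm (h : WFus s W W') : WFus s W' W := Eqv.symm h

theorem trans (h : WFus s W W') (h' : WFus s W' W'') : WFus s W W'' := Eqv.trans h h'

theorem congr (h : WFus s W W') (U V : List (Letter ι)) : WFus s (U ++ W ++ V) (U ++ W' ++ V) := by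
  have := Eqv.mid (real_fits s U) h (real s V)
  simpa [WFus] using this

theorem inv (hs : s.Nodup) (l : Letter ι) : WFus s [l, l.inv] [] := by
  simpa [WFus] using arr_inv hs l

theorem inv' (hs : s.Nodup) (l : Letter ι) : WFus s [l.inv, l] [] := by
  simpa using inv hs l.inv

theorem perm (hs : s.Nodup) (hst : s.Perm t) (h : WFus t W W') : WFus s W W' := by
  have ht := hst.nodup hs
  have h1 := real_vir W hs (vp_vir s t) (vp_fits hst)
  have h2 := Eqv.left (vp_fits hst) h
  have h3 := real_vir W' hs (vp_vir s t) (vp_fits hst)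
  have h4 := (h1.trans (h2.trans h3.symm)).right (vp t s)
  have h5 : Fus s (vp s t ++ vp t s) [] :=
    Vir.coherence hs (by simp [vp_vir]) (by simp) ((vp_fits hst).comp (vp_fits hst.symm)) rfl
  have h6 := Eqv.left (real_fits s W) h5
  have h7 := Eqv.left (real_fits s W') h5
  simp at h4 h6 h7
  exact h6.symm.trans (h4.trans h7)

end WFus

/-- Two arrows commute. -/
def Comm (s : List (Strand ι)) (l m : Letter ι) : Prop := WFus s [l, m] [m, l]

theorem Comm.symm {s : List (Strand ι)} {l m : Letter ι} (h : Comm s l m) : Comm s m l :=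
  WFus.symm h

theorem Comm.inv_left {s : List (Strand ι)} {l m : Letter ι} (hs : s.Nodup) (h : Comm s l m) :
    Comm s l.inv m := by
  have h1 := (WFus.inv hs l).congr [l.inv, m] []
  have h2 := (WFus.symm h).congr [l.inv] [l.inv]
  have h3 := (WFus.inv' hs l).congr [] [m, l.inv]
  exact .trans (.symm h1) (.trans h2 h3)

theorem Comm.of_pos {s : List (Strand ι)} (hs : s.Nodup) {x y x' y' : Strand ι} (e e' : Bool)
    (h : Comm s ⟨x, y, true⟩ ⟨x', y', true⟩) : Comm s ⟨x, y, e⟩ ⟨x', y', e'⟩ := by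
  have h1 : Comm s ⟨x, y, e⟩ ⟨x', y', true⟩ := by
    cases e
    · exact h.inv_left hs
    · exact h
  cases e'
  · exact (h1.symm.inv_left hs).symm
  · exact h1

/-- The arrow at a crossing; there is none at a virtual crossing. -/
def Piece.word : Piece ι → List (Letter ι)
  | .cross (.classical true) x y => [⟨x, y, true⟩]
  | .cross (.classical false) x y => [⟨y, x, false⟩]
  | _ => []

/-- Every crossing is an arrow, or no arrow, followed by a virtual crossing. -/
theorem Fus.cross_word {a b : List (Strand ι)} {x y : Strand ι} (k : Kind)
    (hs : (a ++ x :: y :: b).Nodup) :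
    Fus (a ++ x :: y :: b) [⟨a, .cross k x y, b⟩]
      (real (a ++ x :: y :: b) (Piece.cross k x y).word ++ [⟨a, .cross .virt x y, b⟩]) := by
  rcases k with _ | _ | _
  · exact Eqv.refl _
  · have hp : (a ++ x :: y :: b).Perm (a ++ y :: x :: b) := (List.Perm.swap y x b).append_left a
    have h1 := ((virt_cancel x y).widen a b).right [⟨a, .cross (.classical false) x y, b⟩]
    have h2 := Eqv.left (slice_cross_fits .virt x y a b)
      (arr_local ⟨y, x, false⟩ a b (hp.nodup hs))
    have h3 := arr_vir ⟨y, x, false⟩ hs (by simp) (slice_cross_fits .virt x y a b)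
    simp [Letter.stack, Piece.word] at h1 h2 h3 ⊢
    exact h1.symm.trans (h2.trans h3.symm)
  · have h1 := Eqv.left (u := [⟨a, .cross (.classical true) x y, b⟩])
      (s := a ++ x :: y :: b) (by simpa using slice_cross_fits _ x y a b)
      ((virt_cancel y x).widen a b)
    have h2 := (arr_local ⟨x, y, true⟩ a b hs).right [⟨a, .cross .virt x y, b⟩]
    simp [Letter.stack, Piece.word] at h1 h2 ⊢
    exact h1.symm.trans h2

/-- The arrows of a stack of crossings. -/
def word (w : Stack ι) : List (Letter ι) := w.flatMap fun e => e.piece.word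

/-- A stack of crossings is a product of arrows followed by virtual crossings. -/
theorem Cr.fus_word {s t : List (Strand ι)} {w v : Stack ι} (hs : s.Nodup) (hw : Cr w)
    (hf : Fits s w t) (hv : Vir v) (hv' : Fits s v t) : Fus s w (real s (word w) ++ v) := by
  induction w generalizing s v with
  | nil =>
    cases hf
    exact Vir.coherence hs (by simp) hv rfl hv'
  | cons e w ih =>
    obtain ⟨rfl, hf2⟩ := hf
    obtain ⟨⟨k, x, y, hp⟩, hw2⟩ := cr_cons.1 hw
    obtain ⟨a, g, b⟩ := e
    cases hp
    have h0 : Slice.bot ⟨a, .cross k x y, b⟩ = a ++ x :: y :: b := by simp [Slice.bot, Piece.bot]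
    have h0' : Slice.top ⟨a, .cross k x y, b⟩ = a ++ y :: x :: b := by simp [Slice.top, Piece.top]
    rw [h0] at hs hv' ⊢
    rw [h0'] at hf2
    have hp : (a ++ x :: y :: b).Perm (a ++ y :: x :: b) := (List.Perm.swap y x b).append_left a
    have h1 := Fus.cross_word k hs
    have hv1 : Fits _ [⟨a, .cross .virt x y, b⟩] _ := slice_cross_fits .virt x y a b
    have h2 := ih (hp.nodup hs) hw2 hf2 (vp_vir _ _) (vp_fits (hw2.perm hf2))
    have h3 := Eqv.left ((real_fits _ (Piece.cross k x y).word).comp hv1) h2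
    have h4 := Eqv.mid (real_fits _ (Piece.cross k x y).word)
      (real_vir (word w) hs (by simp) hv1).symm (vp (a ++ y :: x :: b) t)
    have h5 := Eqv.left (real_fits (a ++ x :: y :: b) ((Piece.cross k x y).word ++ word w))
      (Vir.coherence hs (v := [⟨a, .cross .virt x y, b⟩] ++ vp (a ++ y :: x :: b) t)
        (by simp [vp_vir]) hv (hv1.comp (vp_fits (hw2.perm hf2))) hv')
    have h6 := h1.right w
    simp [word] at h3 h4 h5 h6 ⊢
    exact h6.trans (h3.trans (h4.trans h5))

/-- Equivalent stacks of crossings have equivalent words: both are followed by the same virtual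
permutation, which is invertible. -/
theorem WFus.of_fus {s t : List (Strand ι)} {w w' : Stack ι} (hs : s.Nodup) (hw : Cr w)
    (hw' : Cr w') (hf : Fits s w t) (h : Fus s w w') : WFus s (word w) (word w') := by
  have hp := hw.perm hf
  have h1 := hw.fus_word hs hf (vp_vir _ _) (vp_fits hp)
  have h2 := hw'.fus_word hs (h.fits hf) (vp_vir _ _) (vp_fits hp)
  have h3 := (h1.symm.trans (h.trans h2)).right (vp t s)
  have h4 : Fus s (vp s t ++ vp t s) [] :=
    Vir.coherence hs (by simp [vp_vir]) (by simp) ((vp_fits hp).comp (vp_fits hp.symm)) rfl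
  have h5 := Eqv.left (real_fits s (word w)) h4
  have h6 := Eqv.left (real_fits s (word w')) h4
  simp at h3 h5 h6
  exact h5.symm.trans (h3.trans h6)

@[simp] theorem word_wd (a b : List (Strand ι)) (w : Stack ι) : word (wd a b w) = word w := by
  simp [word, wd, Slice.widen, List.flatMap_map]

theorem word_triangleLeft (p q r : Kind) (x y z : Strand ι) :
    word (triangleLeft p q r x y z) = (Piece.cross p x y).word ++ (Piece.cross q x z).word ++
      (Piece.cross r y z).word := by simp [word, triangleLeft]

theorem word_triangleRight (p q r : Kind) (x y z : Strand ι) :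
    word (triangleRight p q r x y z) = (Piece.cross r y z).word ++ (Piece.cross q x z).word ++
      (Piece.cross p x y).word := by simp [word, triangleRight]

theorem WFus.of_triangle {p q r : Kind} {x y z : Strand ι} {b : List (Strand ι)}
    (hs : (x :: y :: z :: b).Nodup)
    (h : FusedMove (triangleLeft p q r x y z) (triangleRight p q r x y z)) :
    WFus (x :: y :: z :: b)
      ((Piece.cross p x y).word ++ (Piece.cross q x z).word ++ (Piece.cross r y z).word)
      ((Piece.cross r y z).word ++ (Piece.cross q x z).word ++ (Piece.cross p x y).word) := by
  have hl : Fits [x, y, z] (triangleLeft p q r x y z) [z, y, x] := by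
    simp [Fits, triangleLeft, Slice.bot, Slice.top, Piece.bot, Piece.top]
  have hr : Fits [x, y, z] (triangleRight p q r x y z) [z, y, x] := by
    simp [Fits, triangleRight, Slice.bot, Slice.top, Piece.bot, Piece.top]
  have h1 := (Eqv.of_move h hl hr).widenR b
  have h2 := WFus.of_fus (t := z :: y :: x :: b) hs (by simp [triangleLeft])
    (by simp [triangleRight]) (by simpa using Fits.widenR hl b) h1
  simpa [word_triangleLeft, word_triangleRight] using h2

/-- Arrows with the same tail commute by the move OC. -/
theorem Comm.tails {x y z : Strand ι} {b : List (Strand ι)} (hs : (x :: y :: z :: b).Nodup) :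
    Comm (x :: y :: z :: b) ⟨x, y, true⟩ ⟨x, z, true⟩ :=
  WFus.of_triangle hs (.inl (.OCx x y z))

/-- Arrows with the same head commute by the move UC. -/
theorem Comm.heads {x y z : Strand ι} {b : List (Strand ι)} (hs : (x :: y :: z :: b).Nodup) :
    Comm (x :: y :: z :: b) ⟨x, z, true⟩ ⟨y, z, true⟩ :=
  WFus.of_triangle hs (.inr (.UCz x y z))

/-- The third Reidemeister move says that consecutive arrows commute, since both of them commute
with the third arrow by the moves OC and UC. -/
theorem Comm.chain {x y z : Strand ι} {b : List (Strand ι)} (hs : (x :: y :: z :: b).Nodup) :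
    Comm (x :: y :: z :: b) ⟨x, y, true⟩ ⟨y, z, true⟩ := by
  have h1 : WFus (x :: y :: z :: b) [⟨x, y, true⟩, ⟨x, z, true⟩, ⟨y, z, true⟩]
      [⟨y, z, true⟩, ⟨x, z, true⟩, ⟨x, y, true⟩] :=
    WFus.of_triangle hs (.inl (.R3 true true true (by simp) x y z))
  have h2 := WFus.congr (Comm.tails hs) [] [⟨y, z, true⟩]
  have h3 := WFus.congr (Comm.heads hs).symm [] [⟨x, y, true⟩]
  have h4 : WFus (x :: y :: z :: b) [⟨x, z, true⟩, ⟨x, y, true⟩, ⟨y, z, true⟩]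
      [⟨x, z, true⟩, ⟨y, z, true⟩, ⟨x, y, true⟩] := .trans (.symm h2) (.trans h1 h3)
  have h5 := WFus.inv' hs ⟨x, z, true⟩
  exact .trans (.symm (h5.congr [] [⟨x, y, true⟩, ⟨y, z, true⟩]))
    (.trans (h4.congr [⟨x, z, false⟩] []) (h5.congr [] [⟨y, z, true⟩, ⟨x, y, true⟩]))

theorem Comm.disjoint {x y z w : Strand ι} {b : List (Strand ι)}
    (hs : (x :: y :: z :: w :: b).Nodup) :
    Comm (x :: y :: z :: w :: b) ⟨x, y, true⟩ ⟨z, w, true⟩ := by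
  have h1 := (exchange (Letter.stack_fits ⟨x, y, true⟩) (Letter.stack_fits ⟨z, w, true⟩)).widenR b
  have h2 := WFus.of_fus (t := x :: y :: z :: w :: b) hs (by simp [Letter.stack_cr])
    (by simp [Letter.stack_cr]) (by
      have := ((Letter.stack_fits ⟨x, y, true⟩).widenR [z, w]).comp
        ((Letter.stack_fits ⟨z, w, true⟩).widenL [x, y])
      simpa using this.widenR b) h1
  simpa [Comm, word, Letter.stack, Piece.word] using h2

/-- Two arrows commute, unless they join the same two strands in opposite directions. -/
theorem Comm.of_ne {s : List (Strand ι)} {l m : Letter ι} (hs : s.Nodup) (hl : l.On s)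
    (hm : m.On s) (h : l.tail = m.head → l.head ≠ m.tail) : Comm s l m := by
  obtain ⟨x, y, e⟩ := l
  obtain ⟨z, w, e'⟩ := m
  obtain ⟨hxy, hx, hy⟩ := hl
  obtain ⟨hzw, hz, hw⟩ := hm
  simp only at hxy hx hy hzw hz hw h
  apply Comm.of_pos hs
  have three : ∀ {u v w : Strand ι}, u ≠ v → u ≠ w → v ≠ w → u ∈ s → v ∈ s → w ∈ s →
      ∃ r, s.Perm (u :: v :: w :: r) := by
    classical
    intro u v w huv huw hvw hu hv hw
    refine ⟨((s.erase u).erase v).erase w, (List.perm_cons_erase hu).trans (.cons _ ?_)⟩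
    refine (List.perm_cons_erase ((List.mem_erase_of_ne huv.symm).2 hv)).trans (.cons _ ?_)
    exact List.perm_cons_erase
      ((List.mem_erase_of_ne hvw.symm).2 ((List.mem_erase_of_ne huw.symm).2 hw))
  by_cases hxz : x = z
  · subst hxz
    by_cases hyw : y = w
    · subst hyw; exact WFus.refl _
    · obtain ⟨r, hr⟩ := three hxy hzw hyw hx hy hw
      exact WFus.perm hs hr (Comm.tails (hr.nodup hs))
  by_cases hyw : y = w
  · subst hyw
    obtain ⟨r, hr⟩ := three hxz hxy hzw hx hz hy
    exact WFus.perm hs hr (Comm.heads (hr.nodup hs))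
  by_cases hyz : y = z
  · subst hyz
    by_cases hxw : x = w
    · exact absurd rfl (h hxw)
    · obtain ⟨r, hr⟩ := three hxy hxw hzw hx hy hw
      exact WFus.perm hs hr (Comm.chain (hr.nodup hs))
  by_cases hxw : x = w
  · subst hxw
    obtain ⟨r, hr⟩ := three hzw (Ne.symm hyz) hxy hz hx hy
    exact WFus.perm hs hr (Comm.chain (hr.nodup hs)).symm
  have four : ∃ r, s.Perm (x :: y :: z :: w :: r) := by
    classical
    obtain ⟨r, hr⟩ := three hxy hxz hyz hx hy hz
    have : w ∈ r := by
      have := hr.subset hw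
      simpa [Ne.symm hxw, Ne.symm hyw, Ne.symm hzw] using this
    exact ⟨r.erase w, hr.trans (.cons _ (.cons _ (.cons _ (List.perm_cons_erase this))))⟩
  obtain ⟨r, hr⟩ := four
  exact WFus.perm hs hr (Comm.disjoint (hr.nodup hs))

/-! ### Reversal of strands -/

@[simp] theorem Strand.rev_rev (x : Strand ι) : x.rev.rev = x := by simp [Strand.rev]

theorem Strand.rev_ne (x : Strand ι) : x.rev ≠ x := by
  intro h
  have := congrArg Strand.up h
  simp [Strand.rev] at this

theorem Strand.eq_or_eq_rev {x y : Strand ι} (h : x.color = y.color) : x = y ∨ x = y.rev := by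
  obtain ⟨c, u⟩ := x
  obtain ⟨d, u'⟩ := y
  cases h
  cases u <;> cases u' <;> simp [Strand.rev]

@[simp] theorem Strand.rev_color (x : Strand ι) : x.rev.color = x.color := rfl

@[simp] theorem Strand.rev_up (x : Strand ι) : x.rev.up = !x.up := rfl

/-! ### Families of cups and caps -/

/-- The strands opened by cups, or closed by caps, at the strands `xs`. -/
def flat (xs : List (Strand ι)) : List (Strand ι) := xs.flatMap fun x => [x, x.rev]

@[simp] theorem flat_nil : flat ([] : List (Strand ι)) = [] := rfl

@[simp] theorem flat_cons (x : Strand ι) (xs : List (Strand ι)) :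
    flat (x :: xs) = x :: x.rev :: flat xs := rfl

@[simp] theorem flat_append (xs ys : List (Strand ι)) : flat (xs ++ ys) = flat xs ++ flat ys := by
  simp [flat]

theorem mem_flat {x : Strand ι} {xs : List (Strand ι)} : x ∈ flat xs ↔ x ∈ xs ∨ x.rev ∈ xs := by
  induction xs with
  | nil => simp
  | cons y xs ih =>
    have : x = y.rev ↔ x.rev = y := ⟨fun h => by simp [h], fun h => by simp [← h]⟩
    simp only [flat_cons, List.mem_cons, ih, this]
    tauto

theorem rev_mem_flat {x : Strand ι} {xs : List (Strand ι)} : x.rev ∈ flat xs ↔ x ∈ flat xs := by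
  simp [mem_flat, or_comm]

/-- A family of cups, side by side. -/
def cups : List (Strand ι) → Stack ι
  | [] => []
  | x :: xs => cups xs ++ [⟨[], .cup x, flat xs⟩]

/-- A family of caps, side by side. -/
def caps : List (Strand ι) → Stack ι
  | [] => []
  | x :: xs => ⟨[], .cap x, flat xs⟩ :: caps xs

theorem slice_cup_fits (x : Strand ι) (a b : List (Strand ι)) :
    Fits (a ++ b) [⟨a, .cup x, b⟩] (a ++ x :: x.rev :: b) := by
  simp [Fits, Slice.bot, Slice.top, Piece.bot, Piece.top]

theorem slice_cap_fits (x : Strand ι) (a b : List (Strand ι)) :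
    Fits (a ++ x :: x.rev :: b) [⟨a, .cap x, b⟩] (a ++ b) := by
  simp [Fits, Slice.bot, Slice.top, Piece.bot, Piece.top]

theorem cups_fits (xs : List (Strand ι)) : Fits [] (cups xs) (flat xs) := by
  induction xs with
  | nil => rfl
  | cons x xs ih => exact ih.comp (slice_cup_fits x [] _)

theorem caps_fits (xs : List (Strand ι)) : Fits (flat xs) (caps xs) [] := by
  induction xs with
  | nil => rfl
  | cons x xs ih => exact (slice_cap_fits x [] _).comp ih

/-- A cup may be opened at the left end and moved to its place by virtual crossings. -/
theorem cup_slide (x : Strand ι) (a b : List (Strand ι)) : Fus (a ++ b)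
    (⟨a, .cup x, b⟩ :: wd [] b (bl a [x, x.rev])) [⟨[], .cup x, a ++ b⟩] := by
  simpa [bl_nil] using (bl_natural a (slice_cup_fits x [] [])).widenR b

/-- A cap may be moved to the left end by virtual crossings. -/
theorem cap_slide (x : Strand ι) (a b : List (Strand ι)) : Fus (a ++ x :: x.rev :: b)
    [⟨a, .cap x, b⟩] (wd [] b (bl a [x, x.rev]) ++ [⟨[], .cap x, a ++ b⟩]) := by
  simpa [bl_nil] using (bl_natural a (slice_cap_fits x [] [])).widenR b

theorem exchange_cup (x : Strand ι) {t t' : List (Strand ι)} {v : Stack ι} (hv : Fits t v t') :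
    Fus t (⟨[], .cup x, t⟩ :: wd [x, x.rev] [] v) (v ++ [⟨[], .cup x, t'⟩]) := by
  simpa [Slice.bot, Slice.top, Piece.bot, Piece.top] using
    exchange_slice_stack ⟨[], .cup x, []⟩ hv

theorem exchange_cap (x : Strand ι) {t t' : List (Strand ι)} {v : Stack ι} (hv : Fits t v t') :
    Fus (x :: x.rev :: t) (⟨[], .cap x, t⟩ :: v) (wd [x, x.rev] [] v ++ [⟨[], .cap x, t'⟩]) := by
  simpa [Slice.bot, Slice.top, Piece.bot, Piece.top] using
    exchange_slice_stack ⟨[], .cap x, []⟩ hv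

/-- A cup of the family may be opened last. -/
theorem cups_insert (x : Strand ι) (xa xb : List (Strand ι)) :
    Fus [] (cups (xa ++ x :: xb)) (cups (xa ++ xb) ++ [⟨flat xa, .cup x, flat xb⟩]) := by
  induction xa with
  | nil => exact Eqv.refl _
  | cons w xa ih =>
    have h1 := ih.right [⟨[], .cup w, flat (xa ++ x :: xb)⟩]
    have h2 := Eqv.left (cups_fits (xa ++ xb))
      (by simpa using (exchange_cup w (slice_cup_fits x (flat xa) (flat xb))).symm)
    simp [cups] at h1 h2 ⊢
    exact h1.trans h2

/-- A cap of the family may be closed first. -/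
theorem caps_insert (x : Strand ι) (xa xb : List (Strand ι)) :
    Fus (flat (xa ++ x :: xb)) (caps (xa ++ x :: xb))
      (⟨flat xa, .cap x, flat xb⟩ :: caps (xa ++ xb)) := by
  induction xa with
  | nil => exact Eqv.refl _
  | cons w xa ih =>
    have h1 := Eqv.left (slice_cap_fits w [] (flat (xa ++ x :: xb))) ih
    have h2 := (exchange_cap w (slice_cap_fits x (flat xa) (flat xb))).right (caps (xa ++ xb))
    simp [caps] at h1 h2 ⊢
    exact h1.trans h2

theorem cups_flip (x : Strand ι) (xa xb : List (Strand ι)) :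
    Fus [] (cups (xa ++ x :: xb))
      (cups (xa ++ x.rev :: xb) ++ [⟨flat xa, .cross .virt x.rev x, flat xb⟩]) := by
  have h1 := cups_insert x xa xb
  have h2 := (cups_insert x.rev xa xb).right [⟨flat xa, .cross .virt x.rev x, flat xb⟩]
  have h3 : Fus [] [⟨[], .cup x.rev, []⟩, ⟨[], .cross .virt x.rev x, []⟩] [⟨[], .cup x, []⟩] := by
    have := Fus.of_welded (.VR1cup x.rev) (s := []) (t := [x, x.rev])
      (by simp [Fits, Slice.bot, Slice.top, Piece.bot, Piece.top])
      (by simp [Fits, Slice.bot, Slice.top, Piece.bot, Piece.top])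
    simpa using this
  have h4 := Eqv.left (cups_fits (xa ++ xb)) (by simpa using h3.widen (flat xa) (flat xb))
  simp at h2 h4
  exact h1.trans (h4.symm.trans h2.symm)

theorem caps_flip (x : Strand ι) (xa xb : List (Strand ι)) :
    Fus (flat (xa ++ x :: xb)) (caps (xa ++ x :: xb))
      (⟨flat xa, .cross .virt x x.rev, flat xb⟩ :: caps (xa ++ x.rev :: xb)) := by
  have h1 := caps_insert x xa xb
  have h2 := Eqv.left (s := flat (xa ++ x :: xb))
    (by simpa using slice_cross_fits .virt x x.rev (flat xa) (flat xb))
    (by simpa using caps_insert x.rev xa xb)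
  have h3 : Fus [x, x.rev] [⟨[], .cross .virt x x.rev, []⟩, ⟨[], .cap x.rev, []⟩]
      [⟨[], .cap x, []⟩] :=
    Fus.of_welded (.VR1cap x) (t := [])
      (by simp [Fits, Slice.bot, Slice.top, Piece.bot, Piece.top])
      (by simp [Fits, Slice.bot, Slice.top, Piece.bot, Piece.top])
  have h4 := (h3.widen (flat xa) (flat xb)).right (caps (xa ++ xb))
  simp at h1 h2 h4 ⊢
  exact h1.trans (h4.symm.trans h2.symm)

theorem exists_of_mem_flat {x : Strand ι} {xs : List (Strand ι)} (h : x ∈ flat xs) :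
    ∃ xa xb, xs = xa ++ x :: xb ∨ xs = xa ++ x.rev :: xb := by
  rcases mem_flat.1 h with h | h
  · obtain ⟨xa, xb, h⟩ := List.append_of_mem h
    exact ⟨xa, xb, .inl h⟩
  · obtain ⟨xa, xb, h⟩ := List.append_of_mem h
    exact ⟨xa, xb, .inr h⟩

theorem flat_perm_cancel {x : Strand ι} {xs xa xb : List (Strand ι)}
    (h : (flat (x :: xs)).Perm (flat (xa ++ x :: xb))) : (flat xs).Perm (flat (xa ++ xb)) := by
  have h1 : (flat (xa ++ x :: xb)).Perm (x :: x.rev :: flat (xa ++ xb)) := by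
    have := (List.perm_append_comm (l₁ := flat xa) (l₂ := [x, x.rev])).append_right (flat xb)
    simpa using this
  exact (List.perm_cons _).1 ((List.perm_cons _).1 (h.trans h1))

theorem flat_perm_flip (x : Strand ι) (xa xb : List (Strand ι)) :
    (flat (xa ++ x.rev :: xb)).Perm (flat (xa ++ x :: xb)) := by
  simpa using (List.Perm.swap x x.rev (flat xb)).append_left (flat xa)

/-- Any strand opened by a family of cups may be taken as the left strand of the first cup. -/
theorem exists_flat_perm {x : Strand ι} {xs : List (Strand ι)} (hx : x ∈ flat xs) :
    ∃ r, (flat (x :: r)).Perm (flat xs) := by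
  obtain ⟨xa, xb, h⟩ := exists_of_mem_flat hx
  refine ⟨xa ++ xb, ?_⟩
  have := (List.perm_append_comm (l₁ := flat xa) (l₂ := [x, x.rev])).append_right (flat xb)
  have h' : (flat (x :: (xa ++ xb))).Perm (flat (xa ++ x :: xb)) := by simpa using this.symm
  rcases h with rfl | rfl
  · exact h'
  · exact h'.trans (flat_perm_flip x xa xb).symm

/-- Strands opened by different cups may be taken as the inner strands of the first two cups. -/
theorem exists_flat_perm_two {x y : Strand ι} {xs : List (Strand ι)} (hx : x ∈ flat xs)
    (hy : y ∈ flat xs) (hxy : y ≠ x) (hxy' : y ≠ x.rev) :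
    ∃ r, (flat (y.rev :: x :: r)).Perm (flat xs) := by
  obtain ⟨r, hr⟩ := exists_flat_perm (rev_mem_flat.2 hy)
  have : x ∈ flat r := by
    have := hr.symm.subset hx
    simpa [Ne.symm hxy, show x ≠ y.rev from fun h => hxy' (by simp [h])] using this
  obtain ⟨r', hr'⟩ := exists_flat_perm this
  exact ⟨r', .trans (.cons _ (.cons _ hr')) hr⟩

/-- Cups may be permuted and reversed at the expense of virtual crossings above them. -/
theorem exists_cups_perm {xs xs' : List (Strand ι)} (h : (flat xs').Perm (flat xs)) :
    ∃ v, Vir v ∧ Fits (flat xs') v (flat xs) ∧ Fus [] (cups xs) (cups xs' ++ v) := by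
  induction xs' generalizing xs with
  | nil =>
    cases xs with
    | nil => exact ⟨[], by simp, rfl, Eqv.refl _⟩
    | cons x xs => simp at h
  | cons x xs' ih =>
    have key : ∀ xa xb, (flat (x :: xs')).Perm (flat (xa ++ x :: xb)) →
        ∃ v, Vir v ∧ Fits (flat (x :: xs')) v (flat (xa ++ x :: xb)) ∧
          Fus [] (cups (xa ++ x :: xb)) (cups (x :: xs') ++ v) := by
      intro xa xb h
      obtain ⟨v, h1, h2, h3⟩ := ih (flat_perm_cancel h)
      rw [flat_append] at h2
      have hb : Fits (flat xa ++ x :: x.rev :: flat xb) (wd [] (flat xb) (bl (flat xa) [x, x.rev]))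
          (x :: x.rev :: (flat xa ++ flat xb)) := by
        simpa using (bl_fits (flat xa) [x, x.rev]).widenR (flat xb)
      obtain ⟨w, hw1, hw2, hw3, -⟩ := Vir.exists_inverse (by simp [bl_vir]) hb
      have h4 := (cup_slide x (flat xa) (flat xb)).right w
      have h5 := Eqv.left (slice_cup_fits x (flat xa) (flat xb)) hw3
      have h6 : Fus (flat xa ++ flat xb) [⟨flat xa, .cup x, flat xb⟩]
          (⟨[], .cup x, flat xa ++ flat xb⟩ :: w) := by
        simpa using h5.symm.trans h4
      have h7 := ((cups_insert x xa xb).trans (h3.right _)).trans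
        (by simpa using Eqv.left ((cups_fits xs').comp h2) h6)
      have h8 := Eqv.mid (cups_fits xs') (exchange_cup x h2).symm w
      refine ⟨wd [x, x.rev] [] v ++ w, by simp [h1, hw1], ?_, ?_⟩
      · have := (h2.widenL [x, x.rev]).comp hw2
        simpa using this
      · simp [cups] at h7 h8 ⊢
        exact h7.trans h8
    obtain ⟨xa, xb, rfl | rfl⟩ := exists_of_mem_flat (h.subset (show x ∈ flat (x :: xs') by simp))
    · exact key xa xb h
    · obtain ⟨v, h1, h2, h3⟩ := key xa xb (h.trans (flat_perm_flip x xa xb))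
      have h4 := cups_flip x.rev xa xb
      refine ⟨v ++ [⟨flat xa, .cross .virt x x.rev, flat xb⟩], by simp [h1], h2.comp ?_, ?_⟩
      · simpa using slice_cross_fits .virt x x.rev (flat xa) (flat xb)
      · have h5 := h3.right [⟨flat xa, .cross .virt x x.rev, flat xb⟩]
        simp at h4 h5 ⊢
        exact h4.trans h5

/-- Caps may be permuted and reversed at the expense of virtual crossings below them. -/
theorem exists_caps_perm {xs xs' : List (Strand ι)} (h : (flat xs').Perm (flat xs)) :
    ∃ v, Vir v ∧ Fits (flat xs) v (flat xs') ∧ Fus (flat xs) (caps xs) (v ++ caps xs') := by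
  induction xs' generalizing xs with
  | nil =>
    cases xs with
    | nil => exact ⟨[], by simp, rfl, Eqv.refl _⟩
    | cons x xs => simp at h
  | cons x xs' ih =>
    have key : ∀ xa xb, (flat (x :: xs')).Perm (flat (xa ++ x :: xb)) →
        ∃ v, Vir v ∧ Fits (flat (xa ++ x :: xb)) v (flat (x :: xs')) ∧
          Fus (flat (xa ++ x :: xb)) (caps (xa ++ x :: xb)) (v ++ caps (x :: xs')) := by
      intro xa xb h
      obtain ⟨v, h1, h2, h3⟩ := ih (flat_perm_cancel h)
      rw [flat_append] at h2 h3
      have hb : Fits (flat xa ++ x :: x.rev :: flat xb) (wd [] (flat xb) (bl (flat xa) [x, x.rev]))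
          (x :: x.rev :: (flat xa ++ flat xb)) := by
        simpa using (bl_fits (flat xa) [x, x.rev]).widenR (flat xb)
      have h4 := (cap_slide x (flat xa) (flat xb)).right (caps (xa ++ xb))
      have h5 := Eqv.left (hb.comp (slice_cap_fits x [] (flat xa ++ flat xb))) h3
      have h6 := Eqv.mid hb (exchange_cap x h2) (caps xs')
      refine ⟨wd [] (flat xb) (bl (flat xa) [x, x.rev]) ++ wd [x, x.rev] [] v,
        by simp [h1, bl_vir], ?_, ?_⟩
      · have := hb.comp (h2.widenL [x, x.rev])
        simpa using this
      · have h7 := caps_insert x xa xb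
        simp [caps] at h4 h5 h6 h7 ⊢
        exact h7.trans (h4.trans (h5.trans h6))
    obtain ⟨xa, xb, rfl | rfl⟩ := exists_of_mem_flat (h.subset (show x ∈ flat (x :: xs') by simp))
    · exact key xa xb h
    · obtain ⟨v, h1, h2, h3⟩ := key xa xb (h.trans (flat_perm_flip x xa xb))
      have h4 := caps_flip x.rev xa xb
      have h0 : Fits (flat (xa ++ x.rev :: xb)) [⟨flat xa, .cross .virt x.rev x, flat xb⟩]
          (flat (xa ++ x :: xb)) := by
        simpa using slice_cross_fits .virt x.rev x (flat xa) (flat xb)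
      refine ⟨⟨flat xa, .cross .virt x.rev x, flat xb⟩ :: v, by simp [h1], h0.comp h2, ?_⟩
      have h5 := Eqv.left h0 h3
      simp at h4 h5 ⊢
      exact h4.trans h5

/-- By coherence, the virtual crossings of `exists_cups_perm` may be any that fit. -/
theorem cups_perm {xs xs' : List (Strand ι)} {v : Stack ι} (hn : (flat xs').Nodup) (hv : Vir v)
    (hf : Fits (flat xs') v (flat xs)) : Fus [] (cups xs) (cups xs' ++ v) := by
  obtain ⟨w, h1, h2, h3⟩ := exists_cups_perm (hv.cr.perm hf)
  exact h3.trans (Eqv.left (cups_fits xs') (Vir.coherence hn h1 hv h2 hf))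

theorem caps_perm {xs xs' : List (Strand ι)} {v : Stack ι} (hn : (flat xs).Nodup) (hv : Vir v)
    (hf : Fits (flat xs) v (flat xs')) : Fus (flat xs) (caps xs) (v ++ caps xs') := by
  obtain ⟨w, h1, h2, h3⟩ := exists_caps_perm (hv.cr.perm hf).symm
  exact h3.trans ((Vir.coherence hn h1 hv h2 hf).right _)

/-! ### Arrows on cups -/

/-- The words `W` and `W'` of arrows give equivalent stacks after a family of cups. -/
def BFus (xs : List (Strand ι)) (W W' : List (Letter ι)) : Prop :=
  Fus [] (cups xs ++ real (flat xs) W) (cups xs ++ real (flat xs) W')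

namespace BFus

variable {xs xs' : List (Strand ι)} {U V W W' W'' : List (Letter ι)}

theorem refl (W : List (Letter ι)) : BFus xs W W := Eqv.refl _

theorem symm (h : BFus xs W W') : BFus xs W' W := Eqv.symm h

theorem trans (h : BFus xs W W') (h' : BFus xs W' W'') : BFus xs W W'' := Eqv.trans h h'

theorem right (h : BFus xs W W') (V : List (Letter ι)) : BFus xs (W ++ V) (W' ++ V) := by
  have := Eqv.right h (real (flat xs) V)
  simpa [BFus] using this

theorem of_wfus (h : WFus (flat xs) W W') : BFus xs W W' := Eqv.left (cups_fits xs) h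

theorem perm (hn : (flat xs').Nodup) (hp : (flat xs').Perm (flat xs)) (h : BFus xs' W W') :
    BFus xs W W' := by
  have hf := vp_fits hp
  have h1 := cups_perm hn (vp_vir _ _) hf
  have key : ∀ U, Fus [] (cups xs ++ real (flat xs) U)
      (cups xs' ++ real (flat xs') U ++ vp (flat xs') (flat xs)) := by
    intro U
    have h2 := h1.right (real (flat xs) U)
    have h3 := Eqv.left (cups_fits xs') (real_vir U hn (vp_vir _ _) hf).symm
    simp at h2 h3 ⊢
    exact h2.trans h3
  exact (key W).trans ((Eqv.right h _).trans (key W').symm)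

end BFus

/-- An end of an arrow moves from one side of a local minimum to the other one. -/
theorem cup_word (k : Kind) {x y : Strand ι} (hs : [y, x, x.rev].Nodup) :
    Fus [y] (⟨[y], .cup x, []⟩ :: real [y, x, x.rev] (Piece.cross k y x).word)
      (⟨[y], .cup x, []⟩ :: real [y, x, x.rev] (Piece.cross k.flip x.rev y).word) := by
  have hp : [y, x, x.rev].Perm [x, x.rev, y] := List.perm_append_comm (l₁ := [y])
  have hp' : [y, x, x.rev].Perm [x, y, x.rev] := List.Perm.swap _ _ _
  have h0 : ∀ k, Fus [y] [⟨[y], .cup x, []⟩, ⟨[], .cross k y x, [x.rev]⟩]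
      [⟨[], .cup x, [y]⟩, ⟨[x], .cross k.flip x.rev y, []⟩] := fun k =>
    Fus.of_welded (.cupSlide k x y) (t := [x, y, x.rev])
      (by simp [Fits, Slice.bot, Slice.top, Piece.bot, Piece.top])
      (by simp [Fits, Slice.bot, Slice.top, Piece.bot, Piece.top])
  have hc : Fits [y] [⟨[y], .cup x, []⟩] [y, x, x.rev] := slice_cup_fits x [y] []
  have hc' : Fits [y] [⟨[], .cup x, [y]⟩] [x, x.rev, y] := slice_cup_fits x [] [y]
  have hV : Fits [y, x, x.rev] [⟨[], .cross .virt y x, [x.rev]⟩] [x, y, x.rev] :=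
    slice_cross_fits .virt y x [] [x.rev]
  have hV' : Fits [x, x.rev, y] [⟨[x], .cross .virt x.rev y, []⟩] [x, y, x.rev] :=
    slice_cross_fits .virt x.rev y [x] []
  have h1 := Eqv.left hc (Fus.cross_word k (a := []) (b := [x.rev]) hs)
  have h2 := Eqv.left hc' (Fus.cross_word k.flip (a := [x]) (b := []) (hp.nodup hs))
  have h3 := Eqv.left hc' (real_vir (Piece.cross k.flip x.rev y).word (hp.nodup hs) (by simp) hV')
  have h4 := (h0 .virt).right (real [x, y, x.rev] (Piece.cross k.flip x.rev y).word)
  have h5 := Eqv.left hc (real_vir (Piece.cross k.flip x.rev y).word hs (by simp) hV)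
  have h6 : Fus [y] (⟨[y], .cup x, []⟩ :: (real [y, x, x.rev] (Piece.cross k y x).word ++
      [⟨[], .cross .virt y x, [x.rev]⟩]))
      (⟨[y], .cup x, []⟩ :: (real [y, x, x.rev] (Piece.cross k.flip x.rev y).word ++
      [⟨[], .cross .virt y x, [x.rev]⟩])) :=
    h1.symm.trans ((h0 k).trans (h2.trans (h3.trans (h4.symm.trans h5.symm))))
  have h7 := h6.right [⟨[], .cross .virt x y, [x.rev]⟩]
  have h8 : ∀ W, Fus [y] (⟨[y], .cup x, []⟩ :: (real [y, x, x.rev] W ++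
      [⟨[], .cross .virt y x, [x.rev]⟩, ⟨[], .cross .virt x y, [x.rev]⟩]))
      (⟨[y], .cup x, []⟩ :: real [y, x, x.rev] W) := by
    intro W
    have := Eqv.left (hc.comp (real_fits _ W)) ((virt_cancel y x).widenR [x.rev])
    simpa using this
  have h9 := (h8 _).symm.trans (.trans (by simpa using h7) (h8 _))
  exact h9

/-- The form of `BFus.conv_head` and `BFus.conv_tail` that comes from a slide at a minimum:
`cup_word` is applied to the second one of two neighbouring minima, which belong to the two ends of
the arrow. -/
theorem bfus_conv (k : Kind) {xs : List (Strand ι)} {x y : Strand ι} (hn : (flat xs).Nodup)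
    (hx : x ∈ flat xs) (hy : y ∈ flat xs) (hxy : y ≠ x) (hxy' : y ≠ x.rev) :
    BFus xs (Piece.cross k y x).word (Piece.cross k.flip x.rev y).word := by
  obtain ⟨xs', hp⟩ := exists_flat_perm_two hx hy hxy hxy'
  have hn' := hp.symm.nodup hn
  refine BFus.perm hn' hp ?_
  have hc := cups_insert x [y.rev] xs'
  have hs : [y, x, x.rev].Nodup := by
    have : [y, x, x.rev].Sublist (flat (y.rev :: x :: xs')) := by
      simp only [flat_cons, Strand.rev_rev]
      exact .cons _ (.cons_cons _ (.cons_cons _ (.cons_cons _ (List.nil_sublist _))))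
    exact hn'.sublist this
  have hfl : flat (y.rev :: x :: xs') = [y.rev] ++ [y, x, x.rev] ++ flat xs' := by simp
  have key : ∀ W : List (Letter ι), (∀ l ∈ W, l.On [y, x, x.rev]) →
      Fus [] (cups (y.rev :: x :: xs') ++ real (flat (y.rev :: x :: xs')) W)
        (cups (y.rev :: xs') ++ wd [y.rev] (flat xs')
          (⟨[y], .cup x, []⟩ :: real [y, x, x.rev] W)) := by
    intro W hW
    have h1 := hc.right (real (flat (y.rev :: x :: xs')) W)
    have h2 := Eqv.left (s := []) (u := cups (y.rev :: xs') ++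
      [⟨flat [y.rev], .cup x, flat xs'⟩]) (by
        have := (cups_fits (y.rev :: xs')).comp (slice_cup_fits x (flat [y.rev]) (flat xs'))
        simpa using this) (real_widen (a := [y.rev]) (b := flat xs') (by rw [← hfl]; exact hn') hW)
    rw [← hfl] at h2
    simp at h1 h2 ⊢
    exact h1.trans h2.symm
  have hW : ∀ l ∈ (Piece.cross k y x).word, l.On [y, x, x.rev] := by
    rcases k with _ | _ | _ <;> simp [Piece.word, Letter.On, hxy, Ne.symm hxy]
  have hW' : ∀ l ∈ (Piece.cross k.flip x.rev y).word, l.On [y, x, x.rev] := by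
    rcases k with _ | _ | _ <;> simp [Piece.word, Letter.On, Kind.flip, hxy', Ne.symm hxy']
  have hm := Eqv.left (s := []) (cups_fits (y.rev :: xs'))
    (by simpa using (cup_word k hs).widen [y.rev] (flat xs'))
  exact (key _ hW).trans (.trans (by simpa using hm) (key _ hW').symm)

/-- The head of an arrow moves across a local minimum. -/
theorem BFus.conv_head {xs : List (Strand ι)} {x y : Strand ι} (hn : (flat xs).Nodup)
    (hx : x ∈ flat xs) (hy : y ∈ flat xs) (hxy : y ≠ x) (hxy' : y ≠ x.rev) (e : Bool) :
    BFus xs [⟨y, x, e⟩] [⟨y, x.rev, !e⟩] := by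
  cases e
  · have := bfus_conv (.classical true) hn (rev_mem_flat.2 hx) hy hxy' (by simpa)
    simpa [Piece.word, Kind.flip] using this.symm
  · exact bfus_conv (.classical true) hn hx hy hxy hxy'

/-- The tail of an arrow moves across a local minimum. -/
theorem BFus.conv_tail {xs : List (Strand ι)} {x y : Strand ι} (hn : (flat xs).Nodup)
    (hx : x ∈ flat xs) (hy : y ∈ flat xs) (hxy : y ≠ x) (hxy' : y ≠ x.rev) (e : Bool) :
    BFus xs [⟨x, y, e⟩] [⟨x.rev, y, !e⟩] := by
  cases e
  · exact bfus_conv (.classical false) hn hx hy hxy hxy'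
  · have := bfus_conv (.classical false) hn (rev_mem_flat.2 hx) hy hxy' (by simpa)
    simpa [Piece.word, Kind.flip] using this.symm

/-- An arrow between the two sides of a local minimum vanishes. -/
theorem BFus.kill {xs : List (Strand ι)} {x : Strand ι} (hn : (flat xs).Nodup)
    (hx : x ∈ flat xs) (e : Bool) : BFus xs [⟨x, x.rev, e⟩] [] := by
  obtain ⟨r, hp⟩ := exists_flat_perm hx
  have hn' := hp.symm.nodup hn
  refine BFus.perm hn' hp ?_
  have h1 := Eqv.left (cups_fits (x :: r)) (arr_local ⟨x, x.rev, e⟩ [] (flat r) hn').symm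
  have hR : ∀ o, Fus [] [⟨[], .cup x, []⟩, ⟨[], .cross (.classical o) x x.rev, []⟩]
      [⟨[], .cup x.rev, []⟩] := fun o =>
    Fus.of_welded (.R1cup o x) (t := [x.rev, x])
      (by simp [Fits, Slice.bot, Slice.top, Piece.bot, Piece.top])
      (by simp [Fits, Slice.bot, Slice.top, Piece.bot, Piece.top])
  have hR' : ∀ o, Fus [] [⟨[], .cup x.rev, []⟩, ⟨[], .cross (.classical o) x.rev x, []⟩]
      [⟨[], .cup x, []⟩] := fun o => by
    have := Fus.of_welded (.R1cup o x.rev) (s := []) (t := [x, x.rev])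
      (by simp [Fits, Slice.bot, Slice.top, Piece.bot, Piece.top])
      (by simp [Fits, Slice.bot, Slice.top, Piece.bot, Piece.top])
    simpa using this
  have hV : Fus [] [⟨[], .cup x, []⟩, ⟨[], .cross .virt x x.rev, []⟩]
      [⟨[], .cup x.rev, []⟩] :=
    Fus.of_welded (.VR1cup x) (t := [x.rev, x])
      (by simp [Fits, Slice.bot, Slice.top, Piece.bot, Piece.top])
      (by simp [Fits, Slice.bot, Slice.top, Piece.bot, Piece.top])
  have hV' : Fus [] [⟨[], .cup x.rev, []⟩, ⟨[], .cross .virt x.rev x, []⟩]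
      [⟨[], .cup x, []⟩] := by
    have := Fus.of_welded (.VR1cup x.rev) (s := []) (t := [x, x.rev])
      (by simp [Fits, Slice.bot, Slice.top, Piece.bot, Piece.top])
      (by simp [Fits, Slice.bot, Slice.top, Piece.bot, Piece.top])
    simpa using this
  have h2 : Fus [] (⟨[], .cup x, []⟩ :: (Letter.stack ⟨x, x.rev, e⟩)) [⟨[], .cup x, []⟩] := by
    cases e
    · exact (hV.right [⟨[], .cross (.classical false) x.rev x, []⟩]).trans (hR' false)
    · exact ((hR true).right [⟨[], .cross .virt x.rev x, []⟩]).trans hV'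
  have h3 := Eqv.left (cups_fits r) (h2.widenR (flat r))
  simp [BFus, cups] at h1 h3 ⊢
  exact h1.trans h3

/-! ### Normal forms of words of arrows on cups -/

/-- An arrow moves below all arrows with which it commutes. -/
theorem WFus.move {s : List (Strand ι)} {l : Letter ι} {U : List (Letter ι)}
    (h : ∀ m ∈ U, Comm s m l) : WFus s (U ++ [l]) (l :: U) := by
  induction U with
  | nil => exact WFus.refl _
  | cons m U ih =>
    have h1 := (ih fun m hm => h m (by simp [hm])).congr [m] []
    have h2 := WFus.congr (h m (by simp)) [] U
    simp at h1 h2 ⊢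
    exact h1.trans h2

theorem BFus.move {xs : List (Strand ι)} {l : Letter ι} {U : List (Letter ι)}
    (h : ∀ m ∈ U, Comm (flat xs) m l) (V : List (Letter ι)) :
    BFus xs (U ++ l :: V) (l :: (U ++ V)) := by
  simpa using BFus.of_wfus ((WFus.move h).congr [] V)

/-- If every letter of `N` may be replaced by its image under `c` as long as it is the lowest one,
and commutes with these images, then all letters of `N` may be replaced, one after the other. -/
theorem BFus.conv {xs : List (Strand ι)} (c : Letter ι → Letter ι) {N : List (Letter ι)}
    (h1 : ∀ l ∈ N, BFus xs [l] [c l]) (h2 : ∀ l ∈ N, ∀ m ∈ N, Comm (flat xs) (c m) l) :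
    BFus xs N (N.map c).reverse := by
  -- `C` is the word of the letters that have been replaced already
  suffices ∀ N C : List (Letter ι), (∀ l ∈ N, BFus xs [l] [c l]) →
      (∀ l ∈ N, ∀ m ∈ N, Comm (flat xs) (c m) l) → (∀ l ∈ N, ∀ m ∈ C, Comm (flat xs) m l) →
      BFus xs (C ++ N) ((N.map c).reverse ++ C) by
    simpa using this N [] h1 h2 (by simp)
  intro N
  induction N with
  | nil => intro C _ _ _; simpa using BFus.refl _
  | cons l N ih =>
    intro C h1 h2 h3
    have h4 := BFus.move (U := C) (h3 l (by simp)) N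
    have h5 := (h1 l (by simp)).right (C ++ N)
    have h6 := ih (c l :: C) (fun l hl => h1 l (by simp [hl]))
      (fun l hl m hm => h2 l (by simp [hl]) m (by simp [hm])) (by
        intro l' hl m hm
        rcases List.mem_cons.1 hm with rfl | hm
        · exact h2 l' (by simp [hl]) l (by simp)
        · exact h3 l' (by simp [hl]) m hm)
    simp at h4 h5 h6 ⊢
    exact h4.trans (h5.trans h6)

/-- A choice of one side of every local minimum. -/
def IsSide (T : Strand ι → Prop) : Prop := ∀ x, T x.rev ↔ ¬ T x

/-- All tails lie on the chosen sides of the local minima, all heads on the other sides, and no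
arrow joins a component to itself. -/
structure Letter.Normal (T : Strand ι → Prop) (s : List (Strand ι)) (l : Letter ι) : Prop where
  on : l.On s
  tail : T l.tail
  head : ¬ T l.head
  color : l.tail.color ≠ l.head.color

theorem Letter.on_of_color {s : List (Strand ι)} {x y : Strand ι} {e : Bool} (hx : x ∈ s)
    (hy : y ∈ s) (h : x.color ≠ y.color) : Letter.On s ⟨x, y, e⟩ :=
  ⟨fun h' => h (congrArg Strand.color h'), hx, hy⟩

theorem Letter.Normal.inv {T : Strand ι → Prop} {s : List (Strand ι)} {l : Letter ι}
    (h : l.Normal T s) : l.inv.Normal T s := ⟨h.on, h.tail, h.head, h.color⟩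

/-- Turn the head of an arrow to the other side. -/
def Letter.turn (l : Letter ι) : Letter ι := ⟨l.tail, l.head.rev, !l.pos⟩

theorem BFus.turn {xs : List (Strand ι)} (hn : (flat xs).Nodup) {l : Letter ι}
    (hl : l.On (flat xs)) (hc : l.tail.color ≠ l.head.color) : BFus xs [l] [l.turn] := by
  refine BFus.conv_head hn hl.2.2 hl.2.1 hl.1 (fun h => hc ?_) l.pos
  rw [h]; rfl

/-- One more arrow `h` is made normal, above a normal word `N`. First the arrows of `N` are turned
so that `h` commutes with all of them; then `h` becomes the lowest arrow, its ends are moved to the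
right sides, it goes back to its place, and the arrows of `N` are turned back. -/
theorem exists_normal_step {xs : List (Strand ι)} (hn : (flat xs).Nodup) {T : Strand ι → Prop}
    (hT : IsSide T) {N : List (Letter ι)} {h : Letter ι} (hN : ∀ l ∈ N, l.Normal T (flat xs))
    (hh : h.On (flat xs)) : ∃ N', (∀ l ∈ N', l.Normal T (flat xs)) ∧ BFus xs (N ++ [h]) N' := by
  classical
  by_cases hc : h.tail.color = h.head.color
  · -- an arrow joining a component to itself commutes with all normal arrows
    refine ⟨N, hN, ?_⟩
    have h1 := BFus.move (xs := xs) (U := N) (l := h) (fun m hm =>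
      Comm.of_ne hn (hN m hm).on hh fun h1 h2 => (hN m hm).color (by rw [h1, h2, hc])) []
    have h2 : h.head = h.tail.rev := by
      rcases Strand.eq_or_eq_rev hc with h' | h'
      · exact absurd h' hh.1
      · simp [h']
    have h3 : BFus xs [h] [] := by
      obtain ⟨x, y, e⟩ := h
      simp only at h2
      subst h2
      exact BFus.kill hn hh.2.1 e
    have h4 := h3.right N
    simp only [List.append_nil] at h1
    exact h1.trans h4
  · obtain ⟨h', hnorm, hb⟩ : ∃ h' : Letter ι, h'.Normal T (flat xs) ∧ BFus xs [h] [h'] := by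
      obtain ⟨x, y, e⟩ := h
      simp only at hc
      obtain ⟨-, hx, hy⟩ := hh
      simp only at hx hy
      have step : ∀ e, ∃ x' e', x' ∈ flat xs ∧ x'.color = x.color ∧ T x' ∧
          BFus xs [⟨x, y, e⟩] [⟨x', y, e'⟩] := by
        intro e
        by_cases hTx : T x
        · exact ⟨x, e, hx, rfl, hTx, BFus.refl _⟩
        · exact ⟨x.rev, !e, rev_mem_flat.2 hx, rfl, (hT x).2 hTx, BFus.conv_tail hn hx hy
            (fun h => hc (by rw [h])) (fun h => hc (by rw [h]; rfl)) e⟩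
      obtain ⟨x', e', hx', hcx, hTx, h1⟩ := step e
      by_cases hTy : T y
      · refine ⟨⟨x', y.rev, !e'⟩, ⟨Letter.on_of_color hx' (rev_mem_flat.2 hy) ?_, hTx, ?_, ?_⟩,
          h1.trans (BFus.conv_head hn hy hx' ?_ ?_ e')⟩
        · simpa [hcx] using hc
        · simpa [hT y] using hTy
        · simpa [hcx] using hc
        · intro h; exact hc (by rw [← hcx, h])
        · intro h; exact hc (by rw [← hcx, h]; rfl)
      · exact ⟨⟨x', y, e'⟩, ⟨Letter.on_of_color hx' hy (by simpa [hcx] using hc), hTx, hTy,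
          by simpa [hcx] using hc⟩, h1⟩
    refine ⟨N ++ [h'], by
      intro l hl
      rcases List.mem_append.1 hl with hl | hl
      · exact hN l hl
      · cases List.mem_singleton.1 hl; exact hnorm, ?_⟩
    -- the arrows that might not commute with `h` get their heads turned
    let c : Letter ι → Letter ι := fun l =>
      if l.tail = h.head ∧ l.head = h.tail then l.turn else l
    have hcT : ∀ m ∈ N, T (c m).tail ∧ (c m).On (flat xs) := by
      intro m hm
      have hm := hN m hm
      simp only [c]
      split_ifs
      · exact ⟨hm.tail, Letter.on_of_color hm.on.2.1 (rev_mem_flat.2 hm.on.2.2) hm.color⟩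
      · exact ⟨hm.tail, hm.on⟩
    have hconv : BFus xs N (N.map c).reverse := by
      apply BFus.conv
      · intro l hl
        simp only [c]
        split_ifs
        · exact BFus.turn hn (hN l hl).on (hN l hl).color
        · exact BFus.refl _
      · intro l hl m hm
        refine Comm.of_ne hn (hcT m hm).2 (hN l hl).on fun h1 _ => (hN l hl).head ?_
        rw [← h1]
        exact (hcT m hm).1
    have hcomm : ∀ m ∈ (N.map c).reverse, Comm (flat xs) m h := by
      intro m hm
      obtain ⟨l, hl, rfl⟩ := List.mem_map.1 (List.mem_reverse.1 hm)
      refine Comm.of_ne hn (hcT l hl).2 hh fun h1 h2 => ?_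
      simp only [c] at h1 h2
      split_ifs at h1 h2 with h3
      · rw [← h3.2] at h2
        exact Strand.rev_ne _ h2
      · exact h3 ⟨h1, h2⟩
    have hcomm' : ∀ m ∈ (N.map c).reverse, Comm (flat xs) m h' := by
      intro m hm
      obtain ⟨l, hl, rfl⟩ := List.mem_map.1 (List.mem_reverse.1 hm)
      refine Comm.of_ne hn (hcT l hl).2 hnorm.on fun h1 _ => hnorm.head ?_
      rw [← h1]
      exact (hcT l hl).1
    have h1 := hconv.right [h]
    have h2 := BFus.move hcomm []
    have h3 := hb.right (N.map c).reverse
    have h4 := BFus.move hcomm' []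
    have h5 := hconv.right [h']
    simp only [List.append_nil] at h2 h4
    exact h1.trans (h2.trans (h3.trans (h4.symm.trans h5.symm)))

/-- Every word of arrows above a family of minima is equivalent to a normal one. -/
theorem exists_normal {xs : List (Strand ι)} (hn : (flat xs).Nodup) {T : Strand ι → Prop}
    (hT : IsSide T) {W : List (Letter ι)} (hW : ∀ l ∈ W, l.On (flat xs)) :
    ∃ N, (∀ l ∈ N, l.Normal T (flat xs)) ∧ BFus xs W N := by
  induction W using List.reverseRecOn with
  | nil => exact ⟨[], by simp, BFus.refl _⟩
  | append_singleton W h ih =>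
    obtain ⟨N, h1, h2⟩ := ih fun l hl => hW l (by simp [hl])
    obtain ⟨N', h3, h4⟩ := exists_normal_step hn hT h1 (hW h (by simp))
    exact ⟨N', h3, (h2.right [h]).trans h4⟩

/-- All ends of arrows may be moved to the chosen sides of the local minima. -/
theorem exists_one_sided {xs : List (Strand ι)} (hn : (flat xs).Nodup) {T : Strand ι → Prop}
    (hT : IsSide T) {W : List (Letter ι)} (hW : ∀ l ∈ W, l.On (flat xs)) :
    ∃ N, (∀ l ∈ N, l.On (flat xs) ∧ T l.tail ∧ T l.head) ∧ BFus xs W N := by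
  obtain ⟨N, h1, h2⟩ := exists_normal hn hT hW
  have h3 : ∀ l ∈ N, l.turn.On (flat xs) := fun l hl =>
    Letter.on_of_color (h1 l hl).on.2.1 (rev_mem_flat.2 (h1 l hl).on.2.2) (h1 l hl).color
  refine ⟨(N.map Letter.turn).reverse, ?_, h2.trans (BFus.conv Letter.turn ?_ ?_)⟩
  · intro l hl
    obtain ⟨m, hm, rfl⟩ := List.mem_map.1 (List.mem_reverse.1 hl)
    exact ⟨h3 m hm, (h1 m hm).tail, (hT _).2 (h1 m hm).head⟩
  · exact fun l hl => BFus.turn hn (h1 l hl).on (h1 l hl).color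
  · intro l hl m hm
    refine Comm.of_ne hn (h3 m hm) (h1 l hl).on fun h _ => (h1 l hl).head ?_
    rw [← h]
    exact (h1 m hm).tail

/-- Normal arrows commute: a tail and a head never lie on the same strand. -/
theorem WFus.of_perm {s : List (Strand ι)} (hn : s.Nodup) {T : Strand ι → Prop}
    {N N' : List (Letter ι)} (h : N.Perm N') (hN : ∀ l ∈ N, l.Normal T s) : WFus s N N' := by
  induction h with
  | nil => exact WFus.refl _
  | cons l _ ih =>
    simpa using (ih fun l hl => hN l (by simp [hl])).congr [l] []
  | swap l m N =>
    have hl := hN l (by simp)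
    have hm := hN m (by simp)
    have : Comm s m l := Comm.of_ne hn hm.on hl.on fun h _ => hl.head (h ▸ hm.tail)
    exact WFus.congr this [] N
  | trans h _ ih ih' =>
    exact (ih hN).trans (ih' fun l hl => hN l (h.symm.subset hl))

theorem WFus.inv_word {s : List (Strand ι)} (hn : s.Nodup) (N : List (Letter ι)) :
    WFus s ((N.map Letter.inv).reverse ++ N) [] := by
  induction N with
  | nil => exact WFus.refl _
  | cons l N ih =>
    have := (WFus.inv' hn l).congr (N.map Letter.inv).reverse N
    simp at this ih ⊢
    exact this.trans ih

/-- The number of arrows from `x` to `y`, counted with signs. -/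
noncomputable def val (x y : Strand ι) (N : List (Letter ι)) : ℤ :=
  open Classical in
  (N.map fun l => if l.tail = x ∧ l.head = y then (if l.pos then 1 else -1) else 0).sum

@[simp] theorem val_nil (x y : Strand ι) : val x y [] = 0 := rfl

theorem val_cons (x y : Strand ι) (l : Letter ι) (N : List (Letter ι)) : val x y (l :: N) =
    val x y [l] + val x y N := by simp [val]

theorem val_append (x y : Strand ι) (N N' : List (Letter ι)) :
    val x y (N ++ N') = val x y N + val x y N' := by simp [val]

theorem val_perm (x y : Strand ι) {N N' : List (Letter ι)} (h : N.Perm N') :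
    val x y N = val x y N' := by
  unfold val
  exact (h.map _).sum_eq

theorem val_inv (x y : Strand ι) (l : Letter ι) : val x y [l.inv] = - val x y [l] := by
  obtain ⟨u, v, _ | _⟩ := l <;> simp [val, Letter.inv] <;> split_ifs <;> simp

theorem val_inv_word (x y : Strand ι) (N : List (Letter ι)) :
    val x y (N.map Letter.inv).reverse = - val x y N := by
  rw [val_perm x y (List.reverse_perm _)]
  induction N with
  | nil => simp
  | cons l N ih => rw [List.map_cons, val_cons, ih, val_inv, val_cons x y l N]; ring

/-- The words `W` and `W'` of arrows give equivalent stacks after a family of cups, up to the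
moves `R`. -/
def BEqv (R : Stack ι → Stack ι → Prop) (xs : List (Strand ι)) (W W' : List (Letter ι)) : Prop :=
  Eqv R [] (cups xs ++ real (flat xs) W) (cups xs ++ real (flat xs) W')

theorem BEqv.right {R : Stack ι → Stack ι → Prop} {xs : List (Strand ι)} {W W' : List (Letter ι)}
    (h : BEqv R xs W W') (V : List (Letter ι)) : BEqv R xs (W ++ V) (W' ++ V) := by
  have := Eqv.right h (real (flat xs) V)
  simpa [BEqv] using this

theorem BFus.mono {R : Stack ι → Stack ι → Prop} (hR : ∀ l r, FusedMove l r → R l r)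
    {xs : List (Strand ι)} {W W' : List (Letter ι)} (h : BFus xs W W') : BEqv R xs W W' :=
  Eqv.mono hR h

section Mod

variable {R : Stack ι → Stack ι → Prop} {n : ℕ} {xs : List (Strand ι)} {T : Strand ι → Prop}

/-- If `n` equal arrows vanish, then so does every normal word with all numbers of arrows
divisible by `n`. -/
theorem BEqv.of_dvd (hR : ∀ l r, FusedMove l r → R l r) (hn : (flat xs).Nodup)
    (hpow : ∀ l : Letter ι, l.Normal T (flat xs) → BEqv R xs (List.replicate n l) [])
    (N : List (Letter ι)) (hN : ∀ l ∈ N, l.Normal T (flat xs))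
    (hv : ∀ x y, (n : ℤ) ∣ val x y N) : BEqv R xs N [] := by
  classical
  induction hk : N.length using Nat.strong_induction_on generalizing N with
  | _ k ih =>
    subst hk
    rcases N with _ | ⟨l, N⟩
    · exact Eqv.refl _
    by_cases hl : l.inv ∈ N
    · -- `l` cancels with an inverse arrow
      obtain ⟨N', hp⟩ : ∃ N', N.Perm (l.inv :: N') := ⟨_, List.perm_cons_erase hl⟩
      have h1 := (BFus.of_wfus (WFus.of_perm hn (hp.cons l) hN)).mono hR
      have h2 := (BFus.of_wfus ((WFus.inv hn l).congr [] N')).mono hR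
      have h3 := ih N'.length (by have := hp.length_eq; simp at this ⊢; omega) N'
        (fun m hm => hN m (by
          have := hp.symm.subset (List.mem_cons_of_mem _ hm)
          simp [this]))
        (fun x y => by
          have h := hv x y
          rw [val_perm x y (hp.cons l), val_cons, val_cons x y l.inv, val_inv] at h
          simpa using h) rfl
      exact h1.trans (h2.trans h3)
    · -- all arrows parallel to `l` are equal to `l`
      have hcount : ∀ M : List (Letter ι), l.inv ∉ M →
          val l.tail l.head M = (if l.pos then 1 else -1) * (M.count l : ℤ) := by
        intro M
        induction M with
        | nil => simp
        | cons m M ihM =>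
          intro hM
          simp only [List.mem_cons, not_or] at hM
          rw [val_cons, ihM hM.2, List.count_cons]
          by_cases hml : m = l
          · subst hml; simp [val]; split_ifs <;> ring
          · have : ¬ (m.tail = l.tail ∧ m.head = l.head) := by
              rintro ⟨h1, h2⟩
              obtain ⟨x, y, e⟩ := l
              obtain ⟨x', y', e'⟩ := m
              simp only at h1 h2
              subst h1 h2
              cases e <;> cases e' <;> simp_all [Letter.inv]
            simp [val, this, hml]
      have hl' : l.inv ∉ l :: N := by
        simp only [List.mem_cons, not_or]
        refine ⟨fun h => ?_, hl⟩
        have := congrArg Letter.pos h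
        simp [Letter.inv] at this
      have h1 := hv l.tail l.head
      rw [hcount _ hl'] at h1
      have h2 : (n : ℤ) ∣ ((l :: N).count l : ℤ) := by
        split_ifs at h1
        · rwa [one_mul] at h1
        · rwa [neg_one_mul, Int.dvd_neg] at h1
      have h3 : n ∣ (l :: N).count l := Int.natCast_dvd_natCast.1 h2
      have h4 : 0 < (l :: N).count l := by simp
      have h5 : n ≤ (l :: N).count l := Nat.le_of_dvd h4 h3
      have hn0 : 0 < n := Nat.pos_of_dvd_of_pos h3 h4
      obtain ⟨N', hp⟩ := (List.replicate_sublist_iff.2 h5).exists_perm_append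
      have hlN := hN l (by simp)
      have h6 := (BFus.of_wfus (WFus.of_perm hn hp hN)).mono hR
      have h7 := (hpow l hlN).right N'
      have h8 := ih N'.length (by have := hp.length_eq; simp at this ⊢; omega) N'
        (fun m hm => hN m (hp.symm.subset (by simp [hm])))
        (fun x y => by
          have h := hv x y
          rw [val_perm x y hp, val_append] at h
          have h' : val x y (List.replicate n l) = n * val x y [l] := by
            simp [val]
          rw [h'] at h
          exact (Int.dvd_add_right (dvd_mul_right _ _)).1 h) rfl
      exact h6.trans (h7.trans h8)

/-- Normal words with congruent numbers of arrows are equivalent, if `n` equal arrows vanish. -/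
theorem BEqv.of_modEq (hR : ∀ l r, FusedMove l r → R l r) (hn : (flat xs).Nodup)
    (hpow : ∀ l : Letter ι, l.Normal T (flat xs) → BEqv R xs (List.replicate n l) [])
    {N N' : List (Letter ι)} (hN : ∀ l ∈ N, l.Normal T (flat xs))
    (hN' : ∀ l ∈ N', l.Normal T (flat xs)) (hv : ∀ x y, val x y N ≡ val x y N' [ZMOD n]) :
    BEqv R xs N N' := by
  have h1 : BEqv R xs (N ++ (N'.map Letter.inv).reverse) [] := by
    apply BEqv.of_dvd hR hn hpow
    · intro l hl
      rcases List.mem_append.1 hl with hl | hl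
      · exact hN l hl
      · obtain ⟨m, hm, rfl⟩ := List.mem_map.1 (List.mem_reverse.1 hl)
        exact (hN' m hm).inv
    · intro x y
      rw [val_append, val_inv_word, ← sub_eq_add_neg]
      exact (hv x y).symm.dvd
  have h2 := (BFus.of_wfus ((WFus.inv_word hn N').congr N [])).mono hR
  have h3 := h1.right N'
  simp at h2 h3
  exact h2.symm.trans h3

/-- It suffices to know that `n` equal arrows vanish for one of the two signs, and on the upward
sides of the local minima. -/
theorem BEqv.pow_of_up (hR : ∀ l r, FusedMove l r → R l r) (hn : (flat xs).Nodup)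
    (hpow : ∀ x y : Strand ι, x ∈ flat xs → y ∈ flat xs → x.up = true → y.up = true →
      x.color ≠ y.color → BEqv R xs (List.replicate n ⟨x, y, false⟩) [])
    {l : Letter ι} (hl : l.Normal (fun x => x.up = true) (flat xs)) :
    BEqv R xs (List.replicate n l) [] := by
  have hT : l.turn.On (flat xs) :=
    Letter.on_of_color hl.on.2.1 (rev_mem_flat.2 hl.on.2.2) hl.color
  have h1 : BFus xs (List.replicate n l) (List.replicate n l.turn) := by
    have := BFus.conv (xs := xs) Letter.turn (N := List.replicate n l)
      (fun m hm => by
        cases List.eq_of_mem_replicate hm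
        exact BFus.turn hn hl.on hl.color)
      (fun m hm m' hm' => by
        cases List.eq_of_mem_replicate hm
        cases List.eq_of_mem_replicate hm'
        refine Comm.of_ne hn hT hl.on fun h _ => hl.head ?_
        rw [← h]
        exact hl.tail)
    simpa using this
  refine (h1.mono hR).trans ?_
  have hhead : l.head.rev.up = true := by
    have := hl.head
    simpa using this
  have h2 := hpow l.tail l.head.rev hl.on.2.1 (rev_mem_flat.2 hl.on.2.2) hl.tail hhead hl.color
  rcases h : l.pos
  · have h3 := h2.right (List.replicate n l.turn)
    have h4 := (BFus.of_wfus (WFus.inv_word hn (List.replicate n l.turn))).mono hR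
    have h5 : l.turn.inv = ⟨l.tail, l.head.rev, false⟩ := by simp [Letter.turn, Letter.inv, h]
    simp [h5] at h4
    exact h3.symm.trans h4
  · have h5 : l.turn = ⟨l.tail, l.head.rev, false⟩ := by simp [Letter.turn, h]
    rw [h5]
    exact h2

end Mod

/-! ### Cups at the bottom, caps at the top -/

/-- A diagram that is closed below is equivalent to one that has its local minima at the bottom and
its local maxima at the top, with crossings in between. -/
theorem exists_plat {w : Stack ι} {t : List (Strand ι)} (hw : Fits [] w t) :
    ∃ xs ys β, Cr β ∧ Fits (flat xs) β (flat ys ++ t) ∧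
      Fus [] w (cups xs ++ (β ++ wd [] t (caps ys))) := by
  induction w using List.reverseRecOn generalizing t with
  | nil =>
    cases hw
    exact ⟨[], [], [], by simp, rfl, Eqv.refl _⟩
  | append_singleton w e ih =>
    obtain ⟨m, hw', rfl, rfl⟩ := fits_append.1 hw
    obtain ⟨xs, ys, β, h1, h2, h3⟩ := ih hw'
    obtain ⟨a, g, b⟩ := e
    have h4 := Eqv.left ((cups_fits xs).comp h2)
      (exchange (caps_fits ys) (Slice.fits ⟨a, g, b⟩))
    have h5 := h3.right [⟨a, g, b⟩]
    simp at h4 h5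
    have h6 := h5.trans h4
    have hs : Slice.bot ⟨a, g, b⟩ = a ++ (g.bot ++ b) := by simp [Slice.bot]
    have ht : Slice.top ⟨a, g, b⟩ = a ++ (g.top ++ b) := by simp [Slice.top]
    rw [hs] at h2
    rw [ht] at h6 ⊢
    cases g with
    | cross k x y =>
      refine ⟨xs, ys, β ++ [⟨flat ys ++ a, .cross k x y, b⟩], by simp [h1], h2.comp ?_, ?_⟩
      · have := slice_fits (flat ys ++ a) b (.cross k x y)
        simpa using this
      · simpa using h6
    | cap x =>
      have h7 := Eqv.mid ((cups_fits xs).comp h2)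
        (by simpa [Piece.bot] using cap_slide x (flat ys ++ a) b) (wd [] (a ++ b) (caps ys))
      refine ⟨xs, x :: ys, β ++ wd [] b (bl (flat ys ++ a) [x, x.rev]),
        by simp [h1, bl_vir, Vir.cr], h2.comp ?_, ?_⟩
      · have := (bl_fits (flat ys ++ a) [x, x.rev]).widenR b
        simpa [Piece.bot, Piece.top] using this
      · simp [caps, Piece.top] at h6 h7 ⊢
        exact h6.trans h7
    | cup x =>
      have hb : Fits (flat ys ++ a ++ x :: x.rev :: b) (wd [] b (bl (flat ys ++ a) [x, x.rev]))
          (x :: x.rev :: (flat ys ++ a ++ b)) := by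
        simpa using (bl_fits (flat ys ++ a) [x, x.rev]).widenR b
      obtain ⟨v, hv1, hv2, hv3, -⟩ := Vir.exists_inverse (by simp [bl_vir]) hb
      have h7 : Fus (flat ys ++ a ++ b) [⟨flat ys ++ a, .cup x, b⟩]
          (⟨[], .cup x, flat ys ++ a ++ b⟩ :: v) := by
        have h8 := (cup_slide x (flat ys ++ a) b).right v
        have h9 := Eqv.left (slice_cup_fits x (flat ys ++ a) b) hv3
        simp at h8 h9 ⊢
        exact h9.symm.trans h8
      have h2' : Fits (flat xs) β (flat ys ++ a ++ b) := by simpa [Piece.bot] using h2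
      have h8 := Eqv.mid ((cups_fits xs).comp h2') h7 (wd [] (a ++ (x :: x.rev :: b)) (caps ys))
      have h9 := Eqv.mid (cups_fits xs) (exchange_cup x h2').symm
        (v ++ wd [] (a ++ (x :: x.rev :: b)) (caps ys))
      refine ⟨x :: xs, ys, wd [x, x.rev] [] β ++ v, by simp [h1, hv1.cr], ?_, ?_⟩
      · have := (h2'.widenL [x, x.rev]).comp hv2
        simpa [Piece.top] using this
      · simp [cups, Piece.top] at h6 h8 h9 ⊢
        exact h6.trans (h8.trans h9)

/-! ### Change of the names of components -/

/-- Change the name of the component of a strand along `f`. -/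
def Strand.map (f : κ → ι) (x : Strand κ) : Strand ι := ⟨f x.color, x.up⟩

/-- Change the names of the components of a piece. -/
def Piece.map (f : κ → ι) : Piece κ → Piece ι
  | .cup x => .cup (x.map f)
  | .cap x => .cap (x.map f)
  | .cross k x y => .cross k (x.map f) (y.map f)

/-- Change the names of the components of a slice. -/
def Slice.map (f : κ → ι) (e : Slice κ) : Slice ι :=
  ⟨e.left.map (Strand.map f), e.piece.map f, e.right.map (Strand.map f)⟩

/-- Change the names of the components of a stack. If `mp f W = w`, then `W` is a refinement of the
names in `w`. -/
def mp (f : κ → ι) (w : Stack κ) : Stack ι := List.map (Slice.map f) w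

section Map

variable (f : κ → ι)

@[simp] theorem Strand.map_rev (x : Strand κ) : x.rev.map f = (x.map f).rev := rfl

@[simp] theorem Strand.map_color (x : Strand κ) : (x.map f).color = f x.color := rfl

@[simp] theorem Strand.map_up (x : Strand κ) : (x.map f).up = x.up := rfl

@[simp] theorem Piece.map_bot (g : Piece κ) : (g.map f).bot = g.bot.map (Strand.map f) := by
  cases g <;> simp [Piece.map, Piece.bot]

@[simp] theorem Piece.map_top (g : Piece κ) : (g.map f).top = g.top.map (Strand.map f) := by
  cases g <;> simp [Piece.map, Piece.top]

@[simp] theorem Slice.map_bot (e : Slice κ) : (e.map f).bot = e.bot.map (Strand.map f) := by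
  simp [Slice.bot, Slice.map]

@[simp] theorem Slice.map_top (e : Slice κ) : (e.map f).top = e.top.map (Strand.map f) := by
  simp [Slice.top, Slice.map]

@[simp] theorem mp_nil : mp f [] = [] := rfl

@[simp] theorem mp_cons (e : Slice κ) (w : Stack κ) : mp f (e :: w) = e.map f :: mp f w := rfl

@[simp] theorem mp_append (u v : Stack κ) : mp f (u ++ v) = mp f u ++ mp f v := by simp [mp]

@[simp] theorem mp_wd (a b : List (Strand κ)) (w : Stack κ) :
    mp f (wd a b w) = wd (a.map (Strand.map f)) (b.map (Strand.map f)) (mp f w) := by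
  simp [mp, wd, Slice.map, Slice.widen]

@[simp] theorem map_flat (xs : List (Strand κ)) :
    (flat xs).map (Strand.map f) = flat (xs.map (Strand.map f)) := by
  induction xs with
  | nil => rfl
  | cons x xs ih => simp [ih]

@[simp] theorem mp_cups (xs : List (Strand κ)) :
    mp f (cups xs) = cups (xs.map (Strand.map f)) := by
  induction xs with
  | nil => rfl
  | cons x xs ih => simp [cups, ih, Slice.map, Piece.map]

@[simp] theorem mp_caps (xs : List (Strand κ)) :
    mp f (caps xs) = caps (xs.map (Strand.map f)) := by
  induction xs with
  | nil => rfl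
  | cons x xs ih => simp [caps, ih, Slice.map, Piece.map]

@[simp] theorem mp_sl (z : Strand κ) (a : List (Strand κ)) :
    mp f (sl z a) = sl (z.map f) (a.map (Strand.map f)) := by
  induction a with
  | nil => rfl
  | cons x a ih => simp [sl, ih, Slice.map, Piece.map]

@[simp] theorem mp_bl (a s : List (Strand κ)) :
    mp f (bl a s) = bl (a.map (Strand.map f)) (s.map (Strand.map f)) := by
  induction a with
  | nil => rfl
  | cons z a ih => simp [bl, ih]

@[simp] theorem cr_mp {w : Stack κ} : Cr (mp f w) ↔ Cr w := by
  have : ∀ g : Piece κ, (∃ k x y, g.map f = .cross k x y) ↔ ∃ k x y, g = .cross k x y := by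
    intro g
    cases g <;> simp [Piece.map]
  simp [Cr, mp, Slice.map, this]

theorem mp_comp {κ' : Type} (g : κ' → κ) (w : Stack κ') : mp f (mp g w) = mp (f ∘ g) w := by
  simp only [mp, List.map_map]
  congr 1
  funext e
  obtain ⟨a, p, b⟩ := e
  cases p <;> simp [Slice.map, Piece.map, Strand.map]

variable {f}

theorem Stack.Fits.map {s t : List (Strand κ)} {w : Stack κ} (h : Fits s w t) :
    Fits (s.map (Strand.map f)) (mp f w) (t.map (Strand.map f)) := by
  induction w generalizing s with
  | nil => cases h; rfl
  | cons e w ih =>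
    obtain ⟨rfl, h⟩ := h
    exact ⟨by simp, by simpa [mp] using ih h⟩

theorem FusedMove.map {l r : Stack κ} (h : FusedMove l r) : FusedMove (mp f l) (mp f r) := by
  rcases h with h | h
  · left
    cases h with
    | interchange g h m =>
      simpa [Slice.map] using WeldedMove.interchange (g.map f) (h.map f) (m.map (Strand.map f))
    | R3 p q r h x y z => exact .R3 p q r h _ _ _
    | _ => constructor
  · right
    cases h <;> constructor

theorem Fus.map {s : List (Strand κ)} {w w' : Stack κ} (h : Fus s w w') :
    Fus (s.map (Strand.map f)) (mp f w) (mp f w') := by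
  induction h with
  | rel w w' h =>
    obtain ⟨a, b, p, q, u, v, l, r, h, h1, h2, h3, rfl, rfl⟩ := h
    refine .rel _ _ ⟨a.map (Strand.map f), b.map (Strand.map f), p.map (Strand.map f),
      q.map (Strand.map f), mp f u, mp f v, mp f l, mp f r, h.map, h1.map, h2.map, ?_, by simp,
      by simp⟩
    simpa using h3.map (f := f)
  | refl w => exact Eqv.refl _
  | symm _ _ _ ih => exact ih.symm
  | trans _ _ _ _ _ ih ih' => exact ih.trans ih'

end Map

theorem flat_injective {xs ys : List (Strand ι)} (h : flat xs = flat ys) : xs = ys := by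
  induction xs generalizing ys with
  | nil => cases ys <;> simp_all
  | cons x xs ih =>
    cases ys with
    | nil => simp at h
    | cons y ys =>
      simp at h
      rw [h.1, ih h.2.2]

theorem length_flat (xs : List (Strand ι)) : (flat xs).length = 2 * xs.length := by
  induction xs with
  | nil => rfl
  | cons x xs ih => simp [ih]; ring

theorem nodup_flat {xs : List (Strand ι)} : (flat xs).Nodup ↔ (xs.map Strand.color).Nodup := by
  induction xs with
  | nil => simp
  | cons x xs ih =>
    have h1 : x.color ∈ xs.map Strand.color ↔ x ∈ flat xs := by
      rw [mem_flat, List.mem_map]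
      constructor
      · rintro ⟨y, hy, hc⟩
        rcases Strand.eq_or_eq_rev hc with rfl | rfl
        · exact .inl hy
        · right; simpa using hy
      · rintro (h | h)
        · exact ⟨x, h, rfl⟩
        · exact ⟨_, h, rfl⟩
    simp only [flat_cons, List.map_cons, List.nodup_cons, List.mem_cons, rev_mem_flat, h1, ih]
    have := Strand.rev_ne x
    tauto

/-! ### Tagging the arcs -/

/-- Names of strands are transported from the bottom to the top through a stack of crossings. -/
theorem Cr.lift {f : κ → ι} {w : Stack ι} (hw : Cr w) {s : List (Strand κ)} {t : List (Strand ι)}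
    (hf : Fits (s.map (Strand.map f)) w t) :
    ∃ w' t', mp f w' = w ∧ t'.map (Strand.map f) = t ∧ Fits s w' t' := by
  induction w generalizing s with
  | nil => cases hf; exact ⟨[], s, rfl, rfl, rfl⟩
  | cons e w ih =>
    obtain ⟨hb, hf'⟩ := hf
    obtain ⟨⟨k, x, y, hp⟩, hw'⟩ := cr_cons.1 hw
    obtain ⟨a, g, b⟩ := e
    cases hp
    have hb : s.map (Strand.map f) = a ++ x :: y :: b := by
      simpa [Slice.bot, Piece.bot] using hb.symm
    obtain ⟨a', r, rfl, rfl, hr⟩ := List.map_eq_append_iff.1 hb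
    obtain ⟨x', r, rfl, rfl, hr'⟩ := List.map_eq_cons_iff.1 hr
    obtain ⟨y', b', rfl, rfl, rfl⟩ := List.map_eq_cons_iff.1 hr'
    obtain ⟨w', t', h1, h2, h3⟩ := ih hw' (s := a' ++ y' :: x' :: b')
      (by simpa [Slice.top, Piece.top] using hf')
    refine ⟨⟨a', .cross k x' y', b'⟩ :: w', t', by simp [h1, Slice.map, Piece.map], h2, ?_⟩
    exact (slice_cross_fits k x' y' a' b').comp h3

/-- A diagram has a plat form in which the arcs at the bottom have names of their own. -/
theorem exists_tagged {w : Stack ι} (hw : Fits [] w []) :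
    ∃ (κ : Type) (f : κ → ι) (xs : List (Strand κ)) (ys : List (Strand ι)) (β : Stack κ)
      (t : List (Strand κ)), (flat xs).Nodup ∧ Cr β ∧ Fits (flat xs) β t ∧
        t.map (Strand.map f) = flat ys ∧ Fus [] w (mp f (cups xs ++ β) ++ caps ys) := by
  obtain ⟨xs, ys, β, h1, h2, h3⟩ := exists_plat hw
  -- the arc that starts at the `i`-th cup gets the name `i`
  let f : Fin xs.length → ι := fun i => xs[i].color
  let xs' : List (Strand (Fin xs.length)) := List.ofFn fun i => ⟨i, xs[i].up⟩
  have hxs : xs'.map (Strand.map f) = xs := by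
    rw [List.map_ofFn]
    exact List.ofFn_getElem
  obtain ⟨β', t, rfl, ht, hf⟩ := h1.lift (f := f) (s := flat xs') (by simpa [hxs] using h2)
  refine ⟨_, f, xs', ys, β', t, ?_, cr_mp f |>.1 h1, hf, by simpa using ht, ?_⟩
  · rw [nodup_flat, List.map_ofFn, List.nodup_ofFn]
    exact fun i j h => h
  · simpa [hxs] using h3

/-! ### Cancelling maxima against minima -/

theorem word_on {s t : List (Strand ι)} {w : Stack ι} (hs : s.Nodup) (hw : Cr w)
    (hf : Fits s w t) : ∀ l ∈ word w, l.On s := by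
  induction w generalizing s with
  | nil => simp [word]
  | cons e w ih =>
    obtain ⟨rfl, hf'⟩ := hf
    obtain ⟨hp, hw'⟩ := cr_cons.1 hw
    have he : e.bot.Perm e.top := Cr.perm (w := [e]) (by simpa using hp) (Slice.fits e)
    intro l hl
    rcases List.mem_append.1 (by simpa [word] using hl : l ∈ e.piece.word ++ word w) with hl | hl
    · obtain ⟨⟨k, x, y, hp⟩, -⟩ := cr_cons.1 hw
      obtain ⟨a, g, b⟩ := e
      cases hp
      have hxy : x ≠ y := by
        rintro rfl
        simp [Slice.bot, Piece.bot, List.nodup_append] at hs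
      rcases k with _ | _ | _
      · simp [Piece.word] at hl
      · simp [Piece.word] at hl
        simp [hl, Letter.On, Slice.bot, Piece.bot, hxy.symm]
      · simp [Piece.word] at hl
        simp [hl, Letter.On, Slice.bot, Piece.bot, hxy]
    · exact (ih (he.nodup hs) hw' hf' l hl).perm he.symm

/-- Either the strands at the top match the caps above, or one of the caps joins two strands of
different names. -/
theorem exists_mismatch {f : κ → ι} {t : List (Strand κ)} {ys : List (Strand ι)}
    (h : t.map (Strand.map f) = flat ys) : (∃ zs, t = flat zs) ∨
      ∃ a b z z' ya yb, t = a ++ z :: z' :: b ∧ ys = ya ++ z.map f :: yb ∧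
        a.map (Strand.map f) = flat ya ∧ b.map (Strand.map f) = flat yb ∧
        z'.map f = (z.map f).rev ∧ z' ≠ z.rev := by
  induction ys generalizing t with
  | nil => left; exact ⟨[], by simpa using h⟩
  | cons y ys ih =>
    obtain ⟨z, t, rfl, rfl, h'⟩ := List.map_eq_cons_iff.1 h
    obtain ⟨z', t, rfl, hz, h''⟩ := List.map_eq_cons_iff.1 h'
    by_cases hzz : z' = z.rev
    · subst hzz
      rcases ih h'' with ⟨zs, rfl⟩ | ⟨a, b, u, u', ya, yb, rfl, rfl, h1, h2, h3, h4⟩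
      · left; exact ⟨z :: zs, by simp⟩
      · right
        exact ⟨z :: z.rev :: a, b, u, u', z.map f :: ya, yb, by simp, by simp, by simp [h1], h2,
          h3, h4⟩
    · right
      exact ⟨[], t, z, z', [], ys, by simp, by simp, by simp, h'', hz, hzz⟩

/-- A maximum that joins the inner strands of two neighbouring minima cancels with one of them. -/
theorem cups_zigzag (y : Strand ι) (r : List (Strand ι)) :
    Fus [] (cups (y.rev :: y.rev :: r) ++ [⟨[y.rev], .cap y, y :: flat r⟩])
      (cups (y.rev :: r)) := by
  have h1 := (cups_insert y.rev [y.rev] r).right [⟨[y.rev], .cap y, y :: flat r⟩]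
  have h2 : Fus [y] [⟨[y], .cup y.rev, []⟩, ⟨[], .cap y, [y]⟩] [] :=
    Fus.of_welded (.zigzagLeft y) (t := [y])
      (by simp [Fits, Slice.bot, Slice.top, Piece.bot, Piece.top]) (by simp [Fits])
  have h3 := Eqv.left (cups_fits (y.rev :: r)) (by simpa using h2.widen [y.rev] (flat r))
  simp at h1 h3 ⊢
  exact h1.trans h3

/-- Every stack of crossings above a family of cups is equivalent to one that starts with a stack
not involving the inner strands `z`, `z'` of the first two cups. -/
theorem exists_avoiding {z z' : Strand κ} {r a b : List (Strand κ)} {β : Stack κ}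
    (hn : (flat (z.rev :: z' :: r)).Nodup) (hβ : Cr β)
    (hf : Fits (flat (z.rev :: z' :: r)) β (a ++ z :: z' :: b)) :
    ∃ γ v, Cr γ ∧ Fits (z.rev :: z'.rev :: flat r) γ (a ++ b) ∧ Vir v ∧
      Fits (z :: z' :: (a ++ b)) v (a ++ z :: z' :: b) ∧
      Fus (z :: z' :: (a ++ b)) (v ++ wd [] b (bl a [z, z'])) [] ∧
      Fus [] (cups (z.rev :: z' :: r) ++ β) (cups (z.rev :: z' :: r) ++
        (wd [] (z'.rev :: flat r) (bl [z.rev] [z, z']) ++ (wd [z, z'] [] γ ++ v))) := by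
  classical
  set X := z.rev :: z' :: r with hX
  have hfX : flat X = z.rev :: z :: z' :: z'.rev :: flat r := by simp [hX]
  have hc : z.color ≠ z'.color := by
    have := nodup_flat.1 hn
    simp [hX] at this
    tauto
  -- the sides `z.rev`, `z'.rev` are chosen at the first two minima, so that `z`, `z'` become free
  let T : Strand κ → Prop := fun x => if x.color = z.color then x = z.rev else
    if x.color = z'.color then x = z'.rev else x.up = true
  have hT : IsSide T := by
    have key : ∀ x w : Strand κ, x.color = w.color → (x.rev = w.rev ↔ ¬ x = w.rev) := by
      intro x w h
      rcases Strand.eq_or_eq_rev h with rfl | rfl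
      · simp [(Strand.rev_ne x).symm]
      · simp [(Strand.rev_ne w).symm]
    intro x
    simp only [T, Strand.rev_color]
    by_cases h1 : x.color = z.color
    · simpa [h1] using key x z h1
    by_cases h2 : x.color = z'.color
    · simpa [h2, hc.symm] using key x z' h2
    · simp [h1, h2]
  have hTz : ¬ T z := by simp [T, (Strand.rev_ne z).symm]
  have hTz' : ¬ T z' := by simp [T, hc.symm, (Strand.rev_ne z').symm]
  obtain ⟨W, hW1, hW2⟩ := exists_one_sided hn hT (word_on hn hβ hf)
  have hb : Fits (a ++ z :: z' :: b) (wd [] b (bl a [z, z'])) (z :: z' :: (a ++ b)) := by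
    simpa using (bl_fits a [z, z']).widenR b
  obtain ⟨v, hv1, hv2, -, hv4⟩ := Vir.exists_inverse (by simp [bl_vir]) hb
  set c := z.rev :: z'.rev :: flat r with hcdef
  have hv0 : Fits (flat X) (wd [] (z'.rev :: flat r) (bl [z.rev] [z, z'])) (z :: z' :: c) := by
    have := (bl_fits [z.rev] [z, z']).widenR (z'.rev :: flat r)
    simpa [hfX, hcdef] using this
  have hp0 : (flat X).Perm (z :: z' :: c) := Vir.cr (by simp [bl_vir]) |>.perm hv0
  have hp : c.Perm (a ++ b) := by
    have h1 := hp0.symm.trans ((hβ.perm hf).trans (Vir.cr (by simp [bl_vir]) |>.perm hb))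
    exact (List.perm_cons _).1 ((List.perm_cons _).1 h1)
  have hWc : ∀ l ∈ W, l.On c := by
    intro l hl
    obtain ⟨⟨h1, h2, h3⟩, h4, h5⟩ := hW1 l hl
    have key : ∀ x ∈ flat X, T x → x ∈ c := by
      intro x hx hTx
      have hx := hp0.subset hx
      rcases List.mem_cons.1 hx with rfl | hx
      · exact absurd hTx hTz
      rcases List.mem_cons.1 hx with rfl | hx
      · exact absurd hTx hTz'
      · exact hx
    exact ⟨h1, key _ h2 h4, key _ h3 h5⟩
  have hvp := vp_fits hp
  have hn0 := hp0.nodup hn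
  have hγv : Fits (z :: z' :: c) (wd [z, z'] [] (vp c (a ++ b))) (z :: z' :: (a ++ b)) :=
    hvp.widenL [z, z']
  refine ⟨real c W ++ vp c (a ++ b), v, by simp [real_cr, (vp_vir _ _).cr],
    (real_fits c W).comp hvp, hv1, hv2, hv4, ?_⟩
  have h1 := Eqv.left (cups_fits X) (hβ.fus_word hn hf
    (v := wd [] (z'.rev :: flat r) (bl [z.rev] [z, z']) ++ (wd [z, z'] [] (vp c (a ++ b)) ++ v))
    (by simp [bl_vir, vp_vir, hv1]) (hv0.comp (hγv.comp hv2)))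
  have h2 := Eqv.right hW2
    (wd [] (z'.rev :: flat r) (bl [z.rev] [z, z']) ++ (wd [z, z'] [] (vp c (a ++ b)) ++ v))
  have h3 := Eqv.mid (cups_fits X) (real_vir W hn (by simp [bl_vir]) hv0)
    (wd [z, z'] [] (vp c (a ++ b)) ++ v)
  have h4 : Fus (z :: z' :: c) (wd [z, z'] [] (real c W)) (real (z :: z' :: c) W) := by
    have := real_widen (a := [z, z']) (b := []) (s := c) (W := W) (by simpa using hn0) hWc
    simpa using this
  have h5 := Eqv.mid ((cups_fits X).comp hv0) h4.symm (wd [z, z'] [] (vp c (a ++ b)) ++ v)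
  simp only [List.append_assoc, wd_append] at h1 h2 h3 h5 ⊢
  exact h1.trans (h2.trans (h3.trans h5))

/-- A cap joining two different arcs is removed, and the two arcs become one. -/
theorem exists_reduction {f : κ → ι} {xs : List (Strand κ)} {ys : List (Strand ι)} {β : Stack κ}
    {t : List (Strand κ)} (hn : (flat xs).Nodup) (hβ : Cr β) (hf : Fits (flat xs) β t)
    (ht : t.map (Strand.map f) = flat ys) (hm : ¬ ∃ zs, t = flat zs) :
    ∃ (xs' : List (Strand κ)) (ys' : List (Strand ι)) (β' : Stack κ) (t' : List (Strand κ)),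
      xs'.length < xs.length ∧ (flat xs').Nodup ∧ Cr β' ∧ Fits (flat xs') β' t' ∧
        t'.map (Strand.map f) = flat ys' ∧
        Fus [] (mp f (cups xs ++ β) ++ caps ys) (mp f (cups xs' ++ β') ++ caps ys') := by
  classical
  obtain ⟨a, b, z, z', ya, yb, rfl, rfl, ha, hb, hz, hzz⟩ := (exists_mismatch ht).resolve_left hm
  have hpt := hβ.perm hf
  have hzmem : z ∈ flat xs := hpt.symm.subset (by simp)
  have hzmem' : z' ∈ flat xs := hpt.symm.subset (by simp)
  have hup : z'.up = !z.up := by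
    have := congrArg Strand.up hz
    simpa using this
  have hfc : f z'.color = f z.color := by
    have := congrArg Strand.color hz
    simpa using this
  obtain ⟨r, hp⟩ := exists_flat_perm_two hzmem' hzmem
    (fun h => by rw [h] at hup; simp at hup) (fun h => hzz (by simp [h]))
  have hnX := hp.symm.nodup hn
  have hX := cups_perm hnX (vp_vir _ _) (vp_fits hp)
  obtain ⟨γ, v, hγ, hγf, hv, hvf, hvinv, hγe⟩ := exists_avoiding hnX
    (β := vp (flat (z.rev :: z' :: r)) (flat xs) ++ β) (by simp [hβ, (vp_vir _ _).cr])
    ((vp_fits hp).comp hf)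
  have hcol : z.color ≠ z'.color ∧ z'.color ∉ r.map Strand.color := by
    have := nodup_flat.1 hnX
    simp only [List.map_cons, List.nodup_cons, List.mem_cons, not_or, Strand.rev_color] at this
    exact ⟨this.1.1, this.2.1⟩
  -- after the cancellation both arcs carry the name of `z`
  let g : κ → κ := fun c => if c = z'.color then z.color else c
  have hfg : f ∘ g = f := by
    funext c
    simp only [Function.comp, g]
    split_ifs with h
    · rw [h, hfc]
    · rfl
  have hgz : z.rev.map g = z.rev := by
    ext <;> simp [g, hcol.1]
  have hgz' : z'.rev.map g = z := by
    ext <;> simp [g, hup]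
  have hgr : (flat r).map (Strand.map g) = flat r := by
    have : r.map (Strand.map g) = r := by
      conv_rhs => rw [← List.map_id r]
      refine List.map_congr_left fun x hx => ?_
      have : x.color ≠ z'.color := fun h => hcol.2 (h ▸ List.mem_map_of_mem hx)
      ext <;> simp [g, this]
    rw [map_flat, this]
  refine ⟨z.rev :: r, ya ++ yb, mp g γ, (a ++ b).map (Strand.map g), ?_, ?_, by simpa using hγ,
    ?_, ?_, ?_⟩
  · have := hp.length_eq
    simp only [length_flat, List.length_cons] at this ⊢
    omega
  · rw [nodup_flat] at hnX ⊢
    simp only [List.map_cons, List.nodup_cons, List.mem_cons, not_or] at hnX ⊢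
    exact ⟨hnX.1.2, hnX.2.2⟩
  · have := hγf.map (f := g)
    simpa [hgz, hgz', hgr, -map_flat] using this
  · rw [List.map_map, show Strand.map f ∘ Strand.map g = Strand.map (ι := ι) (f ∘ g) from rfl, hfg]
    simp [ha, hb]
  · have e1 : Fus [] (cups xs ++ β) _ := (hX.right β).trans (by simpa using hγe)
    have e2 := (e1.map (f := f)).right (caps (ya ++ z.map f :: yb))
    set y := z.map f with hy
    have hyz : z'.map f = y.rev := hz
    have hyz' : z'.rev.map f = y := by rw [Strand.map_rev, hyz, Strand.rev_rev]
    have hcyz : z.rev.map f = y.rev := rfl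
    set R := r.map (Strand.map f) with hR
    have hγf' : Fits (y.rev :: y :: flat R) (mp f γ) (flat ya ++ flat yb) := by
      have := hγf.map (f := f)
      simpa [ha, hb, hyz', hyz, hcyz, hR] using this
    have hvf' : Fits (y :: y.rev :: (flat ya ++ flat yb)) (mp f v)
        (flat ya ++ y :: y.rev :: flat yb) := by
      have := hvf.map (f := f)
      simpa [ha, hb, hyz', hyz, hcyz, hR] using this
    have hvinv' : Fus (y :: y.rev :: (flat ya ++ flat yb))
        (mp f v ++ wd [] (flat yb) (bl (flat ya) [y, y.rev])) [] := by
      have := hvinv.map (f := f)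
      simpa [ha, hb, hyz', hyz, hcyz, hR] using this
    have hV0 : Fits (y.rev :: y :: y.rev :: y :: flat R)
        (wd [] (y :: flat R) (bl [y.rev] [y, y.rev])) (y :: y.rev :: y.rev :: y :: flat R) := by
      simpa using (bl_fits [y.rev] [y, y.rev]).widenR (y :: flat R)
    have hcR : Fits [] (cups (y.rev :: y.rev :: R)) (y.rev :: y :: y.rev :: y :: flat R) := by
      simpa using cups_fits (y.rev :: y.rev :: R)
    have hγw : Fits (y :: y.rev :: y.rev :: y :: flat R) (wd [y, y.rev] [] (mp f γ))
        (y :: y.rev :: (flat ya ++ flat yb)) := hγf'.widenL [y, y.rev]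
    -- the cap goes down through the virtual crossings `v` and past `γ`, and cancels with a cup
    have e3 := Eqv.left (hcR.comp (hV0.comp (hγw.comp hvf')))
      (by simpa using caps_insert y ya yb)
    have e4 : Fus (y :: y.rev :: (flat ya ++ flat yb)) (mp f v ++ [⟨flat ya, .cap y, flat yb⟩])
        [⟨[], .cap y, flat ya ++ flat yb⟩] := by
      have h1 := Eqv.left hvf' (cap_slide y (flat ya) (flat yb))
      have h2 := hvinv'.right [⟨[], .cap y, flat ya ++ flat yb⟩]
      simp only [List.append_assoc, List.nil_append] at h1 h2
      exact h1.trans h2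
    have e5 := Eqv.mid (hcR.comp (hV0.comp hγw)) e4 (caps (ya ++ yb))
    have e6 := Eqv.mid (hcR.comp hV0) (exchange_cap y hγf').symm (caps (ya ++ yb))
    have e7 := Eqv.mid hcR (cap_slide y [y.rev] (y :: flat R)).symm
      (mp f γ ++ caps (ya ++ yb))
    have e8 := (cups_zigzag y R).right (mp f γ ++ caps (ya ++ yb))
    have hgoal : mp f (mp g γ) = mp f γ := by rw [mp_comp, hfg]
    simp [hgoal, hyz', hyz, hcyz, ← hy, ← hR] at e2 e3 e5 e6 e7 e8 ⊢
    exact e2.trans (e3.trans (e5.trans (e6.trans (e7.trans e8))))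

/-- Every closed diagram is equivalent to one in which each circle has one minimum, at the bottom,
and one maximum, at the top, with crossings in between. In the tagged names all circles have
different names. -/
theorem exists_closed_plat {w : Stack ι} (hw : Fits [] w []) :
    ∃ (κ : Type) (f : κ → ι) (zs : List (Strand κ)) (β : Stack κ), (flat zs).Nodup ∧ Cr β ∧
      Fits (flat zs) β (flat zs) ∧ Fus [] w (mp f (cups zs ++ (β ++ caps zs))) := by
  obtain ⟨κ, f, xs, ys, β, t, hn, hβ, hf, ht, he⟩ := exists_tagged hw
  refine ⟨κ, f, ?_⟩
  induction hk : xs.length using Nat.strong_induction_on generalizing xs ys β t with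
  | _ k ih =>
    subst hk
    by_cases hm : ∃ zs, t = flat zs
    · obtain ⟨zs, rfl⟩ := hm
      have hys : zs.map (Strand.map f) = ys := flat_injective (by rw [← ht, map_flat])
      have hp := (hβ.perm hf).symm
      have hnz := hp.symm.nodup hn
      have h1 := (cups_perm hnz (vp_vir _ _) (vp_fits hp)).right β
      refine ⟨zs, vp (flat zs) (flat xs) ++ β, hnz, by simp [hβ, (vp_vir _ _).cr],
        (vp_fits hp).comp hf, he.trans ?_⟩
      have h2 := (Fus.map (f := f) h1).right (caps ys)
      simpa [hys] using h2
    · obtain ⟨xs', ys', β', t', hlt, h1, h2, h3, h4, h5⟩ := exists_reduction hn hβ hf ht hm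
      exact ih _ hlt xs' ys' β' t' h1 h2 h3 h4 (he.trans h5) rfl

/-! ### Transport of names along moves -/

theorem mp_eq_cons {f : κ → ι} {w : Stack κ} {e : Slice ι} {w' : Stack ι} :
    mp f w = e :: w' ↔ ∃ e₀ w₀, w = e₀ :: w₀ ∧ e₀.map f = e ∧ mp f w₀ = w' := by
  simp [mp, List.map_eq_cons_iff]

theorem mp_eq_nil {f : κ → ι} {w : Stack κ} : mp f w = [] ↔ w = [] := by simp [mp]

theorem Slice.map_eq {f : κ → ι} {e : Slice κ} {a b : List (Strand ι)} {g : Piece ι} :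
    e.map f = ⟨a, g, b⟩ ↔ ∃ a₀ g₀ b₀, e = ⟨a₀, g₀, b₀⟩ ∧ a₀.map (Strand.map f) = a ∧
      g₀.map f = g ∧ b₀.map (Strand.map f) = b := by
  obtain ⟨a', g', b'⟩ := e
  simp [Slice.map]

theorem Piece.map_eq_cup {f : κ → ι} {g : Piece κ} {x : Strand ι} :
    g.map f = .cup x ↔ ∃ x₀, g = .cup x₀ ∧ x₀.map f = x := by
  cases g <;> simp [Piece.map]

theorem Piece.map_eq_cap {f : κ → ι} {g : Piece κ} {x : Strand ι} :
    g.map f = .cap x ↔ ∃ x₀, g = .cap x₀ ∧ x₀.map f = x := by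
  cases g <;> simp [Piece.map]

theorem Piece.map_eq_cross {f : κ → ι} {g : Piece κ} {k : Kind} {x y : Strand ι} :
    g.map f = .cross k x y ↔ ∃ x₀ y₀, g = .cross k x₀ y₀ ∧ x₀.map f = x ∧ y₀.map f = y := by
  cases g <;> simp [Piece.map]

/-- Strands of component `c` occur in the stack. -/
def Has (w : Stack ι) (c : ι) : Prop := ∃ e ∈ w, ∃ x ∈ e.bot ++ e.top, x.color = c

@[simp] theorem not_has_nil (c : ι) : ¬ Has ([] : Stack ι) c := by simp [Has]

@[simp] theorem has_cons (e : Slice ι) (w : Stack ι) (c : ι) :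
    Has (e :: w) c ↔ (∃ x ∈ e.bot ++ e.top, x.color = c) ∨ Has w c := by
  simp [Has]

@[simp] theorem has_append (u v : Stack ι) (c : ι) : Has (u ++ v) c ↔ Has u c ∨ Has v c := by
  simp [Has, or_and_right, exists_or]

/-- Whenever the names in the stack `l` are refined, the names in `r` may be refined accordingly,
and no component is lost. -/
def Liftable (f : κ → ι) (l r : Stack ι) : Prop :=
  ∀ (s t : List (Strand κ)) (w : Stack κ), mp f w = l → Fits s w t →
    (∃ q, Fits (s.map (Strand.map f)) r q) →
    (∃ w', mp f w' = r ∧ Fits s w' t) ∧ ∀ c, Has w c → ∃ x ∈ s ++ t, x.color = c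

section

variable (f : κ → ι)

/-- All moves of the third kind: R3, VR3, VR4, OC and UC. -/
theorem liftable_triangle (p q r : Kind) (x y z : Strand ι) :
    Liftable f (triangleLeft p q r x y z) (triangleRight p q r x y z) ∧
      Liftable f (triangleRight p q r x y z) (triangleLeft p q r x y z) := by
  constructor
  · intro s t w hw hf _
    simp [triangleLeft, mp_eq_cons, mp_eq_nil, Slice.map_eq, Piece.map_eq_cross,
      List.map_eq_cons_iff] at hw
    obtain ⟨_, _, _, _, _, _, _, _, _, rfl, ⟨⟨rfl, rfl⟩, rfl⟩, _⟩ := hw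
    simp [Fits, Slice.bot, Slice.top, Piece.bot, Piece.top] at hf
    obtain ⟨rfl, ⟨rfl, rfl, rfl⟩, ⟨rfl, rfl, rfl⟩, rfl⟩ := hf
    refine ⟨⟨triangleRight p q r _ _ _, rfl, ?_⟩, ?_⟩
    · simp [triangleRight, Fits, Slice.bot, Slice.top, Piece.bot, Piece.top]
    · intro c
      simp [Slice.bot, Slice.top, Piece.bot, Piece.top]
      tauto
  · intro s t w hw hf _
    simp [triangleRight, mp_eq_cons, mp_eq_nil, Slice.map_eq, Piece.map_eq_cross,
      List.map_eq_cons_iff] at hw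
    obtain ⟨_, _, _, _, _, _, _, _, _, rfl, ⟨rfl, rfl, rfl⟩, _⟩ := hw
    simp [Fits, Slice.bot, Slice.top, Piece.bot, Piece.top] at hf
    obtain ⟨rfl, ⟨rfl, rfl, rfl⟩, ⟨rfl, rfl, rfl⟩, rfl⟩ := hf
    refine ⟨⟨triangleLeft p q r _ _ _, rfl, ?_⟩, ?_⟩
    · simp [triangleLeft, Fits, Slice.bot, Slice.top, Piece.bot, Piece.top]
    · intro c
      simp [Slice.bot, Slice.top, Piece.bot, Piece.top]
      tauto

theorem liftable_zigzagLeft (x : Strand ι) :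
    Liftable f [⟨[x], .cup x.rev, []⟩, ⟨[], .cap x, [x]⟩] [] ∧
      Liftable f [] [⟨[x], .cup x.rev, []⟩, ⟨[], .cap x, [x]⟩] := by
  constructor
  · intro s t w hw hf _
    simp [mp_eq_cons, mp_eq_nil, Slice.map_eq, Piece.map_eq_cup, Piece.map_eq_cap,
      List.map_eq_cons_iff] at hw
    obtain ⟨_, _, _, _, rfl, -⟩ := hw
    simp [Fits, Slice.bot, Slice.top, Piece.bot, Piece.top] at hf
    obtain ⟨rfl, ⟨rfl, rfl, rfl⟩, rfl⟩ := hf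
    refine ⟨⟨[], rfl, by simp [Fits]⟩, ?_⟩
    intro c
    simp [Slice.bot, Slice.top, Piece.bot, Piece.top]
  · intro s t w hw hf hr
    obtain rfl := mp_eq_nil.1 hw
    cases hf
    obtain ⟨q, hr⟩ := hr
    simp [Fits, Slice.bot, Slice.top, Piece.bot, Piece.top] at hr
    obtain ⟨y, _, rfl, rfl, h⟩ := List.map_eq_cons_iff.1 hr.1.symm
    obtain rfl := List.map_eq_nil_iff.1 h
    refine ⟨⟨[⟨[y], .cup y.rev, []⟩, ⟨[], .cap y, [y]⟩], rfl, ?_⟩, by simp⟩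
    simp [Fits, Slice.bot, Slice.top, Piece.bot, Piece.top]

theorem liftable_zigzagRight (x : Strand ι) :
    Liftable f [⟨[], .cup x, [x]⟩, ⟨[x], .cap x.rev, []⟩] [] ∧
      Liftable f [] [⟨[], .cup x, [x]⟩, ⟨[x], .cap x.rev, []⟩] := by
  constructor
  · intro s t w hw hf _
    simp [mp_eq_cons, mp_eq_nil, Slice.map_eq, Piece.map_eq_cup, Piece.map_eq_cap,
      List.map_eq_cons_iff] at hw
    obtain ⟨_, _, _, _, rfl, -⟩ := hw
    simp [Fits, Slice.bot, Slice.top, Piece.bot, Piece.top] at hf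
    obtain ⟨rfl, ⟨rfl, rfl, h⟩, rfl⟩ := hf
    simp at h
    subst h
    refine ⟨⟨[], rfl, by simp [Fits]⟩, ?_⟩
    intro c
    simp [Slice.bot, Slice.top, Piece.bot, Piece.top]
  · intro s t w hw hf hr
    obtain rfl := mp_eq_nil.1 hw
    cases hf
    obtain ⟨q, hr⟩ := hr
    simp [Fits, Slice.bot, Slice.top, Piece.bot, Piece.top] at hr
    obtain ⟨y, _, rfl, rfl, h⟩ := List.map_eq_cons_iff.1 hr.1.symm
    obtain rfl := List.map_eq_nil_iff.1 h
    refine ⟨⟨[⟨[], .cup y, [y]⟩, ⟨[y], .cap y.rev, []⟩], rfl, ?_⟩, by simp⟩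
    simp [Fits, Slice.bot, Slice.top, Piece.bot, Piece.top]

theorem liftable_capSlide (k k' : Kind) (x y : Strand ι) :
    Liftable f [⟨[x], .cross k y x.rev, []⟩, ⟨[], .cap x, [y]⟩]
        [⟨[], .cross k' x y, [x.rev]⟩, ⟨[y], .cap x, []⟩] ∧
      Liftable f [⟨[], .cross k' x y, [x.rev]⟩, ⟨[y], .cap x, []⟩]
        [⟨[x], .cross k y x.rev, []⟩, ⟨[], .cap x, [y]⟩] := by
  constructor
  · intro s t w hw hf _
    simp [mp_eq_cons, mp_eq_nil, Slice.map_eq, Piece.map_eq_cross, Piece.map_eq_cap,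
      List.map_eq_cons_iff] at hw
    obtain ⟨_, _, _, _, _, rfl, ⟨rfl, rfl, -⟩, -⟩ := hw
    simp [Fits, Slice.bot, Slice.top, Piece.bot, Piece.top] at hf
    obtain ⟨rfl, ⟨rfl, rfl, rfl⟩, rfl⟩ := hf
    refine ⟨⟨[⟨[], .cross k' _ _, [Strand.rev _]⟩, ⟨[_], .cap _, []⟩], rfl, ?_⟩, ?_⟩
    · simp [Fits, Slice.bot, Slice.top, Piece.bot, Piece.top]
    · intro c
      simp [Slice.bot, Slice.top, Piece.bot, Piece.top]
      tauto
  · intro s t w hw hf _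
    simp [mp_eq_cons, mp_eq_nil, Slice.map_eq, Piece.map_eq_cross, Piece.map_eq_cap,
      List.map_eq_cons_iff] at hw
    obtain ⟨_, _, _, _, _, rfl, ⟨⟨rfl, rfl⟩, -⟩, -⟩ := hw
    simp [Fits, Slice.bot, Slice.top, Piece.bot, Piece.top] at hf
    obtain ⟨rfl, ⟨rfl, rfl, rfl⟩, rfl⟩ := hf
    refine ⟨⟨[⟨[_], .cross k _ (Strand.rev _), []⟩, ⟨[], .cap _, [_]⟩], rfl, ?_⟩, ?_⟩
    · simp [Fits, Slice.bot, Slice.top, Piece.bot, Piece.top]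
    · intro c
      simp [Slice.bot, Slice.top, Piece.bot, Piece.top]
      tauto

theorem liftable_cupSlide (k k' : Kind) (x y : Strand ι) :
    Liftable f [⟨[y], .cup x, []⟩, ⟨[], .cross k y x, [x.rev]⟩]
        [⟨[], .cup x, [y]⟩, ⟨[x], .cross k' x.rev y, []⟩] ∧
      Liftable f [⟨[], .cup x, [y]⟩, ⟨[x], .cross k' x.rev y, []⟩]
        [⟨[y], .cup x, []⟩, ⟨[], .cross k y x, [x.rev]⟩] := by
  constructor
  · intro s t w hw hf _
    simp [mp_eq_cons, mp_eq_nil, Slice.map_eq, Piece.map_eq_cross, Piece.map_eq_cup,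
      List.map_eq_cons_iff] at hw
    obtain ⟨_, _, _, _, _, rfl, ⟨rfl, rfl⟩, -⟩ := hw
    simp [Fits, Slice.bot, Slice.top, Piece.bot, Piece.top] at hf
    obtain ⟨rfl, ⟨rfl, rfl, rfl⟩, rfl⟩ := hf
    refine ⟨⟨[⟨[], .cup _, [_]⟩, ⟨[_], .cross k' (Strand.rev _) _, []⟩], rfl, ?_⟩, ?_⟩
    · simp [Fits, Slice.bot, Slice.top, Piece.bot, Piece.top]
    · intro c
      simp [Slice.bot, Slice.top, Piece.bot, Piece.top]
      tauto
  · intro s t w hw hf _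
    simp [mp_eq_cons, mp_eq_nil, Slice.map_eq, Piece.map_eq_cross, Piece.map_eq_cup,
      List.map_eq_cons_iff] at hw
    obtain ⟨_, _, _, _, _, rfl, ⟨rfl, rfl⟩, -⟩ := hw
    simp [Fits, Slice.bot, Slice.top, Piece.bot, Piece.top] at hf
    obtain ⟨rfl, ⟨rfl, rfl, rfl⟩, rfl⟩ := hf
    refine ⟨⟨[⟨[_], .cup _, []⟩, ⟨[], .cross k _ _, [Strand.rev _]⟩], rfl, ?_⟩, ?_⟩
    · simp [Fits, Slice.bot, Slice.top, Piece.bot, Piece.top]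
    · intro c
      simp [Slice.bot, Slice.top, Piece.bot, Piece.top]
      tauto

/-- The moves R1 and VR1 at a maximum. -/
theorem liftable_curl_cap (k : Kind) (x : Strand ι) :
    Liftable f [⟨[], .cross k x x.rev, []⟩, ⟨[], .cap x.rev, []⟩] [⟨[], .cap x, []⟩] ∧
      Liftable f [⟨[], .cap x, []⟩] [⟨[], .cross k x x.rev, []⟩, ⟨[], .cap x.rev, []⟩] := by
  constructor
  · intro s t w hw hf _
    simp [mp_eq_cons, mp_eq_nil, Slice.map_eq, Piece.map_eq_cross, Piece.map_eq_cap] at hw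
    obtain ⟨_, _, _, rfl, ⟨rfl, -⟩, -⟩ := hw
    simp [Fits, Slice.bot, Slice.top, Piece.bot, Piece.top] at hf
    obtain ⟨rfl, ⟨rfl, rfl⟩, rfl⟩ := hf
    refine ⟨⟨[⟨[], .cap _, []⟩], rfl, ?_⟩, ?_⟩
    · simp [Fits, Slice.bot, Slice.top, Piece.bot, Piece.top]
    · intro c
      simp [Slice.bot, Slice.top, Piece.bot, Piece.top]
  · intro s t w hw hf _
    simp [mp_eq_cons, mp_eq_nil, Slice.map_eq, Piece.map_eq_cap] at hw
    obtain ⟨y, rfl, rfl⟩ := hw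
    simp [Fits, Slice.bot, Slice.top, Piece.bot, Piece.top] at hf
    obtain ⟨rfl, rfl⟩ := hf
    refine ⟨⟨[⟨[], .cross k y y.rev, []⟩, ⟨[], .cap y.rev, []⟩], rfl, ?_⟩, ?_⟩
    · simp [Fits, Slice.bot, Slice.top, Piece.bot, Piece.top]
    · intro c
      simp [Slice.bot, Slice.top, Piece.bot, Piece.top]

/-- The moves R1 and VR1 at a minimum. -/
theorem liftable_curl_cup (k : Kind) (x : Strand ι) :
    Liftable f [⟨[], .cup x, []⟩, ⟨[], .cross k x x.rev, []⟩] [⟨[], .cup x.rev, []⟩] ∧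
      Liftable f [⟨[], .cup x.rev, []⟩] [⟨[], .cup x, []⟩, ⟨[], .cross k x x.rev, []⟩] := by
  constructor
  · intro s t w hw hf _
    simp [mp_eq_cons, mp_eq_nil, Slice.map_eq, Piece.map_eq_cross, Piece.map_eq_cup] at hw
    obtain ⟨y, _, _, rfl, h, -⟩ := hw
    simp [Fits, Slice.bot, Slice.top, Piece.bot, Piece.top] at hf
    obtain ⟨rfl, ⟨rfl, rfl⟩, rfl⟩ := hf
    refine ⟨⟨[⟨[], .cup y.rev, []⟩], by simp [Slice.map, Piece.map, h], ?_⟩, ?_⟩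
    · simp [Fits, Slice.bot, Slice.top, Piece.bot, Piece.top]
    · intro c
      simp [Slice.bot, Slice.top, Piece.bot, Piece.top]
  · intro s t w hw hf _
    simp [mp_eq_cons, mp_eq_nil, Slice.map_eq, Piece.map_eq_cup] at hw
    obtain ⟨y, rfl, h⟩ := hw
    simp [Fits, Slice.bot, Slice.top, Piece.bot, Piece.top] at hf
    obtain ⟨rfl, rfl⟩ := hf
    refine ⟨⟨[⟨[], .cup y.rev, []⟩, ⟨[], .cross k y.rev y, []⟩],
      by simp [Slice.map, Piece.map, h], ?_⟩, ?_⟩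
    · simp [Fits, Slice.bot, Slice.top, Piece.bot, Piece.top]
    · intro c
      simp [Slice.bot, Slice.top, Piece.bot, Piece.top]

/-- The moves R2 and VR2. -/
theorem liftable_double (k k' : Kind) (x y : Strand ι) :
    Liftable f [⟨[], .cross k x y, []⟩, ⟨[], .cross k' y x, []⟩] [] ∧
      Liftable f [] [⟨[], .cross k x y, []⟩, ⟨[], .cross k' y x, []⟩] := by
  constructor
  · intro s t w hw hf _
    simp [mp_eq_cons, mp_eq_nil, Slice.map_eq, Piece.map_eq_cross] at hw
    obtain ⟨_, _, _, _, rfl, -⟩ := hw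
    simp [Fits, Slice.bot, Slice.top, Piece.bot, Piece.top] at hf
    obtain ⟨rfl, ⟨rfl, rfl⟩, rfl⟩ := hf
    refine ⟨⟨[], rfl, by simp [Fits]⟩, ?_⟩
    intro c
    simp [Slice.bot, Slice.top, Piece.bot, Piece.top]
    tauto
  · intro s t w hw hf hr
    obtain rfl := mp_eq_nil.1 hw
    cases hf
    obtain ⟨q, hr⟩ := hr
    simp [Fits, Slice.bot, Slice.top, Piece.bot, Piece.top] at hr
    obtain ⟨u, _, rfl, rfl, h⟩ := List.map_eq_cons_iff.1 hr.1.symm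
    obtain ⟨v, _, rfl, rfl, h'⟩ := List.map_eq_cons_iff.1 h
    obtain rfl := List.map_eq_nil_iff.1 h'
    refine ⟨⟨[⟨[], .cross k u v, []⟩, ⟨[], .cross k' v u, []⟩], rfl, ?_⟩, by simp⟩
    simp [Fits, Slice.bot, Slice.top, Piece.bot, Piece.top]

theorem liftable_interchange (g h : Piece ι) (m : List (Strand ι)) :
    Liftable f [⟨[], g, m ++ h.bot⟩, ⟨g.top ++ m, h, []⟩]
        [⟨g.bot ++ m, h, []⟩, ⟨[], g, m ++ h.top⟩] ∧
      Liftable f [⟨g.bot ++ m, h, []⟩, ⟨[], g, m ++ h.top⟩]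
        [⟨[], g, m ++ h.bot⟩, ⟨g.top ++ m, h, []⟩] := by
  constructor
  · intro s t w hw hf _
    simp only [mp_eq_cons, mp_eq_nil, Slice.map_eq, List.map_eq_nil_iff,
      List.map_eq_append_iff] at hw
    obtain ⟨_, _, rfl, ⟨_, g, _, rfl, rfl, rfl, m, hb, rfl, rfl, hhb⟩, _, _, rfl,
      ⟨_, h, _, rfl, ⟨gt, m', rfl, hgt, hm⟩, rfl, rfl⟩, rfl⟩ := hw
    simp only [Fits, Slice.bot, Slice.top, List.nil_append, List.append_nil] at hf
    obtain ⟨rfl, h1, rfl⟩ := hf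
    have h2 : gt.length = g.top.length := by
      have := congrArg List.length hgt
      simpa using this
    have h3 : m'.length = m.length := by
      have := congrArg List.length hm
      simpa using this
    simp only [List.append_assoc] at h1
    obtain ⟨rfl, h4⟩ := List.append_inj h1 h2
    obtain ⟨rfl, rfl⟩ := List.append_inj h4 h3
    refine ⟨⟨[⟨g.bot ++ m', h, []⟩, ⟨[], g, m' ++ h.top⟩], by simp [Slice.map], ?_⟩, ?_⟩
    · simp [Fits, Slice.bot, Slice.top]
    · intro c
      simp only [has_cons, not_has_nil, or_false, Slice.bot, Slice.top, List.mem_append]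
      grind
  · intro s t w hw hf _
    simp only [mp_eq_cons, mp_eq_nil, Slice.map_eq, List.map_eq_nil_iff,
      List.map_eq_append_iff] at hw
    obtain ⟨_, _, rfl, ⟨_, h, _, rfl, ⟨gb, m, rfl, hgb, rfl⟩, rfl, rfl⟩, _, _, rfl,
      ⟨_, g, _, rfl, rfl, rfl, m', ht, rfl, hm, hht⟩, rfl⟩ := hw
    simp only [Fits, Slice.bot, Slice.top, List.nil_append, List.append_nil] at hf
    obtain ⟨rfl, h1, rfl⟩ := hf
    have h2 : g.bot.length = gb.length := by
      have := congrArg List.length hgb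
      simpa using this.symm
    have h3 : m'.length = m.length := by
      have := congrArg List.length hm
      simpa using this
    simp only [List.append_assoc] at h1
    obtain ⟨rfl, h4⟩ := List.append_inj h1 h2
    obtain ⟨rfl, rfl⟩ := List.append_inj h4 h3
    refine ⟨⟨[⟨[], g, m' ++ h.bot⟩, ⟨g.top ++ m', h, []⟩], by simp [Slice.map], ?_⟩, ?_⟩
    · simp [Fits, Slice.bot, Slice.top]
    · intro c
      simp only [has_cons, not_has_nil, or_false, Slice.bot, Slice.top, List.mem_append]
      grind

variable {f}

theorem FusedMove.liftable {l r : Stack ι} (h : FusedMove l r) :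
    Liftable f l r ∧ Liftable f r l := by
  rcases h with h | h
  · cases h with
    | interchange g h m => exact liftable_interchange f g h m
    | zigzagLeft x => exact liftable_zigzagLeft f x
    | zigzagRight x => exact liftable_zigzagRight f x
    | capSlide k x y => exact liftable_capSlide f _ _ x y
    | cupSlide k x y => exact liftable_cupSlide f _ _ x y
    | R1cap o x => exact liftable_curl_cap f _ x
    | R1cup o x => exact liftable_curl_cup f _ x
    | VR1cap x => exact liftable_curl_cap f _ x
    | VR1cup x => exact liftable_curl_cup f _ x
    | R2 o x y => exact liftable_double f _ _ x y
    | VR2 x y => exact liftable_double f _ _ x y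
    | _ => exact liftable_triangle f _ _ _ _ _ _
  · cases h <;> exact liftable_triangle f _ _ _ _ _ _

/-- A refinement of the names in a widened stack comes from a refinement in the stack. -/
theorem exists_of_mp_eq_wd {a b : List (Strand κ)} {l : Stack ι} {w : Stack κ}
    {s m : List (Strand κ)} (hw : mp f w = wd (a.map (Strand.map f)) (b.map (Strand.map f)) l)
    (hf : Fits (a ++ s ++ b) w m) {q : List (Strand ι)} (hp : Fits (s.map (Strand.map f)) l q) :
    ∃ t w', w = wd a b w' ∧ mp f w' = l ∧ Fits s w' t ∧ m = a ++ t ++ b := by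
  induction l generalizing s w with
  | nil =>
    obtain rfl := mp_eq_nil.1 hw
    cases hf
    exact ⟨s, [], rfl, rfl, rfl, rfl⟩
  | cons e l ih =>
    obtain ⟨hp1, hp2⟩ := hp
    obtain ⟨a', g', b'⟩ := e
    simp only [wd_cons, mp_eq_cons, Slice.map_eq, List.map_eq_append_iff] at hw
    obtain ⟨_, w, rfl, ⟨_, g, _, rfl, ⟨a1, a2, rfl, ha1, rfl⟩, rfl, b1, b2, rfl, rfl, hb2⟩, hw⟩ :=
      hw
    obtain ⟨hf1, hf2⟩ := hf
    have ha : a1.length = a.length := by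
      have := congrArg List.length ha1
      simpa using this
    have hb : b2.length = b.length := by
      have := congrArg List.length hb2
      simpa using this
    simp only [Slice.bot, List.append_assoc] at hf1
    obtain ⟨rfl, hf3⟩ := List.append_inj hf1 ha
    simp only [← List.append_assoc] at hf3
    obtain ⟨rfl, rfl⟩ := List.append_inj' hf3 hb
    obtain ⟨t, w', rfl, rfl, h3, rfl⟩ := ih (s := a2 ++ g.top ++ b1) (w := w) hw
      (by simpa [Slice.top] using hf2) (by simpa [Slice.top] using hp2)
    refine ⟨t, ⟨a2, g, b1⟩ :: w', by simp, by simp [Slice.map], ⟨by simp [Slice.bot], ?_⟩, rfl⟩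
    simpa [Slice.top] using h3

theorem mp_eq_append {w : Stack κ} {u v : Stack ι} (h : mp f w = u ++ v) :
    ∃ u' v', w = u' ++ v' ∧ mp f u' = u ∧ mp f v' = v := by
  obtain ⟨u', v', h1, h2, h3⟩ := List.map_eq_append_iff.1 h
  exact ⟨u', v', h1, h2, h3⟩

theorem has_of_mem_top {s t : List (Strand κ)} {w : Stack κ} (hf : Fits s w t) {x : Strand κ}
    (hx : x ∈ t) : x ∈ s ∨ Has w x.color := by
  induction w generalizing s with
  | nil => cases hf; exact .inl hx
  | cons e w ih =>
    right
    rcases ih hf.2 with h | h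
    · exact has_cons _ _ _ |>.2 (.inl ⟨x, by simp [h], rfl⟩)
    · exact has_cons _ _ _ |>.2 (.inr h)

theorem has_of_mem_bot {s t : List (Strand κ)} {w : Stack κ} (hf : Fits s w t) {x : Strand κ}
    (hx : x ∈ s) : x ∈ t ∨ Has w x.color := by
  cases w with
  | nil => cases hf; exact .inl hx
  | cons e w =>
    right
    exact has_cons _ _ _ |>.2 (.inl ⟨x, by simp [hf.1, hx], rfl⟩)

theorem has_wd {a b : List (Strand κ)} {w : Stack κ} {c : κ} (h : Has (wd a b w) c) :
    Has w c ∨ ∃ x ∈ a ++ b, x.color = c := by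
  induction w with
  | nil => simp at h
  | cons e w ih =>
    simp only [wd_cons, has_cons, Slice.bot, Slice.top, List.mem_append] at h ⊢
    simp only [List.mem_append] at ih
    grind

/-- One move transports refined names of a closed diagram. -/
theorem lift_step {a b p q : List (Strand ι)} {u v l r : Stack ι} (hlr : Liftable f l r)
    (hl : Fits p l q) (hr : Fits p r q) (hu : Fits [] u (a ++ p ++ b)) {w : Stack κ}
    (hw : mp f w = u ++ wd a b l ++ v) (hf : Fits [] w []) :
    ∃ w', mp f w' = u ++ wd a b r ++ v ∧ Fits [] w' [] ∧ ∀ c, Has w c → Has w' c := by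
  obtain ⟨_, v, rfl, hw1, rfl⟩ := mp_eq_append hw
  obtain ⟨u, w, rfl, rfl, hw2⟩ := mp_eq_append hw1
  obtain ⟨m', hf', hv⟩ := fits_append.1 hf
  obtain ⟨m, hu', hw'⟩ := fits_append.1 hf'
  have hm := hu'.map.unique hu
  obtain ⟨a', b, rfl, ha, rfl⟩ := List.map_eq_append_iff.1 hm
  obtain ⟨a, s, rfl, rfl, rfl⟩ := List.map_eq_append_iff.1 ha
  obtain ⟨t, w, rfl, rfl, hwf, rfl⟩ := exists_of_mp_eq_wd hw2 hw' hl
  obtain ⟨⟨w', rfl, hwf'⟩, hc⟩ := hlr s t w rfl hwf ⟨q, hr⟩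
  refine ⟨u ++ wd a b w' ++ v, by simp, (hu'.comp (hwf'.widen a b)).comp hv, ?_⟩
  intro c h
  have key : (∃ x ∈ a ++ s ++ b, x.color = c) ∨ (∃ x ∈ a ++ t ++ b, x.color = c) →
      Has (u ++ wd a b w' ++ v) c := by
    rintro (⟨x, hx, rfl⟩ | ⟨x, hx, rfl⟩)
    · rcases has_of_mem_top hu' hx with h | h
      · simp at h
      · simp [h]
    · rcases has_of_mem_bot hv hx with h | h
      · simp at h
      · simp [h]
  simp only [has_append] at h
  rcases h with (h | h) | h
  · simp [h]
  · rcases has_wd h with h | ⟨x, hx, rfl⟩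
    · obtain ⟨x, hx, rfl⟩ := hc c h
      rcases List.mem_append.1 hx with hx | hx
      · exact key (.inl ⟨x, by simp [hx], rfl⟩)
      · exact key (.inr ⟨x, by simp [hx], rfl⟩)
    · refine key (.inl ⟨x, ?_, rfl⟩)
      simp at hx ⊢
      tauto
  · simp [h]

/-- Fused isotopies transport refined names of closed diagrams. -/
theorem Fus.lift {w w' : Stack ι} (h : Fus [] w w') :
    (∀ W : Stack κ, mp f W = w → Fits [] W [] →
      ∃ W', mp f W' = w' ∧ Fits [] W' [] ∧ ∀ c, Has W c → Has W' c) ∧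
    (∀ W : Stack κ, mp f W = w' → Fits [] W [] →
      ∃ W', mp f W' = w ∧ Fits [] W' [] ∧ ∀ c, Has W c → Has W' c) := by
  induction h with
  | rel w w' h =>
    obtain ⟨a, b, p, q, u, v, l, r, h, h1, h2, h3, rfl, rfl⟩ := h
    exact ⟨fun W hW hf => lift_step h.liftable.1 h1 h2 h3 hW hf,
      fun W hW hf => lift_step h.liftable.2 h2 h1 h3 hW hf⟩
  | refl w =>
    exact ⟨fun W hW hf => ⟨W, hW, hf, fun _ h => h⟩, fun W hW hf => ⟨W, hW, hf, fun _ h => h⟩⟩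
  | symm _ _ _ ih => exact ⟨ih.2, ih.1⟩
  | trans w1 w2 w3 _ _ ih ih' =>
    constructor
    · intro W hW hf
      obtain ⟨W', h1, h2, h3⟩ := ih.1 W hW hf
      obtain ⟨W'', h4, h5, h6⟩ := ih'.1 W' h1 h2
      exact ⟨W'', h4, h5, fun c hc => h6 c (h3 c hc)⟩
    · intro W hW hf
      obtain ⟨W', h1, h2, h3⟩ := ih'.2 W hW hf
      obtain ⟨W'', h4, h5, h6⟩ := ih.2 W' h1 h2
      exact ⟨W'', h4, h5, fun c hc => h6 c (h3 c hc)⟩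

end

/-! ### Circles and names -/

/-- The strands at level `k` of a closed diagram, that is, at the bottom of its `k`-th slice; there
are none above the last slice. -/
def level (w : Stack ι) (k : ℕ) : List (Strand ι) := (w[k]?.map Slice.bot).getD []

theorem level_eq {w : Stack ι} {k : ℕ} {e : Slice ι} (he : w[k]? = some e) :
    level w k = e.bot := by simp [level, he]

theorem level_succ {s : List (Strand ι)} {w : Stack ι} (hf : Fits s w []) {k : ℕ} {e : Slice ι}
    (he : w[k]? = some e) : level w (k + 1) = e.top := by
  induction w generalizing s k with
  | nil => simp at he
  | cons d w ih =>
    cases k with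
    | succ k => simpa [level] using ih hf.2 (by simpa using he)
    | zero =>
      obtain rfl : d = e := by simpa using he
      cases w with
      | nil => simpa [level] using (show d.top = [] from hf.2).symm
      | cons e' w => simpa [level] using hf.2.1

/-- Refined names are constant along the curves of the diagram. -/
theorem Stack.Joined.color_eq {f : κ → ι} {W : Stack κ} (hW : Fits [] W []) {P Q : ℕ × ℕ}
    (h : Joined (mp f W) P Q) :
    (level W P.1)[P.2]?.map Strand.color = (level W Q.1)[Q.2]?.map Strand.color := by
  have lift : ∀ {t : ℕ} {e : Slice ι}, (mp f W)[t]? = some e → ∃ e₀, W[t]? = some e₀ ∧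
      e₀.map f = e := by
    intro t e he
    simpa [mp] using he
  cases h with
  | left he hp =>
    obtain ⟨e, he', rfl⟩ := lift he
    simp only [Slice.map, List.length_map] at hp
    simp [level_eq he', level_succ hW he', Slice.bot, Slice.top, List.getElem?_append, hp]
  | right he hp =>
    obtain ⟨e, he', rfl⟩ := lift he
    have h1 : (e.map f).left.length = e.left.length := by simp [Slice.map]
    have h2 : (e.map f).piece.bot.length = e.piece.bot.length := by simp [Slice.map]
    have h3 : (e.map f).piece.top.length = e.piece.top.length := by simp [Slice.map]
    rw [h1, h2, h3]
    simp only [level_eq he', level_succ hW he', Slice.bot, Slice.top]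
    rw [List.getElem?_append_right (by simp), List.getElem?_append_right (by simp)]
    simp
  | cup he =>
    obtain ⟨e, he', h⟩ := lift he
    obtain ⟨a, g, b, rfl, rfl, hg, rfl⟩ := Slice.map_eq.1 h
    obtain ⟨x, rfl, rfl⟩ := Piece.map_eq_cup.1 hg
    simp [level_succ hW he', Slice.top, Piece.top]
  | cap he =>
    obtain ⟨e, he', h⟩ := lift he
    obtain ⟨a, g, b, rfl, rfl, hg, rfl⟩ := Slice.map_eq.1 h
    obtain ⟨x, rfl, rfl⟩ := Piece.map_eq_cap.1 hg
    simp [level_eq he', Slice.bot, Piece.bot]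
  | rising he =>
    obtain ⟨e, he', h⟩ := lift he
    obtain ⟨a, g, b, rfl, rfl, hg, rfl⟩ := Slice.map_eq.1 h
    obtain ⟨x, y, rfl, rfl, rfl⟩ := Piece.map_eq_cross.1 hg
    simp [level_eq he', level_succ hW he', Slice.bot, Slice.top, Piece.bot, Piece.top]
  | falling he =>
    obtain ⟨e, he', h⟩ := lift he
    obtain ⟨a, g, b, rfl, rfl, hg, rfl⟩ := Slice.map_eq.1 h
    obtain ⟨x, y, rfl, rfl, rfl⟩ := Piece.map_eq_cross.1 hg
    simp [level_eq he', level_succ hW he', Slice.bot, Slice.top, Piece.bot, Piece.top]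

/-- Every component that occurs in a closed diagram occurs on some level. -/
theorem Has.exists_level {s : List (Strand ι)} {w : Stack ι} (hf : Fits s w []) {c : ι}
    (h : Has w c) : ∃ (k p : ℕ) (e : Slice ι) (x : Strand ι), w[k]? = some e ∧ e.bot[p]? = some x ∧
      x.color = c := by
  induction w generalizing s with
  | nil => simp at h
  | cons e w ih =>
    by_cases hw : Has w c
    · obtain ⟨k, p, e, x, h1, h2, h3⟩ := ih hf.2 hw
      exact ⟨k + 1, p, e, x, by simpa using h1, h2, h3⟩
    · obtain ⟨x, hx, rfl⟩ := ((has_cons _ _ _).1 h).resolve_right hw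
      rcases List.mem_append.1 hx with hx | hx
      · obtain ⟨p, hp⟩ := List.mem_iff_getElem?.1 hx
        exact ⟨0, p, e, x, by simp, hp, rfl⟩
      · rcases has_of_mem_bot hf.2 hx with h | h
        · simp at h
        · exact absurd h hw

/-- All strands of a circle have the same refined name. -/
theorem Stack.OneCircle.color_eq {f : κ → ι} {W : Stack κ} (hW : Fits [] W []) {i : ι}
    (h : OneCircle (mp f W) i) {c c' : κ} (hc : Has W c) (hc' : Has W c') (hi : f c = i)
    (hi' : f c' = i) : c = c' := by
  have key : ∀ P Q, Relation.EqvGen (Joined (mp f W)) P Q →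
      (level W P.1)[P.2]?.map Strand.color = (level W Q.1)[Q.2]?.map Strand.color := by
    intro P Q hQ
    induction hQ with
    | rel _ _ h => exact h.color_eq hW
    | refl _ => rfl
    | symm _ _ _ ih => exact ih.symm
    | trans _ _ _ _ _ ih ih' => exact ih.trans ih'
  obtain ⟨P, -, hP⟩ := h
  have key' : ∀ c, Has W c → f c = i → (level W P.1)[P.2]?.map Strand.color = some c := by
    intro c hc hi
    obtain ⟨k, p, e, x, h1, h2, rfl⟩ := hc.exists_level hW
    rw [key P (k, p) (hP _ ⟨e.map f, x.map f, by simp [mp, h1], by simp [h2], hi⟩)]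
    simp [level_eq h1, h2]
  exact Option.some.inj ((key' c hc hi).symm.trans (key' c' hc' hi'))

theorem mp_id (w : Stack ι) : mp id w = w := by
  have h : (Strand.map id : Strand ι → Strand ι) = id := rfl
  have : (Slice.map id : Slice ι → Slice ι) = id := by
    funext e
    obtain ⟨a, g, b⟩ := e
    cases g <;> simp [Slice.map, Piece.map, h]
  simp [mp, this]

/-- A component that occurs in a stack of crossings occurs at its bottom. -/
theorem has_cr {s t : List (Strand ι)} {w : Stack ι} (hw : Cr w) (hf : Fits s w t) {c : ι}
    (h : Has w c) : ∃ x ∈ s, x.color = c := by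
  induction w generalizing s with
  | nil => simp at h
  | cons e w ih =>
    obtain ⟨rfl, hf'⟩ := hf
    obtain ⟨hp, hw'⟩ := cr_cons.1 hw
    have he : e.bot.Perm e.top := Cr.perm (w := [e]) (by simpa using hp) (Slice.fits e)
    rcases (has_cons _ _ _).1 h with ⟨x, hx, rfl⟩ | h
    · refine ⟨x, ?_, rfl⟩
      rcases List.mem_append.1 hx with hx | hx
      · exact hx
      · exact he.symm.subset hx
    · obtain ⟨x, hx, rfl⟩ := ih hw' hf' h
      exact ⟨x, he.symm.subset hx, rfl⟩

theorem has_cups {xs : List (Strand ι)} {c : ι} (h : Has (cups xs) c) :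
    ∃ x ∈ flat xs, x.color = c := by
  induction xs with
  | nil => simp [cups] at h
  | cons x xs ih =>
    simp only [cups, has_append, has_cons, not_has_nil, or_false] at h
    rcases h with h | ⟨y, hy, rfl⟩
    · obtain ⟨y, hy, rfl⟩ := ih h
      exact ⟨y, by simp [hy], rfl⟩
    · refine ⟨y, ?_, rfl⟩
      simp [Slice.bot, Slice.top, Piece.bot, Piece.top] at hy ⊢
      tauto

theorem has_caps {xs : List (Strand ι)} {c : ι} (h : Has (caps xs) c) :
    ∃ x ∈ flat xs, x.color = c := by
  induction xs with
  | nil => simp [caps] at h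
  | cons x xs ih =>
    simp only [caps, has_cons] at h
    rcases h with ⟨y, hy, rfl⟩ | h
    · refine ⟨y, ?_, rfl⟩
      simp [Slice.bot, Slice.top, Piece.bot, Piece.top] at hy ⊢
      tauto
    · obtain ⟨y, hy, rfl⟩ := ih h
      exact ⟨y, by simp [hy], rfl⟩

/-! ### Linking numbers -/

section Linking

variable [DecidableEq ι] (i j : ι)

theorem linking_vir {w : Stack ι} (hw : Vir w) : Stack.linking i j w = 0 := by
  induction w with
  | nil => rfl
  | cons e w ih =>
    obtain ⟨⟨x, y, hp⟩, hw'⟩ := vir_cons.1 hw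
    have := ih hw'
    simp only [Stack.linking, List.map_cons, List.sum_cons] at this ⊢
    rw [this, hp]
    rfl

theorem linking_arr {s : List (Strand ι)} {l : Letter ι} (hl : l.On s) :
    Stack.linking i j (arr s l) = if l.tail.color = i ∧ l.head.color = j then
      (if l.pos then 1 else -1) * (l.tail.eps * l.head.eps) else 0 := by
  rw [arr, dif_pos hl.exists_perm, Stack.linking_append, Stack.linking_append,
    linking_vir i j (vp_vir _ _), linking_vir i j (vp_vir _ _), wd, Stack.linking_widen]
  obtain ⟨x, y, _ | _⟩ := l <;> simp [Letter.stack, Stack.linking, Piece.linking, mul_comm]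

/-- A normal arrow is a crossing between an upward and a downward strand, hence its sign is
opposite to the one with which `val` counts it. -/
theorem linking_real {s : List (Strand ι)} {N : List (Letter ι)}
    (hN : ∀ l ∈ N, l.Normal (fun x => x.up = true) s) :
    Stack.linking i j (real s N) = - val ⟨i, true⟩ ⟨j, false⟩ N := by
  induction N with
  | nil => rfl
  | cons l N ih =>
    have hl := hN l (by simp)
    rw [real_cons, Stack.linking_append, linking_arr i j hl.on, ih fun l hl => hN l (by simp [hl]),
      val_cons]
    obtain ⟨⟨c, u⟩, ⟨d, u'⟩, e⟩ := l
    obtain rfl : u = true := hl.tail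
    obtain rfl : u' = false := by simpa using hl.head
    simp [val, Strand.eps]
    split_ifs <;> simp [add_comm]

theorem linking_cups (xs : List (Strand ι)) : Stack.linking i j (cups xs) = 0 := by
  induction xs with
  | nil => rfl
  | cons x xs ih =>
    rw [cups, Stack.linking_append, ih]
    simp [Stack.linking, Piece.linking]

theorem linking_caps (xs : List (Strand ι)) : Stack.linking i j (caps xs) = 0 := by
  induction xs with
  | nil => rfl
  | cons x xs ih =>
    have : Stack.linking i j (caps (x :: xs)) = 0 + Stack.linking i j (caps xs) := rfl
    rw [this, ih, add_zero]

variable {i j}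

theorem UCMove.linking_eq {l r : Stack ι} (h : UCMove l r) :
    l.linking i j = r.linking i j := by
  cases h <;>
    simp only [Stack.linking, triangleLeft, triangleRight, List.map_cons, List.map_nil,
      List.sum_cons, List.sum_nil] <;> ring

theorem FusedMove.linking_eq (hij : i ≠ j) {l r : Stack ι} (h : FusedMove l r) :
    l.linking i j = r.linking i j := by
  rcases h with h | h
  · exact h.linking_eq hij
  · exact h.linking_eq

theorem VMove.linking_modEq {n : ℕ} {l r : Stack ι} (h : VMove n l r) :
    l.linking i j ≡ r.linking i j [ZMOD n] := by
  obtain ⟨o, x, y, -, -⟩ := h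
  have : ∀ (m : ℕ) (w : Stack ι),
      Stack.linking i j (List.replicate m w).flatten = m * Stack.linking i j w := by
    intro m w
    induction m with
    | zero => simp [Stack.linking]
    | succ m ih =>
      rw [List.replicate_succ, List.flatten_cons, Stack.linking_append, ih]
      push_cast
      ring
  rw [this]
  exact (Int.modEq_zero_iff_dvd.2 (dvd_mul_right _ _)).symm

theorem Related.linking_modEq {n : ℤ} {R : Stack ι → Stack ι → Prop}
    (hR : ∀ l r, R l r → l.linking i j ≡ r.linking i j [ZMOD n]) {D D' : Diagram ι}
    (h : Related R D D') : D.stack.linking i j ≡ D'.stack.linking i j [ZMOD n] := by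
  induction h with
  | rel D D' h =>
    obtain ⟨a, b, u, v, l, r, hlr, h1, h2⟩ := h
    rw [h1, h2]
    simp only [Stack.linking_append, Stack.linking_widen]
    exact ((hR l r hlr).add_left _).add_right _
  | refl D => rfl
  | symm D D' _ ih => exact ih.symm
  | trans D D' D'' _ _ ih ih' => exact ih.trans ih'

end Linking

/-! ### The standard form of a diagram -/

/-- The list of all components, oriented upwards. -/
def std (μ : ℕ) : List (Strand (Fin μ)) := (List.finRange μ).map fun i => ⟨i, true⟩

theorem nodup_std (μ : ℕ) : (flat (std μ)).Nodup := by
  rw [nodup_flat]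
  have : (std μ).map Strand.color = List.finRange μ := by simp [std, Function.comp_def]
  rw [this]
  exact List.nodup_finRange μ

theorem mem_std {μ : ℕ} (x : Strand (Fin μ)) : x ∈ flat (std μ) := by
  obtain ⟨i, _ | _⟩ := x <;> simp [mem_flat, std, Strand.rev]

theorem isSide_up : IsSide (fun x : Strand ι => x.up = true) := by
  intro x
  simp

/-- Every diagram is equivalent to a standard one: a minimum for every component, arrows between
different components, and a maximum for every component. -/
theorem LinkDiagram.exists_std {μ : ℕ} (D : LinkDiagram μ) :
    ∃ N : List (Letter (Fin μ)), (∀ l ∈ N, l.Normal (fun x => x.up = true) (flat (std μ))) ∧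
      Fus [] D.stack (cups (std μ) ++ (real (flat (std μ)) N ++ caps (std μ))) := by
  obtain ⟨κ, f, zs, β, hn, hβ, hf, he⟩ := exists_closed_plat D.fits
  have hW : Fits [] (cups zs ++ (β ++ caps zs)) [] :=
    (cups_fits zs).comp (hf.comp (caps_fits zs))
  obtain ⟨W, hWD, hW1, hW2⟩ := (Fus.lift (f := f) he).2 _ rfl hW
  have hhas : ∀ x ∈ zs, Has W x.color := by
    intro x hx
    refine hW2 _ (has_append _ _ _ |>.2 (.inl ?_))
    rcases has_of_mem_top (cups_fits zs) (mem_flat.2 (.inl hx)) with h | h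
    · simp at h
    · exact h
  -- different circles belong to different components
  have hinj : ∀ x ∈ zs, ∀ y ∈ zs, f x.color = f y.color → x.color = y.color := by
    intro x hx y hy hxy
    have h1 := D.oneCircle (f x.color)
    rw [← hWD] at h1
    exact h1.color_eq hW1 (hhas x hx) (hhas y hy) rfl hxy.symm
  set ys := zs.map (Strand.map f) with hys
  have hny : (flat ys).Nodup := by
    rw [nodup_flat] at hn ⊢
    rw [hys, List.map_map, show Strand.color ∘ Strand.map f = f ∘ Strand.color from rfl,
      ← List.map_map]
    refine hn.map_on ?_
    intro c hc c' hc' hcc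
    obtain ⟨x, hx, rfl⟩ := List.mem_map.1 hc
    obtain ⟨y, hy, rfl⟩ := List.mem_map.1 hc'
    exact hinj x hx y hy hcc
  have hβ' : Fits (flat ys) (mp f β) (flat ys) := by simpa [hys] using hf.map (f := f)
  have he' : Fus [] D.stack (cups ys ++ (mp f β ++ caps ys)) := by simpa [hys] using he
  have hall : ∀ x : Strand (Fin μ), x ∈ flat ys := by
    intro x
    obtain ⟨P, ⟨e, y, h1, h2, h3⟩, -⟩ := D.oneCircle x.color
    have hD : Has D.stack x.color :=
      ⟨e, List.mem_of_getElem? h1, y, by simp [List.mem_of_getElem? h2], h3⟩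
    obtain ⟨W', hW', -, h4⟩ := (Fus.lift (f := id) he').1 _ (mp_id D.stack) D.fits
    rw [mp_id] at hW'
    subst hW'
    obtain ⟨z, hz, hc⟩ : ∃ z ∈ flat ys, z.color = x.color := by
      rcases (has_append _ _ _).1 (h4 _ hD) with h | h
      · exact has_cups h
      rcases (has_append _ _ _).1 h with h | h
      · exact has_cr ((cr_mp f).2 hβ) hβ' h
      · exact has_caps h
    rcases Strand.eq_or_eq_rev hc.symm with rfl | rfl
    · exact hz
    · exact rev_mem_flat.2 hz
  have hp : (flat (std μ)).Perm (flat ys) :=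
    (List.perm_ext_iff_of_nodup (nodup_std μ) hny).2 fun x => ⟨fun _ => hall x, fun _ => mem_std x⟩
  have h1 := (cups_perm (nodup_std μ) (vp_vir _ _) (vp_fits hp)).right (mp f β ++ caps ys)
  have hβ0 := (vp_fits hp).comp hβ'
  have h2 := Eqv.left ((cups_fits (std μ)).comp hβ0)
    (caps_perm hny (vp_vir _ _) (vp_fits hp.symm))
  have hβ1 := hβ0.comp (vp_fits hp.symm)
  have hcr : Cr (vp (flat (std μ)) (flat ys) ++ mp f β ++ vp (flat ys) (flat (std μ))) := by
    simp [(vp_vir _ _).cr, hβ]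
  have h3 := Eqv.mid (cups_fits (std μ))
    (hcr.fus_word (nodup_std μ) hβ1 (v := []) (by simp) rfl) (caps (std μ))
  obtain ⟨N, hN1, hN2⟩ := exists_normal (nodup_std μ) isSide_up (word_on (nodup_std μ) hcr hβ1)
  refine ⟨N, hN1, ?_⟩
  have h4 := Eqv.right hN2 (caps (std μ))
  simp only [List.append_assoc, List.append_nil] at h1 h2 h3 h4
  exact he'.trans (h1.trans (h2.trans (h3.trans h4)))

/-- `n` equal arrows vanish by a `V^n`-move. -/
theorem bEqv_replicate {n : ℕ} {R : Stack ι → Stack ι → Prop}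
    (hR : ∀ l r, FusedMove l r → R l r) (hV : ∀ l r, VMove n l r → R l r) {xs : List (Strand ι)}
    (hn : (flat xs).Nodup) {x y : Strand ι} (hx : x ∈ flat xs) (hy : y ∈ flat xs)
    (hxu : x.up = true) (hyu : y.up = true) (hxy : x.color ≠ y.color) :
    BEqv R xs (List.replicate n ⟨x, y, false⟩) [] := by
  obtain ⟨r, hp⟩ := (Letter.on_of_color (e := false) hx hy hxy).exists_perm
  simp only at hp
  have hnr := hp.nodup hn
  have hf : ∀ m, Fits [x, y] (List.replicate m (Letter.stack ⟨x, y, false⟩)).flatten [x, y] := by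
    intro m
    induction m with
    | zero => rfl
    | succ m ih => exact (Letter.stack_fits ⟨x, y, false⟩).comp ih
  have h1 : ∀ m, Fus (x :: y :: r)
      (wd [] r (List.replicate m (Letter.stack ⟨x, y, false⟩)).flatten)
      (real (x :: y :: r) (List.replicate m ⟨x, y, false⟩)) := by
    intro m
    induction m with
    | zero => exact Eqv.refl _
    | succ m ih =>
      have h2 := (arr_local ⟨x, y, false⟩ [] r hnr).right
        (wd [] r (List.replicate m (Letter.stack ⟨x, y, false⟩)).flatten)
      have h3 := Eqv.left (arr_fits (x :: y :: r) ⟨x, y, false⟩) ih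
      simp only [List.replicate_succ, List.flatten_cons, wd_append, real_cons]
      exact h2.trans h3
  have h2 : Eqv R [x, y] [] (List.replicate n (Letter.stack ⟨x, y, false⟩)).flatten :=
    Eqv.of_move (hV _ _ (.mk false x y hxu hyu)) (t := [x, y]) rfl (hf n)
  have h3 : Eqv R (x :: y :: r) (real (x :: y :: r) (List.replicate n ⟨x, y, false⟩)) [] :=
    ((h1 n).symm.mono hR).trans (h2.widenR r).symm
  have hv := vp_fits hp
  have h4 := ((real_vir (List.replicate n ⟨x, y, false⟩) hn (vp_vir _ _) hv).right
    (vp (x :: y :: r) (flat xs))).mono hR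
  have h5 : Fus (flat xs) (vp (flat xs) (x :: y :: r) ++ vp (x :: y :: r) (flat xs)) [] :=
    Vir.coherence hn (by simp [vp_vir]) (by simp) (hv.comp (vp_fits hp.symm)) rfl
  have h6 := (Eqv.left (real_fits (flat xs) (List.replicate n ⟨x, y, false⟩)) h5).mono hR
  have h7 := Eqv.mid hv h3 (vp (x :: y :: r) (flat xs))
  simp only [List.append_assoc, List.append_nil, List.nil_append] at h4 h6 h7
  exact Eqv.left (cups_fits xs) (h6.symm.trans (h4.trans (h7.trans (h5.mono hR))))

/-- Diagrams with congruent linking numbers are related, if `n` equal arrows vanish. -/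
theorem LinkDiagram.related_of_modEq {μ n : ℕ} {R : Stack (Fin μ) → Stack (Fin μ) → Prop}
    (hR : ∀ l r, FusedMove l r → R l r)
    (hpow : ∀ l : Letter (Fin μ), l.Normal (fun x => x.up = true) (flat (std μ)) →
      BEqv R (std μ) (List.replicate n l) []) {D D' : LinkDiagram μ}
    (h : ∀ i j, i ≠ j → D.stack.linking i j ≡ D'.stack.linking i j [ZMOD n]) :
    Related R D.toDiagram D'.toDiagram := by
  obtain ⟨N, hN, hD⟩ := D.exists_std
  obtain ⟨N', hN', hD'⟩ := D'.exists_std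
  have key : ∀ (D : LinkDiagram μ) (N : List (Letter (Fin μ))),
      (∀ l ∈ N, l.Normal (fun x => x.up = true) (flat (std μ))) →
      Fus [] D.stack (cups (std μ) ++ (real (flat (std μ)) N ++ caps (std μ))) →
      ∀ i j, i ≠ j → val ⟨i, true⟩ ⟨j, false⟩ N = - D.stack.linking i j := by
    intro D N hN hD i j hij
    -- congruence modulo `0` is equality
    have h1 := Related.linking_modEq (n := 0) (R := FusedMove) (i := i) (j := j)
      (fun l r h => by rw [h.linking_eq hij])
      (Eqv.related (D := D.toDiagram) (D' := ⟨_, hD.fits D.fits⟩) hD)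
    rw [Int.modEq_zero_iff] at h1
    rw [h1, Stack.linking_append, Stack.linking_append, linking_cups, linking_caps,
      linking_real i j hN]
    ring
  have hv : ∀ x y, val x y N ≡ val x y N' [ZMOD n] := by
    intro x y
    by_cases hxy : x.up = true ∧ y.up = false ∧ x.color ≠ y.color
    · obtain ⟨c, u⟩ := x
      obtain ⟨d, u'⟩ := y
      obtain ⟨rfl, rfl, hc⟩ := hxy
      rw [key D N hN hD c d hc, key D' N' hN' hD' c d hc]
      exact (h c d hc).neg
    · have h0 : ∀ N : List (Letter (Fin μ)),
          (∀ l ∈ N, l.Normal (fun x => x.up = true) (flat (std μ))) → val x y N = 0 := by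
        intro N hN
        refine List.sum_eq_zero ?_
        intro v hv
        obtain ⟨l, hl, rfl⟩ := List.mem_map.1 hv
        refine if_neg ?_
        rintro ⟨rfl, rfl⟩
        exact hxy ⟨(hN l hl).tail, by simpa using (hN l hl).head, (hN l hl).color⟩
      rw [h0 N hN, h0 N' hN']
  have h1 := Eqv.right (BEqv.of_modEq hR (nodup_std μ) hpow hN hN' hv) (caps (std μ))
  simp only [List.append_assoc] at h1
  exact Eqv.related ((hD.mono hR).trans (h1.trans (hD'.mono hR).symm))

theorem WeldedLink.linking_of_isDiagramOf {μ : ℕ} {D : LinkDiagram μ} {L : WeldedLink μ}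
    (h : IsDiagramOf D L) {i j : Fin μ} (hij : i ≠ j) :
    L.linking i j hij = D.stack.linking i j := by
  subst h
  rfl

end Welded

/-- The classification of `μ`-component welded links up to `V^n`-moves and UC-moves by the ordered
linking numbers modulo `n`, and the classification up to UC-moves by the ordered linking
numbers. -/
theorem theorem1p3 (μ : ℕ) (L L' : Welded.WeldedLink μ) :
    (∀ n : ℕ, 0 < n →
      (Welded.WeldedLink.VnUCEquivalent n L L' ↔
        ∀ (i j : Fin μ) (hij : i ≠ j), L.linking i j hij ≡ L'.linking i j hij [ZMOD (n : ℤ)])) ∧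
    (Welded.WeldedLink.UCEquivalent L L' ↔
      ∀ (i j : Fin μ) (hij : i ≠ j), L.linking i j hij = L'.linking i j hij) := by
  constructor
  · intro n _
    constructor
    · rintro ⟨D, D', hD, hD', h⟩ i j hij
      rw [Welded.WeldedLink.linking_of_isDiagramOf hD, Welded.WeldedLink.linking_of_isDiagramOf hD']
      refine h.linking_modEq fun l r hlr => ?_
      rcases hlr with hlr | hlr | hlr
      · rw [hlr.linking_eq hij]
      · rw [hlr.linking_eq]
      · exact hlr.linking_modEq
    · intro h
      obtain ⟨D, rfl⟩ := Quotient.exists_rep L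
      obtain ⟨D', rfl⟩ := Quotient.exists_rep L'
      have hR : ∀ l r : Welded.Stack (Fin μ), Welded.FusedMove l r →
          Welded.WeldedMove l r ∨ Welded.UCMove l r ∨ Welded.VMove n l r :=
        fun l r hlr => hlr.imp_right .inl
      exact ⟨D, D', rfl, rfl, Welded.LinkDiagram.related_of_modEq hR
        (fun l hl => Welded.BEqv.pow_of_up hR (Welded.nodup_std μ)
          (fun x y hx hy hxu hyu hxy => Welded.bEqv_replicate hR (fun l r hlr => .inr (.inr hlr))
            (Welded.nodup_std μ) hx hy hxu hyu hxy) hl) h⟩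
  · constructor
    · rintro ⟨D, D', hD, hD', h⟩ i j hij
      rw [Welded.WeldedLink.linking_of_isDiagramOf hD, Welded.WeldedLink.linking_of_isDiagramOf hD',
        ← Int.modEq_zero_iff]
      refine h.linking_modEq fun l r hlr => ?_
      rw [Welded.FusedMove.linking_eq hij hlr]
    · intro h
      obtain ⟨D, rfl⟩ := Quotient.exists_rep L
      obtain ⟨D', rfl⟩ := Quotient.exists_rep L'
      exact ⟨D, D', rfl, rfl, Welded.LinkDiagram.related_of_modEq (n := 0) (fun l r hlr => hlr)
        (fun l _ => Welded.Eqv.refl _) fun i j hij => Int.modEq_zero_iff.2 (h i j hij)⟩
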